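/- **Setting.** For $k\in\mathbb Z^2$ let $(\sigma_k x)_v=x_{v-k}$ be the shift on $\mathcal A^{\mathbb Z^2}$, $\mathcal A$ a finite discrete alphabet. An *extended symmetry* of a subshift $X\subseteq\mathcal A^{\mathbb Z^2}$ is a homeomorphism $f:X\to X$ for which there is $A\in \mathrm{GL}_2(\mathbb Z)$ with $f\circ\sigma_p=\sigma_{Ap}\circ f$ for all $p\in\mathbb Z^2$; these form a group $\mathrm{Sym}(X,\mathbb Z^2)$ under composition. $X$ is *strongly aperiodic* if $\sigma_k x=x$ with $x\in X$ implies $k=0$. Such an $X$ has a *fracture* in the direction $q\in\mathbb Z^2$ if there are $x^*\in X$, integers $k_1<k_2<\cdots$ and two disjoint half-planes $S^+,S^-\subset\mathbb Z^2$ (sets $\{v\in\mathbb Z^2:\langle \alpha,v\rangle\ge c\}$ with $0\ne\alpha\in\mathbb R^2$, $c\in\mathbb R$), both disjoint from $\mathbb Zq$, such that for each $j$ some $x^{(j)}\in X$ equals $x^*$ on $S^+$ and $\sigma_{k_jq}(x^*)$ on $S^-$. **The Robinson shift.** Its alphabet consists of the $28$ rotations and reflections of the following five tiles on the unit square. Four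 of them have a black arrow running from the midpoint of the top side (tail) to the midpoint of the bottom side (head), and black arrows that start (tails) at the midpoints of the left and right sides and end inside the tile; in addition they have: (1) no red arrows; (2) a red arrow from top to bottom at $x=\frac14$ and red arrows starting on the left and right sides at $y=\frac14$; (4) only the two red arrows starting on the left and right sides at $y=\frac14$; (5) only the red arrow from top to bottom at $x=\frac14$. Tile (3), the *cross*, has black arrow heads at the midpoints of all four sides and a red L-shaped arrow with one head on the top side at $x=\frac14$ and the other head on the right side at $y=\frac14$. The Robinson shift $X_{\rm Rob}$ is the set of all $x$ in the full shift over this alphabet such that (i) on the common side of any two adjacent tiles the red and black arrow heads of each tile meet exactly the arrow tails of the other, at the same point and of the same colour; (ii) for some $k\in\mathbb Z^2$ all tiles on $k+2\mathbb Z^2$ are rotations of the cross, and every other cross lies on $k+(1,1)+2\mathbb Z^2$. **Proposition.** $X_{\rm Rob}$ is strongly aperiodic, and the set of its directions of fracture is exactly $\mathbb Z e_1\cup\mathbb Z e_2$. Every $f\in\mathrm{Sym}(X_{\rm Rob},\mathbb Z^2)$ has a unique associated matrix $\psi(f)=A\in\mathrm{GL}_2(\mathbb Z)$, and $$\mathrm{Sym}(X_{\rm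 Rob},\mathbb Z^2)\cong\mathbb Z^2\rtimes D_4,$$ where $D_4$ is the dihedral group of order $8$, acting on $\mathbb Z^2$ as the group of matrices generated by $\begin{bmatrix}0&-1\\1&0\end{bmatrix}$ and $\begin{bmatrix}-1&0\\0&1\end{bmatrix}$. The isomorphism can be chosen so that $k\in\mathbb Z^2$ corresponds to $\sigma_k$, so that $\psi$ corresponds to the projection onto $D_4$, and so that these two generators correspond to the extended symmetries $$\rho(x)_{(i,j)}=\mathfrak R(x_{(j,-i)}),\qquad \mu(x)_{(i,j)}=\mathfrak M(x_{(-i,j)}),$$ where $\mathfrak R$ rotates each tile counterclockwise by $\frac\pi2$ and $\mathfrak M$ reflects each tile by exchanging left and right. -/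

import Mathlib

/-! ### Subshifts and their extended symmetries -/

/-- The shift action on configurations: `(σ_k x)_v = x_{v - k}`. -/
def shiftMap {d : ℕ} {𝒜 : Type*} (k : Fin d → ℤ) (x : (Fin d → ℤ) → 𝒜) : (Fin d → ℤ) → 𝒜 :=
  fun v => x (v - k)

/-- A `ℤ^d`-subshift over the alphabet `𝒜` (a finite set with the discrete topology): a closed,
shift-invariant set of configurations in the product space `𝒜^(ℤ^d)`. -/
structure Subshift (d : ℕ) (𝒜 : Type*) [TopologicalSpace 𝒜] where
  carrier : Set ((Fin d → ℤ) → 𝒜)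
  isClosed' : IsClosed carrier
  shift_mem' : ∀ (k : Fin d → ℤ) {x : (Fin d → ℤ) → 𝒜}, x ∈ carrier → shiftMap k x ∈ carrier

namespace Subshift

variable {d : ℕ} {𝒜 : Type*} [TopologicalSpace 𝒜]

/-- The points of a subshift, with the subspace topology. -/
abbrev Point (X : Subshift d 𝒜) : Type _ := {x : (Fin d → ℤ) → 𝒜 // x ∈ X.carrier}

/-- The shift action restricted to a subshift. -/
def shift (X : Subshift d 𝒜) (k : Fin d → ℤ) (x : X.Point) : X.Point :=
  ⟨shiftMap k x.1, X.shift_mem' k x.2⟩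

/-- All points have trivial stabilizer. -/
def StronglyAperiodic (X : Subshift d 𝒜) : Prop :=
  ∀ (x : X.Point) (k : Fin d → ℤ), X.shift k x = x → k = 0

/-- `f ∘ σ_p = σ_{A p} ∘ f` for all `p`. -/
def IsAMorphism (X : Subshift d 𝒜) (A : GL (Fin d) ℤ) (f : X.Point → X.Point) : Prop :=
  ∀ (p : Fin d → ℤ) (x : X.Point), f (X.shift p x) = X.shift (A.1.mulVec p) (f x)

/-- The group of extended symmetries, under composition. Since the point space is compact and
Hausdorff for a finite discrete alphabet, the continuous bijections are the homeomorphisms. -/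
def extendedSymmetry (X : Subshift d 𝒜) : Subgroup (X.Point ≃ₜ X.Point) where
  carrier := {f | ∃ A : GL (Fin d) ℤ, X.IsAMorphism A f}
  one_mem' := ⟨1, fun p x => by simp⟩
  mul_mem' := by
    rintro f g ⟨A, hA⟩ ⟨B, hB⟩
    refine ⟨A * B, fun p x => ?_⟩
    have h1 := hB p x
    have h2 := hA (B.1.mulVec p) (g x)
    change f (g (X.shift p x)) = X.shift _ (f (g x))
    rw [h1, h2, Matrix.mulVec_mulVec]
    rfl
  inv_mem' := by
    rintro f ⟨A, hA⟩
    refine ⟨A⁻¹, fun p x => ?_⟩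
    have h := hA ((A⁻¹).1.mulVec p) (f.symm x)
    rw [Matrix.mulVec_mulVec, ← Units.val_mul, mul_inv_cancel, Units.val_one,
      Matrix.one_mulVec, f.apply_symm_apply] at h
    change f.symm (X.shift p x) = X.shift _ (f.symm x)
    rw [← h, f.symm_apply_apply]

end Subshift

/-- The lattice points of a real (affine, closed) half-plane. -/
def IsLatticeHalfPlane (S : Set (Fin 2 → ℤ)) : Prop :=
  ∃ (α : Fin 2 → ℝ) (c : ℝ), α ≠ 0 ∧ S = {v | c ≤ ∑ i, α i * (v i : ℝ)}

/-- A two-dimensional subshift has a fracture in the direction `q` (a notion used for strongly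
aperiodic subshifts). -/
def Subshift.HasFracture {𝒜 : Type*} [TopologicalSpace 𝒜] (X : Subshift 2 𝒜)
    (q : Fin 2 → ℤ) : Prop :=
  ∃ (x : X.Point) (k : ℕ → ℤ) (S₁ S₂ : Set (Fin 2 → ℤ)),
    StrictMono k ∧ IsLatticeHalfPlane S₁ ∧ IsLatticeHalfPlane S₂ ∧
    Disjoint S₁ S₂ ∧ (∀ m : ℤ, m • q ∉ S₁) ∧ (∀ m : ℤ, m • q ∉ S₂) ∧
    ∀ j : ℕ, ∃ y : X.Point,
      (∀ v ∈ S₁, y.1 v = x.1 v) ∧ (∀ v ∈ S₂, y.1 v = (X.shift (k j • q) x).1 v)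

/-! ### The Robinson tiles -/

/-- Whether an arrow that meets a side of a tile ends there (head) or starts there (tail). -/
inductive ArrowEnd
  | head
  | tail
  deriving DecidableEq

/-- Head and tail exchanged. -/
def ArrowEnd.opp : ArrowEnd → ArrowEnd
  | head => tail
  | tail => head

/-- What is seen on one side of a unit tile: the black arrow at the midpoint of the side, and
possibly a red arrow at coordinate `1/4` (`low`) or `3/4` (`high`). Here the coordinate is the
`x`-coordinate on the north and south sides and the `y`-coordinate on the east and west sides, so
that two tiles that share a side use the same coordinate on it. -/
structure SideMarks where
  mid : ArrowEnd
  low : Option ArrowEnd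
  high : Option ArrowEnd
  deriving DecidableEq

/-- The marks that have to face `s` across a common side: at each of the three positions a head
meets a tail, and nothing meets nothing. -/
def SideMarks.opp (s : SideMarks) : SideMarks :=
  ⟨s.mid.opp, s.low.map ArrowEnd.opp, s.high.map ArrowEnd.opp⟩

/-- The side traversed backwards. -/
def SideMarks.flip (s : SideMarks) : SideMarks := ⟨s.mid, s.high, s.low⟩

/-- A unit square with marks on its four sides. -/
structure MarkedSquare where
  east : SideMarks
  north : SideMarks
  west : SideMarks
  south : SideMarks
  deriving DecidableEq

namespace MarkedSquare

/-- Counterclockwise rotation by `π/2`: `(x, y) ↦ (1 - y, x)`. -/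
def rot (t : MarkedSquare) : MarkedSquare where
  east := t.south
  north := t.east.flip
  west := t.north
  south := t.west.flip

/-- The reflection `(x, y) ↦ (1 - x, y)`. -/
def refl (t : MarkedSquare) : MarkedSquare where
  east := t.west
  north := t.north.flip
  west := t.east
  south := t.south.flip

/-- The cross: four black heads and a red two-headed L-shaped arrow from the north side (at
`x = 1/4`) to the east side (at `y = 1/4`). -/
def cross : MarkedSquare where
  east := ⟨.head, some .head, none⟩
  north := ⟨.head, some .head, none⟩
  west := ⟨.head, none, none⟩
  south := ⟨.head, none, none⟩

/-- The five Robinson tiles. Apart from the cross they have a black arrow from north to south and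
black arrows that start on the east and west sides and end inside the tile. In addition:
`0` has no red arrow; `1` has a red arrow from north to south at `x = 1/4` and red arrows from the
east and west sides at `y = 1/4`; `3` has only the latter two red arrows; `4` has only the former
red arrow. -/
def basic : Fin 5 → MarkedSquare
  | 0 => ⟨⟨.tail, none, none⟩, ⟨.tail, none, none⟩,
          ⟨.tail, none, none⟩, ⟨.head, none, none⟩⟩
  | 1 => ⟨⟨.tail, some .tail, none⟩, ⟨.tail, some .tail, none⟩,
          ⟨.tail, some .tail, none⟩, ⟨.head, some .head, none⟩⟩
  | 2 => cross
  | 3 => ⟨⟨.tail, some .tail, none⟩, ⟨.tail, none, none⟩,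
          ⟨.tail, some .tail, none⟩, ⟨.head, none, none⟩⟩
  | 4 => ⟨⟨.tail, none, none⟩, ⟨.tail, some .tail, none⟩,
          ⟨.tail, none, none⟩, ⟨.head, some .head, none⟩⟩

/-- The rotations and reflections of the five Robinson tiles. -/
def IsRobinson (t : MarkedSquare) : Prop :=
  ∃ (b : Fin 5) (i : Fin 4) (j : Fin 2), t = rot^[(i : ℕ)] (refl^[(j : ℕ)] (basic b))

/-- The rotations of the cross. -/
def IsCross (t : MarkedSquare) : Prop := ∃ i : Fin 4, t = rot^[(i : ℕ)] cross

theorem IsRobinson.rot {t : MarkedSquare} (h : t.IsRobinson) : t.rot.IsRobinson := by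
  obtain ⟨b, i, j, rfl⟩ := h
  revert b i j
  unfold IsRobinson
  decide

theorem IsRobinson.refl {t : MarkedSquare} (h : t.IsRobinson) : t.refl.IsRobinson := by
  obtain ⟨b, i, j, rfl⟩ := h
  revert b i j
  unfold IsRobinson
  decide

end MarkedSquare

/-- The alphabet of 28 Robinson tiles. A tile is determined by the marks on its four sides. -/
def RobinsonTile : Type := {t : MarkedSquare // t.IsRobinson}

instance : TopologicalSpace RobinsonTile := ⊥

instance : DiscreteTopology RobinsonTile := ⟨rfl⟩

instance : Finite RobinsonTile :=
  Finite.of_surjective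
    (fun b : Fin 5 × Fin 4 × Fin 2 =>
      (⟨_, b.1, b.2.1, b.2.2, rfl⟩ : {t : MarkedSquare // t.IsRobinson}))
    (by rintro ⟨_, b, i, j, rfl⟩; exact ⟨(b, i, j), rfl⟩)

/-- The tile rotated counterclockwise by `π/2`. -/
def RobinsonTile.rot (t : RobinsonTile) : RobinsonTile := ⟨t.1.rot, t.2.rot⟩

/-- The tile with east and west exchanged. -/
def RobinsonTile.refl (t : RobinsonTile) : RobinsonTile := ⟨t.1.refl, t.2.refl⟩

/-! ### The Robinson shift -/

/-- The nearest neighbour rule: across each common side, arrow heads meet arrow tails. -/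
def ArrowRule (x : (Fin 2 → ℤ) → RobinsonTile) : Prop :=
  ∀ v : Fin 2 → ℤ,
    (x (v + ![1, 0])).1.west = (x v).1.east.opp ∧ (x (v + ![0, 1])).1.south = (x v).1.north.opp

/-- There are only crosses on `k + 2ℤ²`, and all other crosses lie on `k + (1,1) + 2ℤ²`. -/
def CrossRule (k : Fin 2 → ℤ) (x : (Fin 2 → ℤ) → RobinsonTile) : Prop :=
  (∀ p : Fin 2 → ℤ, (x (k + 2 • p)).1.IsCross) ∧
  ∀ v : Fin 2 → ℤ, (x v).1.IsCross →
    (∃ p : Fin 2 → ℤ, v = k + 2 • p) ∨ (∃ p : Fin 2 → ℤ, v = k + ![1, 1] + 2 • p)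

/-- The set of configurations that obey the Robinson rules. -/
def robinsonSet : Set ((Fin 2 → ℤ) → RobinsonTile) :=
  {x | ArrowRule x ∧ ∃ k : Fin 2 → ℤ, CrossRule k x}

theorem CrossRule.add_two {k : Fin 2 → ℤ} {x : (Fin 2 → ℤ) → RobinsonTile}
    (h : CrossRule k x) (q : Fin 2 → ℤ) : CrossRule (k + 2 • q) x := by
  refine ⟨fun p => ?_, fun v hv => ?_⟩
  · have := h.1 (q + p)
    rwa [smul_add, ← add_assoc] at this
  · rcases h.2 v hv with ⟨p, rfl⟩ | ⟨p, rfl⟩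
    · exact Or.inl ⟨p - q, by rw [smul_sub]; abel⟩
    · exact Or.inr ⟨p - q, by rw [smul_sub]; abel⟩

theorem isClosed_arrowRule : IsClosed {x | ArrowRule x} := by
  have hc : ∀ (s : Set (RobinsonTile × RobinsonTile)) (v w : Fin 2 → ℤ),
      IsClosed {x : (Fin 2 → ℤ) → RobinsonTile | (x v, x w) ∈ s} := fun s v w =>
    (isClosed_discrete s).preimage ((continuous_apply v).prodMk (continuous_apply w))
  simp only [ArrowRule, Set.ofPred_forall, Set.ofPred_and]
  exact isClosed_iInter fun v =>
    (hc {s | s.1.1.west = s.2.1.east.opp} _ _).inter (hc {s | s.1.1.south = s.2.1.north.opp} _ _)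

theorem isClosed_crossRule (k : Fin 2 → ℤ) : IsClosed {x | CrossRule k x} := by
  have hc : ∀ (s : Set RobinsonTile) (v : Fin 2 → ℤ),
      IsClosed {x : (Fin 2 → ℤ) → RobinsonTile | x v ∈ s} := fun s v =>
    (isClosed_discrete s).preimage (continuous_apply v)
  simp only [CrossRule, Set.ofPred_forall, Set.ofPred_and]
  exact (isClosed_iInter fun p => hc {s | s.1.IsCross} _).inter
    (isClosed_iInter fun v => hc {s | s.1.IsCross →
      (∃ p : Fin 2 → ℤ, v = k + 2 • p) ∨ (∃ p : Fin 2 → ℤ, v = k + ![1, 1] + 2 • p)} v)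

theorem isClosed_robinsonSet : IsClosed robinsonSet := by
  have h : robinsonSet =
      {x | ArrowRule x} ∩ ⋃ k : Fin 2 → Fin 2, {x | CrossRule (fun i => ((k i : ℕ) : ℤ)) x} := by
    ext x
    simp only [robinsonSet, Set.mem_ofPred_eq, Set.mem_inter_iff, Set.mem_iUnion]
    refine and_congr_right fun _ => ⟨?_, fun ⟨k, hk⟩ => ⟨_, hk⟩⟩
    rintro ⟨k, hk⟩
    refine ⟨fun i => ⟨(k i % 2).toNat, by omega⟩, ?_⟩
    convert hk.add_two (fun i => -(k i / 2)) using 1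
    funext i
    change (((k i % 2).toNat : ℕ) : ℤ) = k i + 2 • (-(k i / 2))
    rw [two_nsmul]
    omega
  rw [h]
  exact isClosed_arrowRule.inter (isClosed_iUnion_of_finite fun k => isClosed_crossRule _)

theorem shiftMap_mem_robinsonSet (k : Fin 2 → ℤ) {x : (Fin 2 → ℤ) → RobinsonTile}
    (hx : x ∈ robinsonSet) : shiftMap k x ∈ robinsonSet := by
  obtain ⟨ha, l, hl⟩ := hx
  refine ⟨fun v => ?_, l + k, fun p => ?_, fun v hv => ?_⟩
  · have := ha (v - k)
    rw [sub_add_eq_add_sub, sub_add_eq_add_sub] at this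
    exact this
  · have := hl.1 p
    unfold shiftMap
    rwa [show l + k + 2 • p - k = l + 2 • p by abel]
  · rcases hl.2 (v - k) hv with ⟨p, hp⟩ | ⟨p, hp⟩
    · exact Or.inl ⟨p, by rw [sub_eq_iff_eq_add.mp hp]; abel⟩
    · exact Or.inr ⟨p, by rw [sub_eq_iff_eq_add.mp hp]; abel⟩

/-- The Robinson shift. -/
def robinsonShift : Subshift 2 RobinsonTile where
  carrier := robinsonSet
  isClosed' := isClosed_robinsonSet
  shift_mem' := shiftMap_mem_robinsonSet

/-! ### The semidirect product `ℤ² ⋊ D₄` -/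

/-- The rotation by `π/2`. -/
def rotMatrix : GL (Fin 2) ℤ :=
  ⟨!![0, -1; 1, 0], !![0, 1; -1, 0], by decide, by decide⟩

/-- The reflection that changes the sign of the first coordinate. -/
def reflMatrix : GL (Fin 2) ℤ :=
  ⟨!![-1, 0; 0, 1], !![-1, 0; 0, 1], by decide, by decide⟩

/-- The standard embedding of the dihedral group of order 8 into `GL₂(ℤ)`. -/
def dihedralMatrix : DihedralGroup 4 →* GL (Fin 2) ℤ where
  toFun
    | .r i => rotMatrix ^ i.val
    | .sr i => reflMatrix * rotMatrix ^ i.val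
  map_one' := rfl
  map_mul' := by
    decide

/-- `GL_d(ℤ)` acting on the (multiplicatively written) group `ℤ^d`. -/
def latticeAut (d : ℕ) : GL (Fin d) ℤ →* MulAut (Multiplicative (Fin d → ℤ)) where
  toFun A :=
    { toFun := fun v => Multiplicative.ofAdd (A.1.mulVec v.toAdd)
      invFun := fun v => Multiplicative.ofAdd ((A⁻¹).1.mulVec v.toAdd)
      left_inv := fun v => by
        simp only [toAdd_ofAdd, Matrix.mulVec_mulVec, ← Units.val_mul, inv_mul_cancel,
          Units.val_one, Matrix.one_mulVec, ofAdd_toAdd]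
      right_inv := fun v => by
        simp only [toAdd_ofAdd, Matrix.mulVec_mulVec, ← Units.val_mul, mul_inv_cancel,
          Units.val_one, Matrix.one_mulVec, ofAdd_toAdd]
      map_mul' := fun v w => by
        simp only [toAdd_mul, Matrix.mulVec_add, ofAdd_add] }
  map_one' := by
    ext v : 1
    change Multiplicative.ofAdd ((1 : Matrix (Fin d) (Fin d) ℤ).mulVec v.toAdd) = v
    simp
  map_mul' A B := by
    ext v : 1
    change Multiplicative.ofAdd ((A.1 * B.1).mulVec v.toAdd) =
      Multiplicative.ofAdd (A.1.mulVec (B.1.mulVec v.toAdd))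
    rw [Matrix.mulVec_mulVec]

/-- `ℤ² ⋊ D₄`, where `D₄` acts on `ℤ²` by its standard matrices. -/
abbrev LatticeDihedral : Type :=
  Multiplicative (Fin 2 → ℤ) ⋊[(latticeAut 2).comp dihedralMatrix] DihedralGroup 4

/-! Black arrows leave every cross, and red arrows tell which crosses face each other. The rules
force the crosses on a coset of 2ℤ² to combine by fours into squares of side 3 around a new cross,
these by fours into squares of side 7, and so on. A supertile of level n is a square of side 2^(n+1)
- 1. Up to the direction of its central cross it is a piece of one explicit hierarchical pattern,
`stdTile`, in which the tile at (i, j) is governed by the 2-adic levels of i and j. Four supertiles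
that open to a common centre always fill up to the next level (`IsSupertile.of_corners`). That such
foursomes exist at every level (`exists_parent`) rests on matching red arrows across the gaps
(`IsSupertile.hor_neighbour`), on the alignment of supertiles that open to each other
(`IsColumnLattice.aligned_of_east`) and on the combinatorics of lattices of centres
(`IsColumnLattice.isCoherent_or`).

The centres of level n form a coset of 2^(n+1)ℤ², except that the plane may be split along one
column, or one row, the same for all levels, with its two sides shifted along it
(`exists_hasShape`). This determines all tiles off the gaps and the central arms.

Aperiodicity: a period would move crosses of a huge supertile into its central column, which
contains no cross but the centre.

Fractures: two standard half-planes on the two sides of a column of plain tiles can slide along it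
by any even amount. In a direction off the axes, each half-plane reaches every column and every row.
At each level a Robinson tiling has a single phase for its columns or a single phase for its rows,
so one coordinate of the displacement is divisible by arbitrarily high powers of two
(`IsRobinsonTiling.eq_zero_or_eq_zero`).

Extended symmetries map directions of fracture to directions of fracture, so their matrices preserve
the union of the axes. There are eight such matrices, and rotation and reflection realise them all.
It remains to see that a symmetry g commuting with the shifts is a shift. By compactness g is local.
Let z be made of four standard quadrants separated by lines without red arrows. Changing z in row 0
only, or in column 0 only, changes g z only in a strip, and this forces a row and a column of gaps
of all levels in g z (`exists_hasRowPhase`). After a shift, g therefore fixes the standard pattern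
(`IsLocalPair.exists_fixesStd`). On tilings that are standard off a column and two half-rows, g can
only change marks along these lines. Counting the tiles with a given mark, and looking at tiles that
send an arrow sideways out of the column, shows that it changes nothing
(`IsStdPair.map_centerTiling`, `IsStdPair.map_fault`). Every finite window of a Robinson tiling
occurs in such a tiling (`HasWindowShape.exists_isFault`), so g is the identity. -/

/-! ### Tiles -/

namespace MarkedSquare

/-- The reflection `(x, y) ↦ (y, x)`. -/
def transpose (t : MarkedSquare) : MarkedSquare := ⟨t.north, t.east, t.south, t.west⟩

instance : DecidablePred IsRobinson := fun t => by unfold IsRobinson; infer_instance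

instance : DecidablePred IsCross := fun t => by unfold IsCross; infer_instance

theorem forall_isRobinson {p : MarkedSquare → Prop}
    (h : ∀ (b : Fin 5) (i : Fin 4) (j : Fin 2), p (rot^[(i : ℕ)] (refl^[(j : ℕ)] (basic b))))
    {t : MarkedSquare} (ht : t.IsRobinson) : p t := by
  obtain ⟨b, i, j, rfl⟩ := ht
  exact h b i j

@[simp] theorem transpose_transpose (t : MarkedSquare) : t.transpose.transpose = t := rfl

@[simp] theorem refl_refl (t : MarkedSquare) : t.refl.refl = t := rfl

theorem IsRobinson.transpose {t : MarkedSquare} (h : t.IsRobinson) : t.transpose.IsRobinson :=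
  forall_isRobinson (p := fun t => t.transpose.IsRobinson) (by decide) h

theorem IsCross.transpose {t : MarkedSquare} (h : t.IsCross) : t.transpose.IsCross := by
  obtain ⟨i, rfl⟩ := h
  revert i
  decide

theorem IsCross.refl {t : MarkedSquare} (h : t.IsCross) : t.refl.IsCross := by
  obtain ⟨i, rfl⟩ := h
  revert i
  decide

theorem IsCross.mid {t : MarkedSquare} (h : t.IsCross) :
    t.east.mid = .head ∧ t.north.mid = .head ∧ t.west.mid = .head ∧ t.south.mid = .head := by
  obtain ⟨i, rfl⟩ := h
  revert i
  decide

end MarkedSquare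

namespace SideMarks

/-- A side where a black arrow starts and no red arrow is seen. -/
def bareTail : SideMarks := ⟨.tail, none, none⟩

/-- A side where a black arrow ends and no red arrow is seen. -/
def bareHead : SideMarks := ⟨.head, none, none⟩

@[simp] theorem opp_opp (s : SideMarks) : s.opp.opp = s := by
  obtain ⟨a, b, c⟩ := s
  rcases a with _ | _ <;> rcases b with _ | (_ | _) <;> rcases c with _ | (_ | _) <;> rfl

@[simp] theorem opp_bareTail : bareTail.opp = bareHead := rfl

@[simp] theorem opp_bareHead : bareHead.opp = bareTail := rfl

theorem opp_inj {s t : SideMarks} : s.opp = t.opp ↔ s = t :=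
  ⟨fun h => by rw [← opp_opp s, h, opp_opp], fun h => by rw [h]⟩

theorem opp_mid_eq_head {s : SideMarks} : s.opp.mid = .head ↔ s.mid = .tail := by
  obtain ⟨a, b, c⟩ := s
  rcases a with _ | _ <;> simp [opp, ArrowEnd.opp]

theorem opp_mid_eq_tail {s : SideMarks} : s.opp.mid = .tail ↔ s.mid = .head := by
  obtain ⟨a, b, c⟩ := s
  rcases a with _ | _ <;> simp [opp, ArrowEnd.opp]

end SideMarks

/-! ### Local rigidity of the tiles: how some sides constrain the others -/

namespace MarkedSquare

open SideMarks

theorem ext_sides {t t' : MarkedSquare} (he : t.east = t'.east) (hn : t.north = t'.north)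
    (hw : t.west = t'.west) (hs : t.south = t'.south) : t = t' := by
  cases t
  cases t'
  simp_all

/-- A finite check over all pairs of tiles. This determinism is what allows rows and columns to be
filled in tile by tile. -/
theorem east_eq_of_west_north_south : ∀ (b : Fin 5) (i : Fin 4) (j : Fin 2) (b' : Fin 5)
    (i' : Fin 4) (j' : Fin 2),
    (rot^[(i : ℕ)] (refl^[(j : ℕ)] (basic b))).west =
      (rot^[(i' : ℕ)] (refl^[(j' : ℕ)] (basic b'))).west →
    (rot^[(i : ℕ)] (refl^[(j : ℕ)] (basic b))).north =
      (rot^[(i' : ℕ)] (refl^[(j' : ℕ)] (basic b'))).north →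
    (rot^[(i : ℕ)] (refl^[(j : ℕ)] (basic b))).south =
      (rot^[(i' : ℕ)] (refl^[(j' : ℕ)] (basic b'))).south →
    (rot^[(i : ℕ)] (refl^[(j : ℕ)] (basic b))).east =
      (rot^[(i' : ℕ)] (refl^[(j' : ℕ)] (basic b'))).east := by
  decide +kernel

/-- Three sides of a Robinson tile determine the fourth one. -/
theorem IsRobinson.ext_of_west {t t' : MarkedSquare} (h : t.IsRobinson) (h' : t'.IsRobinson)
    (hw : t.west = t'.west) (hn : t.north = t'.north) (hs : t.south = t'.south) : t = t' := by
  obtain ⟨b, i, j, rfl⟩ := h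
  obtain ⟨b', i', j', rfl⟩ := h'
  exact ext_sides (east_eq_of_west_north_south b i j b' i' j' hw hn hs) hn hw hs

theorem IsRobinson.ext_of_south {t t' : MarkedSquare} (h : t.IsRobinson) (h' : t'.IsRobinson)
    (hs : t.south = t'.south) (he : t.east = t'.east) (hw : t.west = t'.west) : t = t' := by
  have := h.transpose.ext_of_west h'.transpose hs he hw
  rw [← transpose_transpose t, this, transpose_transpose]

theorem IsRobinson.ext_of_east {t t' : MarkedSquare} (h : t.IsRobinson) (h' : t'.IsRobinson)
    (he : t.east = t'.east) (hn : t.north = t'.north) (hs : t.south = t'.south) : t = t' := by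
  have := h.refl.ext_of_west h'.refl he (congrArg SideMarks.flip hn) (congrArg SideMarks.flip hs)
  rw [← refl_refl t, this, refl_refl]

theorem IsRobinson.ext_of_north {t t' : MarkedSquare} (h : t.IsRobinson) (h' : t'.IsRobinson)
    (hn : t.north = t'.north) (he : t.east = t'.east) (hw : t.west = t'.west) : t = t' := by
  have := h.transpose.ext_of_east h'.transpose hn he hw
  rw [← transpose_transpose t, this, transpose_transpose]

/-- A tile crossed by a vertical black arrow carries equal marks on its east and west sides, and
the arrow goes through. -/
theorem IsRobinson.of_tails {t : MarkedSquare} (h : t.IsRobinson) (he : t.east.mid = .tail)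
    (hw : t.west.mid = .tail) : t.east = t.west ∧ t.north = t.south.opp := by
  revert he hw
  exact forall_isRobinson (p := fun t => t.east.mid = .tail → t.west.mid = .tail →
    t.east = t.west ∧ t.north = t.south.opp) (by decide) h

theorem IsRobinson.of_tails' {t : MarkedSquare} (h : t.IsRobinson) (hn : t.north.mid = .tail)
    (hs : t.south.mid = .tail) : t.north = t.south ∧ t.east = t.west.opp :=
  h.transpose.of_tails hn hs

/-- A red arrow that enters through the west side at height `1/4` keeps the black arrow of the
tile from ending on its north side. -/
theorem IsRobinson.north_tail {t : MarkedSquare} (h : t.IsRobinson)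
    (hw : t.west = ⟨.tail, some .tail, none⟩) : t.north.mid = .tail := by
  revert hw
  exact forall_isRobinson (p := fun t => t.west = ⟨.tail, some .tail, none⟩ →
    t.north.mid = .tail) (by decide) h

theorem IsRobinson.south_tail {t : MarkedSquare} (h : t.IsRobinson)
    (hw : t.west = ⟨.tail, none, some .tail⟩) : t.south.mid = .tail := by
  revert hw
  exact forall_isRobinson (p := fun t => t.west = ⟨.tail, none, some .tail⟩ →
    t.south.mid = .tail) (by decide) h

/-- Red arrows that come in from two opposite sides lie in the half of the tile towards which its
through-going black arrow points; `x = 3/4` is the eastern half. -/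
theorem IsRobinson.east_head {t : MarkedSquare} (h : t.IsRobinson)
    (hn : t.north = ⟨.tail, none, some .tail⟩) (hs : t.south = ⟨.tail, none, some .tail⟩) :
    t.east.mid = .head := by
  revert hn hs
  exact forall_isRobinson (p := fun t => t.north = ⟨.tail, none, some .tail⟩ →
    t.south = ⟨.tail, none, some .tail⟩ → t.east.mid = .head) (by decide) h

/-- If a black arrow ends on the south side of a tile other than a cross, none ends on its north
side. -/
theorem IsRobinson.north_tail_of_south_head {t : MarkedSquare} (h : t.IsRobinson)
    (hs : t.south.mid = .head) (hew : t.west.mid = .tail ∨ t.east.mid = .tail) :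
    t.north.mid = .tail := by
  revert hs hew
  exact forall_isRobinson (p := fun t => t.south.mid = .head →
    (t.west.mid = .tail ∨ t.east.mid = .tail) → t.north.mid = .tail) (by decide) h

theorem IsRobinson.isCross {t : MarkedSquare} (h : t.IsRobinson) (he : t.east.mid = .head)
    (hn : t.north.mid = .head) : t.IsCross := by
  revert he hn
  exact forall_isRobinson (p := fun t => t.east.mid = .head → t.north.mid = .head →
    t.IsCross) (by decide) h

end MarkedSquare

/-! ### The standard hierarchical pattern -/

/-- The marks on an edge of a row, seen from its west end, in terms of the position `q` of the edge
relative to the crosses of the row and of the position `o` of the row among rows of its level. -/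
def edgeMark (q o : ZMod 4) : SideMarks :=
  let e : ArrowEnd := if q = 1 ∨ q = 3 then .head else .tail
  let r : Option ArrowEnd := if q = 1 ∨ q = 2 then some e else none
  if o = 1 then ⟨e, r, none⟩ else ⟨e, none, r⟩

/-- The marks on the edge between `(i, j)` and `(i + 1, j)` in the standard pattern. -/
def lineMark (i j : ℤ) : SideMarks :=
  edgeMark ((i / 2 ^ padicValInt 2 j : ℤ) : ZMod 4) ((j / 2 ^ padicValInt 2 j : ℤ) : ZMod 4)

/-- The standard pattern; it obeys the Robinson rules off the axes. -/
def stdTile (i j : ℤ) : MarkedSquare :=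
  ⟨lineMark i j, lineMark j i, (lineMark (i - 1) j).opp, (lineMark (j - 1) i).opp⟩

theorem exists_eq_two_pow_mul {j : ℤ} (hj : j ≠ 0) : ∃ (b : ℕ) (o : ℤ), Odd o ∧ j = 2 ^ b * o := by
  obtain ⟨b, m, hm, h⟩ := Nat.exists_eq_two_pow_mul_odd (Int.natAbs_ne_zero.mpr hj)
  rcases Int.natAbs_eq j with h' | h'
  · exact ⟨b, m, by exact_mod_cast hm, by rw [h', h]; push_cast; ring⟩
  · exact ⟨b, -m, by simpa using (by exact_mod_cast hm : Odd (m : ℤ)),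
      by rw [h', h]; push_cast; ring⟩

theorem padicValInt_two_pow_mul (b : ℕ) {o : ℤ} (ho : Odd o) : padicValInt 2 (2 ^ b * o) = b := by
  have h2 : ¬ (2 : ℤ) ∣ o := by rwa [← even_iff_two_dvd, Int.not_even_iff_odd]
  have h0 : o ≠ 0 := by rintro rfl; simp at h2
  rw [padicValInt.mul (by positivity) h0,
    padicValInt.eq_zero_of_not_dvd (z := o) (by exact_mod_cast h2), add_zero]
  simp [padicValInt, Int.natAbs_pow]

theorem lineMark_eq (i : ℤ) (b : ℕ) {o : ℤ} (ho : Odd o) :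
    lineMark i (2 ^ b * o) = edgeMark ((i / 2 ^ b : ℤ) : ZMod 4) (o : ZMod 4) := by
  rw [lineMark, padicValInt_two_pow_mul b ho, Int.mul_ediv_cancel_left _ (by positivity)]

theorem cast_odd {o : ℤ} (ho : Odd o) : (o : ZMod 4) = 1 ∨ (o : ZMod 4) = 3 := by
  obtain ⟨k, rfl⟩ := ho
  push_cast
  generalize (k : ZMod 4) = k
  revert k
  decide

/-- Reflecting a row sends the edge `i` to the edge `-1 - i` and reads its arrow from the other end.
-/
theorem edgeMark_opp (q o : ZMod 4) : edgeMark (-1 - q) o = (edgeMark q o).opp := by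
  revert q o
  decide

theorem edgeMark_flip {q o : ZMod 4} (h : o = 1 ∨ o = 3) :
    edgeMark q (-o) = (edgeMark q o).flip := by
  revert q o
  decide

theorem two_pow_mul_sub_one_ediv (b : ℕ) (m : ℤ) : (2 ^ b * m - 1) / 2 ^ b = m - 1 := by
  have h : (0 : ℤ) < 2 ^ b := by positivity
  rw [Int.ediv_eq_iff_of_pos h]
  constructor <;> nlinarith

/-- An odd multiple of `2 ^ b` is not a multiple of `2 ^ a`, so the quotient does not jump there: a
line of level `a` carries the same marks before and after it crosses a line of lower level `b`. -/
theorem sub_one_ediv_of_odd {a b : ℕ} (hab : b < a) {o : ℤ} (ho : Odd o) :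
    (2 ^ b * o - 1) / 2 ^ a = (2 ^ b * o) / 2 ^ a := by
  obtain ⟨c, rfl⟩ := Nat.exists_eq_add_of_lt hab
  have h1 : (2 : ℤ) ^ (b + c + 1) = 2 ^ b * 2 ^ (c + 1) := by rw [← pow_add]; rfl
  have h2 : (0 : ℤ) < 2 ^ b := by positivity
  rw [h1, ← Int.ediv_ediv_of_nonneg h2.le, ← Int.ediv_ediv_of_nonneg h2.le,
    two_pow_mul_sub_one_ediv, Int.mul_ediv_cancel_left _ h2.ne']
  obtain ⟨k, rfl⟩ := ho
  rw [pow_succ', ← Int.ediv_ediv_of_nonneg (by norm_num),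
    ← Int.ediv_ediv_of_nonneg (by norm_num : (0 : ℤ) ≤ 2)]
  congr 1
  omega

theorem stdTile_transpose (i j : ℤ) : (stdTile i j).transpose = stdTile j i := rfl

theorem stdTile_eq_cross (b : ℕ) {m o : ℤ} (hm : Odd m) (ho : Odd o) :
    stdTile (2 ^ b * m) (2 ^ b * o) = ⟨edgeMark m o, edgeMark o m, (edgeMark (m - 1) o).opp,
      (edgeMark (o - 1) m).opp⟩ := by
  have h2 : (2 : ℤ) ^ b ≠ 0 := by positivity
  simp only [stdTile, lineMark_eq _ _ hm, lineMark_eq _ _ ho, two_pow_mul_sub_one_ediv,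
    Int.mul_ediv_cancel_left _ h2, Int.cast_sub, Int.cast_one]

theorem stdTile_isCross (b : ℕ) {m o : ℤ} (hm : Odd m) (ho : Odd o) :
    (stdTile (2 ^ b * m) (2 ^ b * o)).IsCross := by
  rw [stdTile_eq_cross b hm ho]
  have h1 := cast_odd hm
  have h2 := cast_odd ho
  generalize (m : ZMod 4) = m at *
  generalize (o : ZMod 4) = o at *
  revert m o
  decide

/-- The tiles of the standard pattern in a column of higher level than their row. -/
theorem stdTile_of_lt {a b : ℕ} (hab : b < a) {m o : ℤ} (hm : Odd m) (ho : Odd o) :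
    (stdTile (2 ^ a * m) (2 ^ b * o)).IsRobinson ∧
      (stdTile (2 ^ a * m) (2 ^ b * o)).east.mid = .tail := by
  have h2 : (2 : ℤ) ^ b ≠ 0 := by positivity
  obtain ⟨c, rfl⟩ := Nat.exists_eq_add_of_lt hab
  have h1 : (2 : ℤ) ^ (b + c + 1) * m = 2 ^ b * (2 * (2 ^ c * m)) := by
    rw [pow_succ, pow_add]; ring
  have hE : ((2 : ℤ) ^ (b + c + 1) * m) / 2 ^ b = 2 * (2 ^ c * m) := by
    rw [h1, Int.mul_ediv_cancel_left _ h2]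
  have hW : ((2 : ℤ) ^ (b + c + 1) * m - 1) / 2 ^ b = 2 * (2 ^ c * m) - 1 := by
    rw [h1, two_pow_mul_sub_one_ediv]
  simp only [stdTile, lineMark_eq _ _ hm, lineMark_eq _ _ ho, hE, hW,
    sub_one_ediv_of_odd (by omega : b < b + c + 1) ho]
  have hm' := cast_odd hm
  have ho' := cast_odd ho
  -- For consecutive levels the row is crossed midway between two crosses, where its red arrows, if
  -- any, arrive; writing `o = 2k + 1` ties their height to the direction of the vertical arrow. For
  -- levels further apart no red arrow arrives, and the position on the column is arbitrary.
  rcases Nat.eq_zero_or_pos c with rfl | hc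
  · have hN : ((2 : ℤ) ^ b * o) / 2 ^ (b + 0 + 1) = o / 2 := by
      rw [add_zero, pow_succ, ← Int.ediv_ediv_of_nonneg (by positivity),
        Int.mul_ediv_cancel_left _ h2]
    rw [hN]
    obtain ⟨k, rfl⟩ := ho
    have : (2 * k + 1) / 2 = k := by omega
    rw [this]
    push_cast
    generalize (m : ZMod 4) = m at *
    generalize (k : ZMod 4) = k at *
    clear * - hm'
    revert m k
    decide
  · obtain ⟨c', rfl⟩ := Nat.exists_eq_succ_of_ne_zero hc.ne'
    have hz : ((2 * (2 ^ (c' + 1) * m) : ℤ) : ZMod 4) = 0 := by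
      rw [show 2 * ((2 : ℤ) ^ (c' + 1) * m) = 4 * (2 ^ c' * m) by rw [pow_succ]; ring]
      push_cast
      rw [show (4 : ZMod 4) = 0 by decide, zero_mul]
    rw [Int.cast_sub, hz]
    push_cast
    generalize ((((2 : ℤ) ^ b * o) / 2 ^ (b + c'.succ + 1) : ℤ) : ZMod 4) = q
    generalize (m : ZMod 4) = m at *
    generalize (o : ZMod 4) = o at *
    clear * - hm' ho'
    revert m o q
    decide

theorem stdTile_isRobinson {i j : ℤ} (hi : i ≠ 0) (hj : j ≠ 0) : (stdTile i j).IsRobinson := by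
  obtain ⟨a, m, hm, rfl⟩ := exists_eq_two_pow_mul hi
  obtain ⟨b, o, ho, rfl⟩ := exists_eq_two_pow_mul hj
  rcases lt_trichotomy a b with h | rfl | h
  · have := (stdTile_of_lt h ho hm).1.transpose
    rwa [stdTile_transpose] at this
  · have := stdTile_isCross a hm ho
    obtain ⟨i, hi⟩ := this
    exact ⟨2, i, 0, hi⟩
  · exact (stdTile_of_lt h hm ho).1

theorem not_isCross_stdTile {a b : ℕ} (hab : b < a) {m o : ℤ} (hm : Odd m) (ho : Odd o) :
    ¬ (stdTile (2 ^ a * m) (2 ^ b * o)).IsCross := fun h => by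
  have := (stdTile_of_lt hab hm ho).2
  rw [h.mid.1] at this
  cases this

theorem lineMark_neg_left {i j : ℤ} (hj : j ≠ 0) :
    lineMark (-i) j = (lineMark (i - 1) j).opp := by
  obtain ⟨b, o, ho, rfl⟩ := exists_eq_two_pow_mul hj
  rw [lineMark_eq _ _ ho, lineMark_eq _ _ ho, ← edgeMark_opp]
  congr 1
  have h : (-i) / 2 ^ b = -1 - (i - 1) / 2 ^ b := by
    have h : (0 : ℤ) < 2 ^ b := by positivity
    have h1 := Int.emod_add_mul_ediv (i - 1) (2 ^ b)
    have h2 := Int.emod_nonneg (i - 1) h.ne'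
    have h3 := Int.emod_lt_of_pos (i - 1) h
    rw [Int.ediv_eq_iff_of_pos h]
    constructor <;> nlinarith
  rw [h]
  push_cast
  rfl

theorem lineMark_neg_right {i j : ℤ} (hj : j ≠ 0) : lineMark i (-j) = (lineMark i j).flip := by
  obtain ⟨b, o, ho, rfl⟩ := exists_eq_two_pow_mul hj
  rw [← mul_neg, lineMark_eq _ _ ho, lineMark_eq _ _ ho.neg, Int.cast_neg,
    edgeMark_flip (cast_odd ho)]

theorem stdTile_refl {i j : ℤ} (hi : i ≠ 0) (hj : j ≠ 0) :
    (stdTile i j).refl = stdTile (-i) j := by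
  simp only [stdTile, MarkedSquare.refl, lineMark_neg_left hj, lineMark_neg_right hi,
    show -i - 1 = -(i + 1) by ring, add_sub_cancel_right, SideMarks.opp_opp]
  rfl

theorem lineMark_zero_left {j : ℤ} (hj : j ≠ 0) : lineMark 0 j = .bareTail := by
  obtain ⟨b, o, ho, rfl⟩ := exists_eq_two_pow_mul hj
  rw [lineMark_eq _ _ ho, Int.zero_ediv, Int.cast_zero]
  generalize (o : ZMod 4) = o
  revert o
  decide

theorem lineMark_neg_one_left {j : ℤ} (hj : j ≠ 0) : lineMark (-1) j = .bareHead := by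
  rw [lineMark_neg_left hj, sub_self, lineMark_zero_left hj]
  rfl

/-- A row of level `b < n` sees only the quotients of `i` and `j` by `2 ^ b` modulo 4, and `2 ^ (b +
2)` divides `2 ^ (n + 1)`. -/
theorem lineMark_congr {n : ℕ} {i i' j j' : ℤ} (hj : ¬ (2 : ℤ) ^ n ∣ j)
    (hi' : (2 : ℤ) ^ (n + 1) ∣ i' - i) (hj' : (2 : ℤ) ^ (n + 1) ∣ j' - j) :
    lineMark i' j' = lineMark i j := by
  have h0 : j ≠ 0 := by rintro rfl; simp at hj
  obtain ⟨b, o, ho, rfl⟩ := exists_eq_two_pow_mul h0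
  have hb : b < n := by
    by_contra! h
    exact hj (Dvd.dvd.mul_right (pow_dvd_pow 2 (by omega)) _)
  obtain ⟨c, rfl⟩ := Nat.exists_eq_add_of_lt hb
  have hp : (2 : ℤ) ^ (b + c + 1 + 1) = 2 ^ b * (4 * 2 ^ c) := by
    rw [pow_succ, pow_succ, pow_add]; ring
  have h2 : (2 : ℤ) ^ b ≠ 0 := by positivity
  obtain ⟨k, hk⟩ := hi'
  obtain ⟨l, hl⟩ := hj'
  rw [hp] at hk hl
  obtain rfl : i' = i + 2 ^ b * (4 * (2 ^ c * k)) := by linarith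
  obtain rfl : j' = 2 ^ b * (o + 4 * (2 ^ c * l)) := by linarith
  have ho' : Odd (o + 4 * (2 ^ c * l)) := by
    obtain ⟨t, rfl⟩ := ho
    exact ⟨t + 2 * (2 ^ c * l), by ring⟩
  rw [lineMark_eq _ _ ho', lineMark_eq _ _ ho, Int.add_mul_ediv_left _ _ h2]
  push_cast
  simp only [show (4 : ZMod 4) = 0 by decide, zero_mul, add_zero]

/-- The standard pattern is periodic as far as its low levels are concerned. -/
theorem stdTile_congr {n : ℕ} {i i' j j' : ℤ} (hi : ¬ (2 : ℤ) ^ n ∣ i)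
    (hj : ¬ (2 : ℤ) ^ n ∣ j) (hi' : (2 : ℤ) ^ (n + 1) ∣ i' - i)
    (hj' : (2 : ℤ) ^ (n + 1) ∣ j' - j) : stdTile i' j' = stdTile i j := by
  have h1 : (2 : ℤ) ^ (n + 1) ∣ i' - 1 - (i - 1) := by simpa using hi'
  have h2 : (2 : ℤ) ^ (n + 1) ∣ j' - 1 - (j - 1) := by simpa using hj'
  simp only [stdTile, lineMark_congr hj hi' hj', lineMark_congr hi hj' hi',
    lineMark_congr hj h1 hj', lineMark_congr hi h2 hi']

theorem lineMark_eq_bareTail {n : ℕ} {i j : ℤ} (hj : ¬ (2 : ℤ) ^ n ∣ j)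
    (hi : (2 : ℤ) ^ (n + 1) ∣ i) : lineMark i j = .bareTail := by
  rw [lineMark_congr hj (i := 0) (by simpa using hi) (by simp : _ ∣ j - j),
    lineMark_zero_left (by rintro rfl; simp at hj)]

theorem lineMark_eq_bareHead {n : ℕ} {i j : ℤ} (hj : ¬ (2 : ℤ) ^ n ∣ j)
    (hi : (2 : ℤ) ^ (n + 1) ∣ i + 1) : lineMark i j = .bareHead := by
  rw [lineMark_congr hj (i := -1) (by simpa using hi) (by simp : _ ∣ j - j),
    lineMark_neg_one_left (by rintro rfl; simp at hj)]

/-! ### Robinson tilings in coordinates -/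

/-- A plane filled with Robinson tiles according to the arrow rule, with crosses on a coset of
`2ℤ²`. -/
structure IsRobinsonTiling (x : ℤ → ℤ → MarkedSquare) : Prop where
  tile : ∀ i j, (x i j).IsRobinson
  hor : ∀ i j, (x (i + 1) j).west = (x i j).east.opp
  ver : ∀ i j, (x i (j + 1)).south = (x i j).north.opp
  cross : ∃ k l, ∀ i j, (x (k + 2 * i) (l + 2 * j)).IsCross

/-- The image of a tiling under the reflection `(i, j) ↦ (j, i)`. -/
def transposeTiling (x : ℤ → ℤ → MarkedSquare) : ℤ → ℤ → MarkedSquare :=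
  fun i j => (x j i).transpose

/-- The image of a tiling under the reflection `(i, j) ↦ (-i, j)`. -/
def mirrorTiling (x : ℤ → ℤ → MarkedSquare) : ℤ → ℤ → MarkedSquare :=
  fun i j => (x (-i) j).refl

theorem transposeTiling_transposeTiling (x : ℤ → ℤ → MarkedSquare) :
    transposeTiling (transposeTiling x) = x := rfl

namespace IsRobinsonTiling

variable {x : ℤ → ℤ → MarkedSquare}

theorem transpose (hx : IsRobinsonTiling x) : IsRobinsonTiling (transposeTiling x) where
  tile i j := (hx.tile j i).transpose
  hor i j := hx.ver j i
  ver i j := hx.hor j i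
  cross := by
    obtain ⟨k, l, h⟩ := hx.cross
    exact ⟨l, k, fun i j => (h j i).transpose⟩

theorem mirror (hx : IsRobinsonTiling x) : IsRobinsonTiling (mirrorTiling x) where
  tile i j := (hx.tile (-i) j).refl
  hor i j := by
    have := hx.hor (-(i + 1)) j
    rw [show -(i + 1) + 1 = -i by ring] at this
    change (x (-(i + 1)) j).east = (x (-i) j).west.opp
    rw [this, SideMarks.opp_opp]
  ver i j := congrArg SideMarks.flip (hx.ver (-i) j)
  cross := by
    obtain ⟨k, l, h⟩ := hx.cross
    refine ⟨-k, l, fun i j => ?_⟩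
    have := (h (-i) j).refl
    rwa [show k + 2 * -i = -(-k + 2 * i) by ring] at this

theorem west_eq (hx : IsRobinsonTiling x) (i j : ℤ) : (x i j).west = (x (i - 1) j).east.opp := by
  have := hx.hor (i - 1) j
  rwa [sub_add_cancel] at this

theorem east_eq (hx : IsRobinsonTiling x) (i j : ℤ) : (x i j).east = (x (i + 1) j).west.opp := by
  rw [hx.hor, SideMarks.opp_opp]

theorem south_eq (hx : IsRobinsonTiling x) (i j : ℤ) : (x i j).south = (x i (j - 1)).north.opp :=
  hx.transpose.west_eq j i

theorem north_eq (hx : IsRobinsonTiling x) (i j : ℤ) : (x i j).north = (x i (j + 1)).south.opp :=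
  hx.transpose.east_eq j i

end IsRobinsonTiling

/-! ### Supertiles -/

/-- The square of side `2 ^ (n + 1) - 1` around `(p, q)` is filled as in the standard pattern, with
a central cross that opens to the east or west according to the sign `e`, and to the north or south
according to the sign `d`. -/
def IsSupertile (n : ℕ) (x : ℤ → ℤ → MarkedSquare) (p q e d : ℤ) : Prop :=
  (e = 1 ∨ e = -1) ∧ (d = 1 ∨ d = -1) ∧ ∀ i j, |i| < 2 ^ n → |j| < 2 ^ n →
    x (p + i) (q + j) = stdTile (2 ^ n * e + i) (2 ^ n * d + j)

theorem odd_of_sign {e : ℤ} (he : e = 1 ∨ e = -1) : Odd e := by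
  rcases he with rfl | rfl <;> decide

theorem not_dvd_of_abs_lt {m i : ℤ} (hi : |i| < m) (h0 : i ≠ 0) : ¬ m ∣ i := fun h =>
  h0 (Int.eq_zero_of_abs_lt_dvd h hi)

theorem sign_mul_add_ne_zero {m e i : ℤ} (he : e = 1 ∨ e = -1) (hi : |i| < m) :
    m * e + i ≠ 0 := by
  rw [abs_lt] at hi
  rcases he with rfl | rfl <;> omega

theorem not_dvd_sign_mul_add {n : ℕ} {e i : ℤ} (he : e = 1 ∨ e = -1) (hi : |i| < 2 ^ n) :
    ¬ (2 : ℤ) ^ (n + 1) ∣ 2 ^ n * e + i := by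
  apply not_dvd_of_abs_lt _ (sign_mul_add_ne_zero he hi)
  rw [abs_lt] at hi ⊢
  rw [pow_succ]
  rcases he with rfl | rfl <;> omega

theorem not_dvd_sign_mul_add' {n : ℕ} {e i : ℤ} (hi : |i| < 2 ^ n) (h0 : i ≠ 0) :
    ¬ (2 : ℤ) ^ n ∣ 2 ^ n * e + i := by
  rw [dvd_add_right (Dvd.intro _ rfl)]
  exact not_dvd_of_abs_lt hi h0

theorem two_pow_succ_dvd {n : ℕ} {e f : ℤ} (he : e = 1 ∨ e = -1) (hf : f = 1 ∨ f = -1) :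
    (2 : ℤ) ^ (n + 1) ∣ 2 ^ n * e + 2 ^ n * f := by
  rw [pow_succ, ← mul_add]
  apply mul_dvd_mul_left
  rcases he with rfl | rfl <;> rcases hf with rfl | rfl <;> decide

theorem mid_eq_tail_of_eq_bareTail {s : SideMarks} (h : s = .bareTail) : s.mid = .tail := by
  rw [h]; rfl

namespace IsSupertile

variable {n : ℕ} {x : ℤ → ℤ → MarkedSquare} {p q e d : ℤ}

theorem transpose (h : IsSupertile n x p q e d) :
    IsSupertile n (transposeTiling x) q p d e := by
  refine ⟨h.2.1, h.1, fun i j hi hj => ?_⟩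
  rw [transposeTiling, h.2.2 j i hj hi, stdTile_transpose]

theorem mirror (h : IsSupertile n x p q e d) :
    IsSupertile n (mirrorTiling x) (-p) q (-e) d := by
  refine ⟨by rcases h.1 with h | h <;> simp [h], h.2.1, fun i j hi hj => ?_⟩
  have hi' : |-i| < 2 ^ n := by rwa [abs_neg]
  rw [mirrorTiling, show -(-p + i) = p + -i by ring, h.2.2 (-i) j hi' hj,
    stdTile_refl (sign_mul_add_ne_zero h.1 hi') (sign_mul_add_ne_zero h.2.1 hj)]
  congr 1
  ring

theorem west_right (h : IsSupertile n x p q e d) (hx : IsRobinsonTiling x) {j : ℤ}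
    (hj : |j| < 2 ^ n) :
    (x (p + 2 ^ n) (q + j)).west = (lineMark (2 ^ n * e + 2 ^ n - 1) (2 ^ n * d + j)).opp := by
  have h1 : (1 : ℤ) ≤ 2 ^ n := one_le_pow₀ (by norm_num)
  rw [hx.west_eq, show p + 2 ^ n - 1 = p + (2 ^ n - 1) by ring,
    h.2.2 _ _ (by rw [abs_of_nonneg] <;> linarith) hj]
  simp only [stdTile]
  congr 2
  ring

theorem east_left (h : IsSupertile n x p q e d) (hx : IsRobinsonTiling x) {j : ℤ}
    (hj : |j| < 2 ^ n) :
    (x (p - 2 ^ n) (q + j)).east = lineMark (2 ^ n * e - 2 ^ n) (2 ^ n * d + j) := by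
  have h1 : (1 : ℤ) ≤ 2 ^ n := one_le_pow₀ (by norm_num)
  rw [hx.east_eq, show p - 2 ^ n + 1 = p + (-(2 ^ n - 1)) by ring,
    h.2.2 _ _ (by rw [abs_neg, abs_of_nonneg] <;> linarith) hj]
  simp only [stdTile, SideMarks.opp_opp]
  congr 1
  ring

theorem west_right_zero (h : IsSupertile n x p q e d) (hx : IsRobinsonTiling x) :
    (x (p + 2 ^ n) q).west = (edgeMark e d).opp := by
  have := h.west_right hx (j := 0) (by simp)
  rw [add_zero, add_zero] at this
  rw [this, lineMark_eq _ _ (odd_of_sign h.2.1), show (2 : ℤ) ^ n * e + 2 ^ n - 1 =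
    2 ^ n * (e + 1) - 1 by ring, two_pow_mul_sub_one_ediv, add_sub_cancel_right]

theorem east_left_zero (h : IsSupertile n x p q e d) (hx : IsRobinsonTiling x) :
    (x (p - 2 ^ n) q).east = edgeMark (e - 1) d := by
  have := h.east_left hx (j := 0) (by simp)
  rw [add_zero, add_zero] at this
  rw [this, lineMark_eq _ _ (odd_of_sign h.2.1), show (2 : ℤ) ^ n * e - 2 ^ n =
    2 ^ n * (e - 1) by ring, Int.mul_ediv_cancel_left _ (by positivity), Int.cast_sub,
    Int.cast_one]

/-- Only the central row can send a red arrow out of the supertile: the other rows have lower level,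
and to them the boundary column looks like the axis. -/
theorem west_right_ne (h : IsSupertile n x p q e d) (hx : IsRobinsonTiling x) {j : ℤ}
    (hj : |j| < 2 ^ n) (h0 : j ≠ 0) : (x (p + 2 ^ n) (q + j)).west = .bareTail := by
  rw [h.west_right hx hj, lineMark_eq_bareHead (not_dvd_sign_mul_add' hj h0)]
  · rfl
  · rw [sub_add_cancel]
    simpa using two_pow_succ_dvd (n := n) h.1 (Or.inl rfl)

theorem east_left_ne (h : IsSupertile n x p q e d) (hx : IsRobinsonTiling x) {j : ℤ}
    (hj : |j| < 2 ^ n) (h0 : j ≠ 0) : (x (p - 2 ^ n) (q + j)).east = .bareTail := by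
  rw [h.east_left hx hj, lineMark_eq_bareTail (not_dvd_sign_mul_add' hj h0)]
  simpa [← sub_eq_add_neg] using two_pow_succ_dvd (n := n) h.1 (Or.inr rfl)

theorem west_right_mid (h : IsSupertile n x p q e d) (hx : IsRobinsonTiling x) {j : ℤ}
    (hj : |j| < 2 ^ n) : (x (p + 2 ^ n) (q + j)).west.mid = .tail := by
  rcases eq_or_ne j 0 with rfl | h0
  · rw [add_zero, h.west_right_zero hx]
    rcases h.1 with rfl | rfl <;> rcases h.2.1 with rfl | rfl <;> decide
  · exact mid_eq_tail_of_eq_bareTail (h.west_right_ne hx hj h0)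

theorem east_left_mid (h : IsSupertile n x p q e d) (hx : IsRobinsonTiling x) {j : ℤ}
    (hj : |j| < 2 ^ n) : (x (p - 2 ^ n) (q + j)).east.mid = .tail := by
  rcases eq_or_ne j 0 with rfl | h0
  · rw [add_zero, h.east_left_zero hx]
    rcases h.1 with rfl | rfl <;> rcases h.2.1 with rfl | rfl <;> decide
  · exact mid_eq_tail_of_eq_bareTail (h.east_left_ne hx hj h0)

/-- The central crosses of neighbouring supertiles open to each other or away from each other. -/
theorem hor_neighbour (hx : IsRobinsonTiling x) {e' d' : ℤ} (h : IsSupertile n x p q e d)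
    (h' : IsSupertile n x (p + 2 ^ (n + 1)) q e' d') : e' = -e ∧ (e = 1 → d' = d) := by
  have h1 := h.west_right_zero hx
  have h2 := h'.east_left_zero hx
  have h3 := h.west_right_mid hx (j := 0) (by simp)
  have h4 := h'.east_left_mid hx (j := 0) (by simp)
  rw [show p + 2 ^ (n + 1) - 2 ^ n = p + 2 ^ n by ring] at h2 h4
  rw [add_zero] at h3 h4
  -- Black arrows enter the gap tile from both sides, so the two arms carry equal marks; comparing
  -- presence and height of the red arrows leaves only the stated signs.
  have h5 := ((hx.tile _ _).of_tails h4 h3).1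
  rw [h1, h2] at h5
  clear h1 h2 h3 h4
  rcases h.1 with rfl | rfl <;> rcases h.2.1 with rfl | rfl <;> rcases h'.1 with rfl | rfl <;>
    rcases h'.2.1 with rfl | rfl <;> revert h5 <;> decide

theorem ver_neighbour (hx : IsRobinsonTiling x) {e' d' : ℤ} (h : IsSupertile n x p q e d)
    (h' : IsSupertile n x p (q + 2 ^ (n + 1)) e' d') : d' = -d ∧ (d = 1 → e' = e) :=
  hor_neighbour hx.transpose h.transpose h'.transpose

/-- Two supertiles, one above the other, whose central crosses open to each other and to the east
have a cross to the east of the gap between them. -/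
theorem east_not_tail (hx : IsRobinsonTiling x) (h : IsSupertile n x p q 1 1)
    (h' : IsSupertile n x p (q + 2 ^ (n + 1)) 1 (-1)) :
    (x (p + 2 ^ n) (q + 2 ^ n)).east.mid ≠ .tail := by
  intro hE
  have hM : (2 : ℤ) ^ (n + 1) = 2 * 2 ^ n := pow_succ' 2 n
  have hpos : (0 : ℤ) < 2 ^ n := by positivity
  -- The red arrow at height `1/4` makes the black arrow of the gap column point south at row `q`.
  -- This direction persists upwards, since every tile on the way is also entered from the side: by
  -- the supertiles on the west or, at the gap row, from the east by assumption. At the upper centre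
  -- the red arrow at `3/4` demands the opposite direction.
  have key : ∀ m : ℕ, (m : ℤ) < 2 ^ (n + 1) →
      (x (p + 2 ^ n) (q + m)).north.mid = .tail := by
    intro m
    induction m with
    | zero =>
      intro _
      apply (hx.tile _ _).north_tail
      rw [Nat.cast_zero, add_zero, h.west_right_zero hx]
      decide
    | succ m ih =>
      intro hm
      push_cast at hm ⊢
      have hs := hx.ver (p + 2 ^ n) (q + m)
      refine (hx.tile _ _).north_tail_of_south_head ?_ ?_
      · rw [← add_assoc, hs, SideMarks.opp_mid_eq_head]
        exact ih (by linarith)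
      · rcases lt_trichotomy ((m : ℤ) + 1) (2 ^ n) with h1 | h1 | h1
        · exact Or.inl (h.west_right_mid hx (by rw [abs_of_nonneg] <;> linarith))
        · exact Or.inr (by rw [h1]; exact hE)
        · left
          have := h'.west_right_mid hx (j := (m : ℤ) + 1 - 2 ^ (n + 1))
            (by rw [abs_lt]; constructor <;> linarith)
          rwa [add_add_sub_cancel] at this
  have h1 := key (2 ^ (n + 1) - 1) (by
    rw [Nat.cast_sub Nat.one_le_two_pow]; push_cast; linarith)
  rw [Nat.cast_sub Nat.one_le_two_pow] at h1
  push_cast at h1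
  have h2 := hx.south_eq (p + 2 ^ n) (q + 2 ^ (n + 1))
  rw [add_sub_assoc] at h2
  have h3 : (x (p + 2 ^ n) (q + 2 ^ (n + 1))).south.mid = .tail := by
    apply (hx.tile _ _).south_tail
    rw [h'.west_right_zero hx]
    decide
  rw [h2, SideMarks.opp_mid_eq_tail, h1] at h3
  cases h3

/-- A supertile of the next level has supertiles in its corners, opening to its centre. -/
theorem corner (h : IsSupertile (n + 1) x p q e d) {s t : ℤ} (hs : s = 1 ∨ s = -1)
    (ht : t = 1 ∨ t = -1) : IsSupertile n x (p + 2 ^ n * s) (q + 2 ^ n * t) (-s) (-t) := by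
  have hs' : -s = 1 ∨ -s = -1 := by rcases hs with rfl | rfl <;> simp
  have ht' : -t = 1 ∨ -t = -1 := by rcases ht with rfl | rfl <;> simp
  have hM : (2 : ℤ) ^ (n + 1) = 2 * 2 ^ n := pow_succ' 2 n
  have hpos : (0 : ℤ) < 2 ^ n := by positivity
  refine ⟨hs', ht', fun i j hi hj => ?_⟩
  have aux : ∀ {s i : ℤ}, (s = 1 ∨ s = -1) → |i| < 2 ^ n → |2 ^ n * s + i| < 2 ^ (n + 1) := by
    intro s i hs hi
    rw [abs_lt] at hi ⊢
    rcases hs with rfl | rfl <;> constructor <;> linarith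
  -- Since `e + s` is even, the frames of the large supertile and of its corner differ by a multiple
  -- of `2 ^ (n + 2)`, a period of the pattern off the central arms.
  have aux' : ∀ {e s i : ℤ}, (e = 1 ∨ e = -1) → (s = 1 ∨ s = -1) →
      (2 : ℤ) ^ (n + 1 + 1) ∣ 2 ^ (n + 1) * e + (2 ^ n * s + i) - (2 ^ n * -s + i) := by
    intro e s i he hs
    have := two_pow_succ_dvd (n := n + 1) he hs
    convert this using 1
    ring
  rw [add_assoc, add_assoc, h.2.2 _ _ (aux hs hi) (aux ht hj)]
  exact stdTile_congr (not_dvd_sign_mul_add hs' hi) (not_dvd_sign_mul_add ht' hj)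
    (aux' h.1 hs) (aux' h.2.1 ht)

end IsSupertile

/-! ### Filling in the arms -/

section Arms

variable {x : ℤ → ℤ → MarkedSquare}

/-- Going outwards, the previous tile and the rows above and below give three sides of the next
tile, hence the tile. -/
theorem arm_east (hx : IsRobinsonTiling x) {p q u v L : ℤ} (hv : v ≠ 0)
    (hu : ∀ i, 0 < i → i < L → u + i ≠ 0) (h0 : x p q = stdTile u v)
    (hN : ∀ i, 0 < i → i < L → x (p + i) (q + 1) = stdTile (u + i) (v + 1))
    (hS : ∀ i, 0 < i → i < L → x (p + i) (q - 1) = stdTile (u + i) (v - 1))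
    (m : ℕ) (hm : (m : ℤ) < L) : x (p + m) q = stdTile (u + m) v := by
  induction m with
  | zero => simpa using h0
  | succ m ih =>
    push_cast at hm ⊢
    have hm' : 0 < (m : ℤ) + 1 := by positivity
    refine (hx.tile _ _).ext_of_west (stdTile_isRobinson (hu _ hm' hm) hv) ?_ ?_ ?_
    · rw [hx.west_eq, show p + ((m : ℤ) + 1) - 1 = p + m by ring, ih (by linarith)]
      simp only [stdTile]
      congr 2
      ring
    · rw [hx.north_eq, hN _ hm' hm]
      simp [stdTile]
    · rw [hx.south_eq, hS _ hm' hm]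
      simp [stdTile]

theorem arm_west (hx : IsRobinsonTiling x) {p q u v L : ℤ} (hv : v ≠ 0) (hv1 : v + 1 ≠ 0)
    (hv2 : v - 1 ≠ 0) (hu0 : u ≠ 0)
    (hu : ∀ i, 0 < i → i < L → u - i ≠ 0) (h0 : x p q = stdTile u v)
    (hN : ∀ i, 0 < i → i < L → x (p - i) (q + 1) = stdTile (u - i) (v + 1))
    (hS : ∀ i, 0 < i → i < L → x (p - i) (q - 1) = stdTile (u - i) (v - 1))
    (m : ℕ) (hm : (m : ℤ) < L) : x (p - m) q = stdTile (u - m) v := by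
  have h := arm_east hx.mirror (p := -p) (q := q) (u := -u) (v := v) (L := L) hv
    (fun i hi hL => by have := hu i hi hL; omega)
    (by rw [mirrorTiling, neg_neg, h0, stdTile_refl hu0 hv])
    (fun i hi hL => by
      rw [mirrorTiling, show -(-p + i) = p - i by ring, hN i hi hL, stdTile_refl (hu i hi hL) hv1]
      congr 1; ring)
    (fun i hi hL => by
      rw [mirrorTiling, show -(-p + i) = p - i by ring, hS i hi hL, stdTile_refl (hu i hi hL) hv2]
      congr 1; ring) m hm
  have hne : u - m ≠ 0 := by
    rcases Nat.eq_zero_or_pos m with rfl | hm'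
    · simpa using hu0
    · exact hu m (by exact_mod_cast hm') hm
  rw [mirrorTiling, show -(-p + (m : ℤ)) = p - m by ring, show -u + (m : ℤ) = -(u - m) by ring,
    ← stdTile_refl hne hv] at h
  rw [← MarkedSquare.refl_refl (x (p - m) q), h, MarkedSquare.refl_refl]

/-- Both horizontal arms. -/
theorem arm_hor (hx : IsRobinsonTiling x) {p q u v L : ℤ} (hv : v ≠ 0) (hv1 : v + 1 ≠ 0)
    (hv2 : v - 1 ≠ 0) (hu : ∀ i, |i| < L → u + i ≠ 0) (h0 : x p q = stdTile u v)
    (h : ∀ i j, i ≠ 0 → |i| < L → j = 1 ∨ j = -1 → x (p + i) (q + j) = stdTile (u + i) (v + j))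
    (i : ℤ) (hi : |i| < L) : x (p + i) q = stdTile (u + i) v := by
  have hL : 0 < L := (abs_nonneg i).trans_lt hi
  rcases le_total 0 i with hi0 | hi0
  · lift i to ℕ using hi0
    rw [abs_of_nonneg (by positivity)] at hi
    refine arm_east hx hv (fun i h1 h2 => hu i (by rwa [abs_of_pos h1])) h0
      (fun i h1 h2 => h i 1 h1.ne' (by rwa [abs_of_pos h1]) (Or.inl rfl))
      (fun i h1 h2 => h i (-1) h1.ne' (by rwa [abs_of_pos h1]) (Or.inr rfl)) i hi
  · obtain ⟨m, rfl⟩ : ∃ m : ℕ, i = -m := ⟨i.natAbs, by omega⟩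
    rw [abs_neg, abs_of_nonneg (by positivity)] at hi
    refine arm_west hx hv hv1 hv2 (by simpa using hu 0 (by simpa using hL))
      (fun i h1 h2 => hu (-i) (by rwa [abs_neg, abs_of_pos h1])) h0
      (fun i h1 h2 => h (-i) 1 (by omega) (by rwa [abs_neg, abs_of_pos h1]) (Or.inl rfl))
      (fun i h1 h2 => h (-i) (-1) (by omega) (by rwa [abs_neg, abs_of_pos h1]) (Or.inr rfl)) m hi

/-- The central tile of four supertiles that open to their common centre sends a black arrow to
the east. -/
theorem east_head_of_corners (hx : IsRobinsonTiling x) {n : ℕ} {p q : ℤ}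
    (h1 : IsSupertile n x (p + 2 ^ n) (q + 2 ^ n) (-1) (-1))
    (h2 : IsSupertile n x (p + 2 ^ n) (q - 2 ^ n) (-1) 1) : (x p q).east.mid = .head := by
  have hpos : (0 : ℤ) < 2 ^ n := by positivity
  -- At the far end of the arm two red arrows at `x = 3/4` fix the direction. From there to the
  -- centre, black arrows enter the row from north and south, so the horizontal arrow runs straight.
  have key : ∀ m : ℕ, (m : ℤ) ≤ 2 ^ n → (x (p + 2 ^ n - m) q).east.mid = .head := by
    intro m
    induction m with
    | zero =>
      intro _
      have hN := h1.transpose.east_left_zero hx.transpose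
      have hS := h2.transpose.west_right_zero hx.transpose
      rw [add_sub_cancel_right] at hN
      rw [sub_add_cancel] at hS
      rw [Nat.cast_zero, sub_zero]
      exact (hx.tile _ _).east_head (hN.trans (by decide)) (hS.trans (by decide))
    | succ m ih =>
      intro hm
      push_cast at hm ⊢
      have hm' : |-(m : ℤ)| < 2 ^ n := by
        rw [abs_neg, abs_of_nonneg] <;> linarith [Nat.cast_nonneg (α := ℤ) m]
      have hN := h1.transpose.east_left_mid hx.transpose hm'
      have hS := h2.transpose.west_right_mid hx.transpose hm'
      rw [add_sub_cancel_right, ← sub_eq_add_neg] at hN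
      rw [sub_add_cancel, ← sub_eq_add_neg] at hS
      have h3 := ((hx.tile _ _).of_tails' hN hS).2
      have h4 := ih (by linarith)
      rw [h3, SideMarks.opp_mid_eq_head, hx.west_eq, SideMarks.opp_mid_eq_tail] at h4
      rwa [← sub_sub]
  simpa using key (2 ^ n) (by simp)

theorem exists_stdTile_eq_of_isCross {t : MarkedSquare} (h : t.IsCross) (b : ℕ) :
    ∃ e d : ℤ, (e = 1 ∨ e = -1) ∧ (d = 1 ∨ d = -1) ∧ t = stdTile (2 ^ b * e) (2 ^ b * d) := by
  obtain ⟨i, rfl⟩ := h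
  have key : ∀ i : Fin 4, ∃ e ∈ ({1, -1} : Finset ℤ), ∃ d ∈ ({1, -1} : Finset ℤ),
      MarkedSquare.rot^[(i : ℕ)] MarkedSquare.cross = ⟨edgeMark e d, edgeMark d e,
        (edgeMark (e - 1) d).opp, (edgeMark (d - 1) e).opp⟩ := by decide
  obtain ⟨e, he, d, hd, h⟩ := key i
  simp only [Finset.mem_insert, Finset.mem_singleton] at he hd
  exact ⟨e, d, he, hd, by rw [stdTile_eq_cross b (odd_of_sign he) (odd_of_sign hd), h]⟩

/-- Four supertiles that open to their common centre make up a supertile of the next level. -/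
theorem IsSupertile.of_corners (hx : IsRobinsonTiling x) {n : ℕ} {p q : ℤ}
    (h : ∀ s t : ℤ, (s = 1 ∨ s = -1) → (t = 1 ∨ t = -1) →
      IsSupertile n x (p + 2 ^ n * s) (q + 2 ^ n * t) (-s) (-t)) :
    ∃ e d, IsSupertile (n + 1) x p q e d := by
  have hM : (2 : ℤ) ^ (n + 1) = 2 * 2 ^ n := pow_succ' 2 n
  have hpos : (0 : ℤ) < 2 ^ n := by positivity
  have h11 : IsSupertile n x (p + 2 ^ n) (q + 2 ^ n) (-1) (-1) := by
    simpa using h 1 1 (Or.inl rfl) (Or.inl rfl)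
  have h12 : IsSupertile n x (p + 2 ^ n) (q - 2 ^ n) (-1) 1 := by
    simpa [← sub_eq_add_neg] using h 1 (-1) (Or.inl rfl) (Or.inr rfl)
  have h21 : IsSupertile n x (p - 2 ^ n) (q + 2 ^ n) 1 (-1) := by
    simpa [← sub_eq_add_neg] using h (-1) 1 (Or.inr rfl) (Or.inl rfl)
  have hc : (x p q).IsCross := (hx.tile p q).isCross (east_head_of_corners hx h11 h12)
    (east_head_of_corners hx.transpose h11.transpose h21.transpose)
  obtain ⟨e, d, he, hd, h0⟩ := exists_stdTile_eq_of_isCross hc (n + 1)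
  have aux : ∀ {i : ℤ}, i ≠ 0 → |i| < 2 ^ (n + 1) →
      ∃ s, (s = 1 ∨ s = -1) ∧ |i - 2 ^ n * s| < 2 ^ n := by
    intro i hi hi'
    rw [abs_lt] at hi'
    rcases lt_or_gt_of_ne hi with hi | hi
    · exact ⟨-1, Or.inr rfl, by rw [abs_lt]; constructor <;> linarith⟩
    · exact ⟨1, Or.inl rfl, by rw [abs_lt]; constructor <;> linarith⟩
  have aux' : ∀ {e s i : ℤ}, (e = 1 ∨ e = -1) → (s = 1 ∨ s = -1) →
      (2 : ℤ) ^ (n + 1 + 1) ∣ 2 ^ (n + 1) * e + i - (2 ^ n * -s + (i - 2 ^ n * s)) := by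
    intro e s i he hs
    have := two_pow_succ_dvd (n := n + 1) he hs
    convert this using 1
    ring
  have hoff : ∀ i j, i ≠ 0 → j ≠ 0 → |i| < 2 ^ (n + 1) → |j| < 2 ^ (n + 1) →
      x (p + i) (q + j) = stdTile (2 ^ (n + 1) * e + i) (2 ^ (n + 1) * d + j) := by
    intro i j hi hj hi' hj'
    obtain ⟨s, hs, his⟩ := aux hi hi'
    obtain ⟨t, ht, hjt⟩ := aux hj hj'
    have := h s t hs ht
    have h1 := this.2.2 _ _ his hjt
    rw [add_add_sub_cancel, add_add_sub_cancel] at h1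
    rw [h1]
    exact (stdTile_congr (not_dvd_sign_mul_add this.1 his) (not_dvd_sign_mul_add this.2.1 hjt)
      (aux' he hs) (aux' hd ht)).symm
  have hM2 : (2 : ℤ) ≤ 2 ^ (n + 1) := by linarith
  have hlt1 : ∀ {j : ℤ}, (j = 1 ∨ j = -1) → j ≠ 0 ∧ |j| < 2 ^ (n + 1) := by
    rintro j (rfl | rfl) <;> constructor <;> norm_num <;> linarith
  have hne : ∀ {e i : ℤ}, (e = 1 ∨ e = -1) → |i| < 2 ^ (n + 1) → 2 ^ (n + 1) * e + i ≠ 0 :=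
    fun he hi => sign_mul_add_ne_zero he hi
  have harm : ∀ (y : ℤ → ℤ → MarkedSquare) (p q e d : ℤ), IsRobinsonTiling y →
      (e = 1 ∨ e = -1) → (d = 1 ∨ d = -1) →
      y p q = stdTile (2 ^ (n + 1) * e) (2 ^ (n + 1) * d) →
      (∀ i j, i ≠ 0 → j ≠ 0 → |i| < 2 ^ (n + 1) → |j| < 2 ^ (n + 1) →
        y (p + i) (q + j) = stdTile (2 ^ (n + 1) * e + i) (2 ^ (n + 1) * d + j)) →
      ∀ i, |i| < 2 ^ (n + 1) →
        y (p + i) q = stdTile (2 ^ (n + 1) * e + i) (2 ^ (n + 1) * d) := by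
    intro y p q e d hy he hd h0 hoff i hi
    refine arm_hor hy (by simpa using hne hd (i := 0) (by simp)) (hne hd (hlt1 (Or.inl rfl)).2)
      (hne hd (hlt1 (Or.inr rfl)).2) (fun i hi => hne he hi) h0 (fun i j hi hi' hj => ?_) i hi
    exact hoff i j hi (hlt1 hj).1 hi' (hlt1 hj).2
  refine ⟨e, d, he, hd, fun i j hi hj => ?_⟩
  rcases eq_or_ne j 0 with rfl | hj0
  · rw [add_zero, add_zero]
    exact harm x p q e d hx he hd h0 hoff i hi
  rcases eq_or_ne i 0 with rfl | hi0
  · rw [add_zero, add_zero]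
    have := harm (transposeTiling x) q p d e hx.transpose hd he
      (by rw [transposeTiling, h0, stdTile_transpose])
      (fun i j hi hj hi' hj' => by
        rw [transposeTiling, hoff j i hj hi hj' hi', stdTile_transpose]) j hj
    rw [transposeTiling, ← stdTile_transpose] at this
    rw [← MarkedSquare.transpose_transpose (x p (q + j)), this, MarkedSquare.transpose_transpose]
  · exact hoff i j hi0 hj0 hi hj

end Arms

/-! ### Lattices of supertile centres -/

/-- The set `C` consists of one coset of `Mℤ` in each of the columns of a coset of `Mℤ`. -/
structure IsColumnLattice (M : ℤ) (C : ℤ → ℤ → Prop) : Prop where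
  up : ∀ {p q}, C p q → C p (q + M)
  down : ∀ {p q}, C p q → C p (q - M)
  col : ∀ {p q p' q'}, C p q → C p' q' → M ∣ p' - p
  row : ∀ {p q q'}, C p q → C p q' → M ∣ q' - q
  right : ∀ {p q}, C p q → ∃ q', C (p + M) q'
  left : ∀ {p q}, C p q → ∃ q', C (p - M) q'
  nonempty : ∃ p q, C p q

/-- The rules for the directions `e` (east or west) and `d` (north or south) to which the central
crosses of supertiles with centres in `C` open. -/
structure IsFacing (M : ℤ) (C : ℤ → ℤ → Prop) (e d : ℤ → ℤ → ℤ) : Prop where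
  sign_left : ∀ {p q}, C p q → e p q = 1 ∨ e p q = -1
  sign_right : ∀ {p q}, C p q → d p q = 1 ∨ d p q = -1
  east : ∀ {p q}, C p q → e p q = 1 → C (p + M) q ∧ e (p + M) q = -1 ∧ d (p + M) q = d p q
  west : ∀ {p q}, C p q → e p q = -1 → C (p - M) q ∧ e (p - M) q = 1 ∧ d (p - M) q = d p q
  north : ∀ {p q}, C p q → d p q = 1 → C p (q + M) ∧ d p (q + M) = -1 ∧ e p (q + M) = e p q
  south : ∀ {p q}, C p q → d p q = -1 → C p (q - M) ∧ d p (q - M) = 1 ∧ e p (q - M) = e p q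
  hor : ∀ {p q}, C p q → C (p + M) q → e (p + M) q = -e p q
  ver : ∀ {p q}, C p q → C p (q + M) → d p (q + M) = -d p q

theorem IsFacing.swap {M : ℤ} {C : ℤ → ℤ → Prop} {e d : ℤ → ℤ → ℤ} (h : IsFacing M C e d) :
    IsFacing M (Function.swap C) (Function.swap d) (Function.swap e) where
  sign_left := h.sign_right
  sign_right := h.sign_left
  east := h.north
  west := h.south
  north := h.east
  south := h.west
  hor := h.ver
  ver := h.hor

theorem IsColumnLattice.of_dvd {M : ℤ} {C : ℤ → ℤ → Prop} (hC : IsColumnLattice M C) {p q q' : ℤ}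
    (h : C p q) (hq : M ∣ q' - q) : C p q' := by
  obtain ⟨i, hi⟩ := hq
  obtain rfl : q' = q + M * i := by linarith
  clear hi
  induction i using Int.induction_on with
  | zero => simpa using h
  | succ i ih => simpa [mul_add, add_assoc] using hC.up ih
  | pred i ih => simpa [mul_sub, add_sub_assoc] using hC.down ih

/-- An alternating sequence of signs. -/
theorem eq_of_alternating {f : ℤ → ℤ} (hf : ∀ i, f (i + 1) = -f i) (k : ℤ) : f (2 * k) = f 0 := by
  induction k using Int.induction_on with
  | zero => rfl
  | succ k ih =>
    rw [show 2 * ((k : ℤ) + 1) = 2 * k + 1 + 1 by ring, hf, hf, neg_neg, ih]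
  | pred k ih =>
    rw [← ih, show 2 * (-(k : ℤ)) = 2 * (-k - 1) + 1 + 1 by ring, hf, hf, neg_neg]

section Abstract

variable {M : ℤ} {C : ℤ → ℤ → Prop} {e d : ℤ → ℤ → ℤ}

/-- Each column opens to one side. -/
def IsCoherent (C : ℤ → ℤ → Prop) (e : ℤ → ℤ → ℤ) : Prop :=
  ∀ p q q', C p q → C p q' → e p q = e p q'

/-- A column that opens east faces an aligned column, all of which answers. A column that opens west
offers no partner to a supertile on its right that would open west. -/
theorem IsColumnLattice.opens_right (hC : IsColumnLattice M C) (hF : IsFacing M C e d)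
    {p q₀ ε : ℤ} (h₀ : C p q₀) (h : ∀ q, C p q → e p q = ε) :
    ∀ q, C (p + M) q → e (p + M) q = -ε := by
  intro q hq
  rcases hF.sign_left h₀ with h1 | h1
  · obtain rfl : ε = 1 := by rw [← h _ h₀, h1]
    have h2 := (hF.east h₀ h1).1
    have h3 := hC.of_dvd h₀ (hC.row h2 hq)
    exact (hF.east h3 (h _ h3)).2.1
  · obtain rfl : ε = -1 := by rw [← h _ h₀, h1]
    rcases hF.sign_left hq with h2 | h2
    · rw [h2]; rfl
    · have h3 := hF.west hq h2
      rw [add_sub_cancel_right] at h3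
      have := h _ h3.1
      omega

theorem IsColumnLattice.opens_left (hC : IsColumnLattice M C) (hF : IsFacing M C e d)
    {p q₀ ε : ℤ} (h₀ : C p q₀) (h : ∀ q, C p q → e p q = ε) :
    ∀ q, C (p - M) q → e (p - M) q = -ε := by
  intro q hq
  rcases hF.sign_left h₀ with h1 | h1
  · obtain rfl : ε = 1 := by rw [← h _ h₀, h1]
    rcases hF.sign_left hq with h2 | h2
    · have h3 := hF.east hq h2
      rw [sub_add_cancel] at h3
      have := h _ h3.1
      omega
    · exact h2
  · obtain rfl : ε = -1 := by rw [← h _ h₀, h1]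
    have h2 := (hF.west h₀ h1).1
    have h3 := hC.of_dvd h₀ (hC.row h2 hq)
    exact (hF.west h3 (h _ h3)).2.1

theorem IsColumnLattice.opens_even (hC : IsColumnLattice M C) (hF : IsFacing M C e d)
    {p q₀ ε : ℤ} (h₀ : C p q₀) (h : ∀ q, C p q → e p q = ε) (k : ℤ) :
    (∃ q, C (p + 2 * M * k) q) ∧ ∀ q, C (p + 2 * M * k) q → e (p + 2 * M * k) q = ε := by
  induction k using Int.induction_on with
  | zero => simpa using ⟨⟨q₀, h₀⟩, h⟩
  | succ k ih =>
    obtain ⟨⟨q, hq⟩, h1⟩ := ih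
    obtain ⟨q1, hq1⟩ := hC.right hq
    obtain ⟨q2, hq2⟩ := hC.right hq1
    have h2 := hC.opens_right hF hq1 (hC.opens_right hF hq h1)
    rw [show p + 2 * M * k + M + M = p + 2 * M * (k + 1) by ring] at h2 hq2
    exact ⟨⟨q2, hq2⟩, by simpa using h2⟩
  | pred k ih =>
    obtain ⟨⟨q, hq⟩, h1⟩ := ih
    obtain ⟨q1, hq1⟩ := hC.left hq
    obtain ⟨q2, hq2⟩ := hC.left hq1
    have h2 := hC.opens_left hF hq1 (hC.opens_left hF hq h1)
    rw [show p + 2 * M * (-(k : ℤ)) - M - M = p + 2 * M * (-k - 1) by ring] at h2 hq2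
    exact ⟨⟨q2, hq2⟩, by simpa using h2⟩

theorem IsColumnLattice.opens_odd (hC : IsColumnLattice M C) (hF : IsFacing M C e d)
    {p q₀ ε : ℤ} (h₀ : C p q₀) (h : ∀ q, C p q → e p q = ε) (k : ℤ) :
    ∀ q, C (p + 2 * M * k + M) q → e (p + 2 * M * k + M) q = -ε := by
  obtain ⟨⟨q, hq⟩, h1⟩ := hC.opens_even hF h₀ h k
  exact hC.opens_right hF hq h1

/-- If one column opens to one side then all do. -/
theorem IsColumnLattice.isCoherent (hC : IsColumnLattice M C) (hF : IsFacing M C e d)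
    {p q₀ ε : ℤ} (h₀ : C p q₀) (h : ∀ q, C p q → e p q = ε) : IsCoherent C e := by
  intro p' q q' hq hq'
  obtain ⟨i, hi⟩ := hC.col h₀ hq
  obtain ⟨k, rfl | rfl⟩ := Int.even_or_odd' i
  · obtain rfl : p' = p + 2 * M * k := by linarith
    have := (hC.opens_even hF h₀ h k).2
    rw [this _ hq, this _ hq']
  · obtain rfl : p' = p + 2 * M * k + M := by linarith
    have := hC.opens_odd hF h₀ h k
    rw [this _ hq, this _ hq']

/-- If two neighbouring columns are not aligned then every column opens to one side. -/
theorem IsColumnLattice.isCoherent_of_jump (hC : IsColumnLattice M C) (hF : IsFacing M C e d)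
    {p q : ℤ} (h : C p q) (h' : ¬ C (p + M) q) : IsCoherent C e := by
  refine hC.isCoherent hF h (ε := -1) fun q' hq' => ?_
  rcases hF.sign_left hq' with h1 | h1
  · exact absurd (hC.of_dvd (hF.east hq' h1).1 (hC.row hq' h)) h'
  · exact h1

/-- If some column does not open to one side, no two neighbouring columns are misaligned, so `C` is
a full lattice. Some vertical neighbours then differ in `e`, and as signs alternate along rows they
differ in every column. A member of the lower row opening north would share `e` with its northern
neighbour, so this whole row opens south, and the result for columns applies to rows. -/
theorem IsColumnLattice.isCoherent_or (hC : IsColumnLattice M C) (hF : IsFacing M C e d) :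
    IsCoherent C e ∨ (IsColumnLattice M (Function.swap C) ∧
      IsCoherent (Function.swap C) (Function.swap d)) := by
  by_cases hco : IsCoherent C e
  · exact Or.inl hco
  right
  have hR : ∀ {p q}, C p q → C (p + M) q := fun {p q} h => by
    by_contra h'
    exact hco (hC.isCoherent_of_jump hF h h')
  have hL : ∀ {p q}, C p q → C (p - M) q := fun {p q} h => by
    obtain ⟨q', hq'⟩ := hC.left h
    have h1 := hR hq'
    rw [sub_add_cancel] at h1
    exact hC.of_dvd hq' (hC.row h1 h)
  have hall : ∀ {p q} (i : ℤ), C p q → C (p + M * i) q := fun {p q} i h => by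
    induction i using Int.induction_on with
    | zero => simpa using h
    | succ i ih => simpa [mul_add, add_assoc] using hR ih
    | pred i ih => simpa [mul_sub, add_sub_assoc] using hL ih
  have hcol : ∀ {p q p' q'}, C p q → C p' q' → C p q' := fun {p q p' q'} h h' => by
    obtain ⟨i, hi⟩ := hC.col h h'
    have := hall (-i) h'
    rwa [show p' + M * -i = p by linarith] at this
  have hS : IsColumnLattice M (Function.swap C) :=
    { up := fun h => hR h
      down := fun h => hL h
      col := fun h h' => hC.row (hcol h h) (hcol h h')
      row := fun h h' => hC.col h h'
      right := fun {q p} h => ⟨p, hC.up h⟩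
      left := fun {q p} h => ⟨p, hC.down h⟩
      nonempty := by
        obtain ⟨p, q, h⟩ := hC.nonempty
        exact ⟨q, p, h⟩ }
  refine ⟨hS, ?_⟩
  -- Otherwise `e` would be constant on each column, against the assumption.
  obtain ⟨p, q, hq, hne⟩ : ∃ p q, C p q ∧ e p (q + M) ≠ e p q := by
    by_contra! hcon
    refine hco fun p q q' hq hq' => ?_
    obtain ⟨i, hi⟩ := hC.row hq hq'
    obtain rfl : q' = q + M * i := by linarith
    clear hi hq'
    suffices C p (q + M * i) ∧ e p q = e p (q + M * i) from this.2
    induction i using Int.induction_on with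
    | zero => simpa using hq
    | succ i ih =>
      rw [mul_add, mul_one, ← add_assoc]
      exact ⟨hC.up ih.1, ih.2.trans (hcon _ _ ih.1).symm⟩
    | pred i ih =>
      rw [mul_sub, mul_one, ← add_sub_assoc]
      have h1 := hC.down ih.1
      refine ⟨h1, ih.2.trans ?_⟩
      have := hcon _ _ h1
      rwa [sub_add_cancel] at this
  have key : ∀ i : ℤ, e (p + M * i) (q + M) ≠ e (p + M * i) q := by
    intro i
    induction i using Int.induction_on with
    | zero => simpa using hne
    | succ i ih =>
      rw [mul_add, mul_one, ← add_assoc]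
      have h1 := hall (i : ℤ) hq
      have h2 := hC.up h1
      rw [hF.hor h1 (hR h1), hF.hor h2 (hR h2)]
      omega
    | pred i ih =>
      rw [mul_sub, mul_one, ← add_sub_assoc]
      have h1 := hL (hall (-(i : ℤ)) hq)
      have h2 := hC.up h1
      have h3 := hF.hor h1 (hR h1)
      have h4 := hF.hor h2 (hR h2)
      rw [sub_add_cancel] at h3 h4
      omega
  -- One row that opens south throughout is enough for all rows.
  refine hS.isCoherent hF.swap (p := q) (q₀ := p) (ε := -1) hq fun p' hp' => ?_
  obtain ⟨i, hi⟩ := hC.col hq hp'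
  obtain rfl : p' = p + M * i := by linarith
  rcases hF.sign_right hp' with h1 | h1
  · exact absurd (hF.north hp' h1).2.2 (key i)
  · exact h1

/-- The supertiles in the south-west corners of supertiles of the next level. -/
theorem IsColumnLattice.double (hC : IsColumnLattice M C) (hF : IsFacing M C e d)
    (hco : IsCoherent C e) :
    IsColumnLattice (2 * M) (fun p q => C p q ∧ e p q = 1 ∧ d p q = 1) := by
  have hd : ∀ {p q}, C p q → ∃ q', C p q' ∧ d p q' = 1 := fun {p q} h => by
    rcases hF.sign_right h with h1 | h1
    · exact ⟨q, h, h1⟩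
    · exact ⟨q + M, hC.up h, by rw [hF.ver h (hC.up h), h1]; rfl⟩
  have hK : ∀ {p q}, C p q → e p q = 1 → ∀ q', C p q' → e p q' = 1 :=
    fun {p q} h h1 q' h' => by rw [← h1]; exact hco _ _ _ h' h
  refine ⟨?_, ?_, ?_, ?_, ?_, ?_, ?_⟩
  · rintro p q ⟨h, he, hd⟩
    have h1 := hC.up h
    have h2 := hC.up h1
    have h3 := hF.ver h h1
    have h4 := hF.ver h1 h2
    rw [show q + 2 * M = q + M + M by ring]
    exact ⟨h2, hK h he _ h2, by omega⟩
  · rintro p q ⟨h, he, hd⟩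
    have h1 := hC.down h
    have h2 := hC.down h1
    have h3 := hF.ver h1 (hC.up h1)
    have h4 := hF.ver h2 (hC.up h2)
    rw [sub_add_cancel] at h3 h4
    rw [show q - 2 * M = q - M - M by ring]
    exact ⟨h2, hK h he _ h2, by omega⟩
  · rintro p q p' q' ⟨h, he, hd⟩ ⟨h', he', hd'⟩
    obtain ⟨i, hi⟩ := hC.col h h'
    obtain ⟨k, rfl | rfl⟩ := Int.even_or_odd' i
    · exact ⟨k, by linarith⟩
    · obtain rfl : p' = p + 2 * M * k + M := by linarith
      have := hC.opens_odd hF h (hK h he) k _ h'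
      omega
  · rintro p q q' ⟨h, he, hd⟩ ⟨h', he', hd'⟩
    obtain ⟨i, hi⟩ := hC.row h h'
    obtain rfl : q' = q + M * i := by linarith
    have hall : ∀ j : ℤ, C p (q + M * j) := fun j => hC.of_dvd h ⟨j, by ring⟩
    have halt : ∀ j : ℤ, d p (q + M * (j + 1)) = -d p (q + M * j) := fun j => by
      have := hF.ver (hall j) (hC.up (hall j))
      rwa [add_assoc, ← mul_add_one] at this
    obtain ⟨k, rfl | rfl⟩ := Int.even_or_odd' i
    · exact ⟨k, by linarith⟩
    · have h1 := eq_of_alternating (f := fun j => d p (q + M * j)) halt k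
      have h2 := halt (2 * k)
      simp only [mul_zero, add_zero] at h1
      omega
  · rintro p q ⟨h, he, -⟩
    obtain ⟨⟨q', h'⟩, h2⟩ := hC.opens_even hF h (hK h he) 1
    rw [mul_one] at h' h2
    obtain ⟨q'', h3, h4⟩ := hd h'
    exact ⟨q'', h3, h2 _ h3, h4⟩
  · rintro p q ⟨h, he, -⟩
    obtain ⟨⟨q', h'⟩, h2⟩ := hC.opens_even hF h (hK h he) (-1)
    rw [mul_neg, mul_one, ← sub_eq_add_neg] at h' h2
    obtain ⟨q'', h3, h4⟩ := hd h'
    exact ⟨q'', h3, h2 _ h3, h4⟩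
  · obtain ⟨p, q, h⟩ := hC.nonempty
    obtain ⟨p', q', h', he⟩ : ∃ p q, C p q ∧ e p q = 1 := by
      rcases hF.sign_left h with h1 | h1
      · exact ⟨p, q, h, h1⟩
      · exact ⟨p - M, q, (hF.west h h1).1, (hF.west h h1).2.1⟩
    obtain ⟨q'', h3, h4⟩ := hd h'
    exact ⟨p', q'', h3, hK h' he _ h3, h4⟩

theorem IsColumnLattice.double_or (hC : IsColumnLattice M C) (hF : IsFacing M C e d) :
    IsColumnLattice (2 * M) (fun p q => C p q ∧ e p q = 1 ∧ d p q = 1) ∨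
    IsColumnLattice (2 * M) (fun q p => C p q ∧ e p q = 1 ∧ d p q = 1) := by
  rcases hC.isCoherent_or hF with h | ⟨h1, h2⟩
  · exact Or.inl (hC.double hF h)
  · right
    convert h1.double hF.swap h2 using 4
    exact and_comm

/-- The other corners of a supertile of the next level. -/
theorem IsFacing.square (hF : IsFacing M C e d) {p q : ℤ} (h : C p q) (he : e p q = 1)
    (hd : d p q = 1) :
    (C (p + M) q ∧ e (p + M) q = -1 ∧ d (p + M) q = 1) ∧
    (C p (q + M) ∧ e p (q + M) = 1 ∧ d p (q + M) = -1) ∧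
    (C (p + M) (q + M) ∧ e (p + M) (q + M) = -1 ∧ d (p + M) (q + M) = -1) := by
  obtain ⟨h1, h2, h3⟩ := hF.east h he
  obtain ⟨h4, h5, h6⟩ := hF.north h hd
  obtain ⟨h7, h8, h9⟩ := hF.north h1 (h3.trans hd)
  exact ⟨⟨h1, h2, h3.trans hd⟩, ⟨h4, h6.trans he, h5⟩, h7, h9.trans h2, h8⟩

/-- Every centre is the corner of a square of centres that open to each other. -/
theorem IsFacing.exists_square (hF : IsFacing M C e d) {p q : ℤ} (h : C p q) :
    ∃ s t : ℤ, (s = 0 ∨ s = 1) ∧ (t = 0 ∨ t = 1) ∧ C (p - M * s) (q - M * t) ∧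
      e (p - M * s) (q - M * t) = 1 ∧ d (p - M * s) (q - M * t) = 1 := by
  obtain ⟨s, hs, h1, h2⟩ : ∃ s : ℤ, (s = 0 ∨ s = 1) ∧ C (p - M * s) q ∧ e (p - M * s) q = 1 := by
    rcases hF.sign_left h with h1 | h1
    · exact ⟨0, by simp, by simpa using h, by simpa using h1⟩
    · have := hF.west h h1
      exact ⟨1, by simp, by simpa using this.1, by simpa using this.2.1⟩
  rcases hF.sign_right h1 with h3 | h3
  · exact ⟨s, 0, hs, by simp, by simpa using h1, by simpa using h2, by simpa using h3⟩
  · obtain ⟨h4, h5, h6⟩ := hF.south h1 h3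
    exact ⟨s, 1, hs, by simp, by simpa using h4, by simpa using h6.trans h2, by simpa using h5⟩

end Abstract

/-! ### The facing rules for supertiles -/

section Supertiles

variable {x : ℤ → ℤ → MarkedSquare} {n : ℕ} {C : ℤ → ℤ → Prop} {e d : ℤ → ℤ → ℤ}

theorem IsColumnLattice.mirror {M : ℤ} (hC : IsColumnLattice M C) :
    IsColumnLattice M (fun p q => C (-p) q) where
  up h := hC.up h
  down h := hC.down h
  col {p q p' q'} h h' := by
    have := hC.col h' h
    rwa [show -p - -p' = p' - p by ring] at this
  row h h' := hC.row h h'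
  right {p q} h := by
    obtain ⟨q', h'⟩ := hC.left h
    exact ⟨q', by rwa [show -(p + M) = -p - M by ring]⟩
  left {p q} h := by
    obtain ⟨q', h'⟩ := hC.right h
    exact ⟨q', by rwa [show -(p - M) = -p + M by ring]⟩
  nonempty := by
    obtain ⟨p, q, h⟩ := hC.nonempty
    exact ⟨-p, q, by simpa using h⟩

/-- Together with its vertical partner the supertile forces a black arrow to leave the gap between
them towards the east (`east_not_tail`). If the next column had another phase, this arrow would run
into the side of a supertile, where every black arrow points outwards. -/
theorem IsColumnLattice.aligned_of_east (hx : IsRobinsonTiling x)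
    (hC : IsColumnLattice (2 ^ (n + 1)) C)
    (hS : ∀ p q, C p q → IsSupertile n x p q (e p q) (d p q)) {p q : ℤ} (h : C p q)
    (he : e p q = 1) : C (p + 2 ^ (n + 1)) q := by
  have hM : (2 : ℤ) ^ (n + 1) = 2 * 2 ^ n := pow_succ' 2 n
  have hpos : (0 : ℤ) < 2 ^ n := by positivity
  -- `q₀` is the centre of the lower member of the facing vertical pair that contains the given
  -- supertile.
  obtain ⟨q₀, h1, h2, h3⟩ : ∃ q₀, C p q₀ ∧ IsSupertile n x p q₀ 1 1 ∧
      IsSupertile n x p (q₀ + 2 ^ (n + 1)) 1 (-1) := by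
    have h0 := hS _ _ h
    rcases h0.2.1 with h1 | h1
    · have h2 := hS _ _ (hC.up h)
      obtain ⟨h3, h4⟩ := h0.ver_neighbour hx h2
      rw [h3, h4 h1] at h2
      rw [he, h1] at h0 h2
      exact ⟨q, h, h0, h2⟩
    · have h2 := hS _ _ (hC.down h)
      have h2' := h2
      obtain ⟨h3, h4⟩ := h2.ver_neighbour hx (by rwa [sub_add_cancel])
      have h5 : d p (q - 2 ^ (n + 1)) = 1 := by omega
      rw [h5, ← h4 h5, he] at h2'
      refine ⟨_, hC.down h, h2', ?_⟩
      rw [sub_add_cancel]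
      rwa [he, h1] at h0
  obtain ⟨q₁, h4⟩ := hC.right h
  by_contra hne
  apply h2.east_not_tail hx h3
  have hnd : ¬ (2 : ℤ) ^ (n + 1) ∣ q₀ - q₁ := fun hd =>
    hne (hC.of_dvd (hC.of_dvd h4 hd) (hC.row h1 h))
  set y := q₀ + 2 ^ n with hy
  -- `r - 2 ^ n` is the height of the gap row `y` above the nearest centre of the next column; `r =
  -- 0` would mean that `y` is a gap of that column too.
  set r := (y - q₁ + 2 ^ n) % 2 ^ (n + 1) with hr
  have hr0 : 0 ≤ r := Int.emod_nonneg _ (by positivity)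
  have hr1 : r < 2 ^ (n + 1) := Int.emod_lt_of_pos _ (by positivity)
  have hr2 : (2 : ℤ) ^ (n + 1) ∣ (y - q₁ + 2 ^ n) - r := Int.dvd_self_sub_emod
  have hr3 : r ≠ 0 := by
    intro h0
    rw [h0, sub_zero] at hr2
    apply hnd
    have h5 : y - q₁ + 2 ^ n = (q₀ - q₁) + 2 ^ (n + 1) := by rw [hy, hM]; ring
    rw [h5] at hr2
    simpa using hr2
  have h5 : C (p + 2 ^ (n + 1)) (y - (r - 2 ^ n)) :=
    hC.of_dvd h4 (by convert hr2 using 1; ring)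
  have h6 := (hS _ _ h5).east_left_mid hx (j := r - 2 ^ n) (by
    rw [abs_lt]; constructor <;> omega)
  rwa [sub_add_cancel, show p + 2 ^ (n + 1) - 2 ^ n = p + 2 ^ n by rw [hM]; ring] at h6

theorem IsColumnLattice.isFacing (hx : IsRobinsonTiling x) (hC : IsColumnLattice (2 ^ (n + 1)) C)
    (hS : ∀ p q, C p q → IsSupertile n x p q (e p q) (d p q)) :
    IsFacing (2 ^ (n + 1)) C e d := by
  have hE : ∀ {p q}, C p q → e p q = 1 → C (p + 2 ^ (n + 1)) q :=
    fun h he => hC.aligned_of_east hx hS h he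
  have hW : ∀ {p q}, C p q → e p q = -1 → C (p - 2 ^ (n + 1)) q := fun {p q} h he => by
    have := IsColumnLattice.aligned_of_east hx.mirror hC.mirror
      (e := fun p q => -e (-p) q) (d := fun p q => d (-p) q)
      (fun p q h => by simpa using (hS _ _ h).mirror) (p := -p) (q := q) (by simpa using h)
      (by simp [he])
    rwa [show -(-p + (2 : ℤ) ^ (n + 1)) = p - 2 ^ (n + 1) by ring] at this
  have hhor : ∀ {p q}, C p q → C (p + 2 ^ (n + 1)) q → e (p + 2 ^ (n + 1)) q = -e p q ∧
      (e p q = 1 → d (p + 2 ^ (n + 1)) q = d p q) :=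
    fun h h' => (hS _ _ h).hor_neighbour hx (hS _ _ h')
  have hver : ∀ {p q}, C p q → C p (q + 2 ^ (n + 1)) → d p (q + 2 ^ (n + 1)) = -d p q ∧
      (d p q = 1 → e p (q + 2 ^ (n + 1)) = e p q) :=
    fun h h' => (hS _ _ h).ver_neighbour hx (hS _ _ h')
  refine ⟨fun h => (hS _ _ h).1, fun h => (hS _ _ h).2.1, ?_, ?_, ?_, ?_, fun h h' => (hhor h h').1,
    fun h h' => (hver h h').1⟩
  · intro p q h he
    have h' := hE h he
    exact ⟨h', by rw [(hhor h h').1, he], (hhor h h').2 he⟩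
  · intro p q h he
    have h' := hW h he
    have h1 := hhor h' (by rwa [sub_add_cancel])
    rw [sub_add_cancel] at h1
    have h2 : e (p - 2 ^ (n + 1)) q = 1 := by omega
    exact ⟨h', h2, (h1.2 h2).symm⟩
  · intro p q h hd
    have h' := hC.up h
    exact ⟨h', by rw [(hver h h').1, hd], (hver h h').2 hd⟩
  · intro p q h hd
    have h' := hC.down h
    have h1 := hver h' (by rwa [sub_add_cancel])
    rw [sub_add_cancel] at h1
    have h2 : d p (q - 2 ^ (n + 1)) = 1 := by omega
    exact ⟨h', h2, (h1.2 h2).symm⟩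

end Supertiles

/-! ### The hierarchy of supertiles of a Robinson tiling -/

/-- The centres of the supertiles of level `n`; those of level `0` are restricted to the coset of
`(k, l)` modulo `2ℤ²`. -/
def superCenter (x : ℤ → ℤ → MarkedSquare) (k l : ℤ) : ℕ → ℤ → ℤ → Prop
  | 0, p, q => 2 ∣ p - k ∧ 2 ∣ q - l
  | n + 1, p, q => ∃ e d, IsSupertile (n + 1) x p q e d

theorem IsSupertile.unique {n : ℕ} {x : ℤ → ℤ → MarkedSquare} {p q e d e' d' : ℤ}
    (h : IsSupertile n x p q e d) (h' : IsSupertile n x p q e' d') : e = e' ∧ d = d' := by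
  have h1 := (h.2.2 0 0 (by simp) (by simp)).symm.trans (h'.2.2 0 0 (by simp) (by simp))
  simp only [add_zero] at h1
  rw [stdTile_eq_cross n (odd_of_sign h.1) (odd_of_sign h.2.1),
    stdTile_eq_cross n (odd_of_sign h'.1) (odd_of_sign h'.2.1)] at h1
  rcases h.1 with rfl | rfl <;> rcases h.2.1 with rfl | rfl <;> rcases h'.1 with rfl | rfl <;>
    rcases h'.2.1 with rfl | rfl <;> revert h1 <;> decide

section Hierarchy

variable {x : ℤ → ℤ → MarkedSquare} {k l : ℤ}

theorem superCenter_transpose (n : ℕ) (p q : ℤ) :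
    superCenter (transposeTiling x) l k n q p ↔ superCenter x k l n p q := by
  cases n with
  | zero => exact and_comm
  | succ n =>
    exact ⟨fun ⟨e, d, h⟩ => ⟨d, e, h.transpose⟩, fun ⟨e, d, h⟩ => ⟨d, e, h.transpose⟩⟩

theorem isCross_of_dvd (hk : ∀ i j, (x (k + 2 * i) (l + 2 * j)).IsCross) {i j : ℤ}
    (hi : 2 ∣ i - k) (hj : 2 ∣ j - l) : (x i j).IsCross := by
  obtain ⟨a, ha⟩ := hi
  obtain ⟨b, hb⟩ := hj
  obtain rfl : i = k + 2 * a := by linarith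
  obtain rfl : j = l + 2 * b := by linarith
  exact hk a b

/-- Any other coset would make two crosses adjacent, with head meeting head. Hence the second half
of the cross rule follows from the first. -/
theorem parity_of_isCross (hx : IsRobinsonTiling x)
    (hk : ∀ i j, (x (k + 2 * i) (l + 2 * j)).IsCross) {i j : ℤ} (h : (x i j).IsCross) :
    (2 ∣ i - k ∧ 2 ∣ j - l) ∨ (2 ∣ i - k - 1 ∧ 2 ∣ j - l - 1) := by
  have h1 : ¬ (2 ∣ i - k ∧ 2 ∣ j - l - 1) := fun ⟨hi, hj⟩ => by
    have h2 := (isCross_of_dvd hk hi (j := j + 1) (by omega)).mid.2.2.2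
    rw [hx.ver, SideMarks.opp_mid_eq_head, h.mid.2.1] at h2
    cases h2
  have h2 : ¬ (2 ∣ i - k - 1 ∧ 2 ∣ j - l) := fun ⟨hi, hj⟩ => by
    have h2 := (isCross_of_dvd hk (i := i + 1) (by omega) hj).mid.2.2.1
    rw [hx.hor, SideMarks.opp_mid_eq_head, h.mid.1] at h2
    cases h2
  omega

theorem superCenter.exists_isSupertile (hk : ∀ i j, (x (k + 2 * i) (l + 2 * j)).IsCross) {n : ℕ}
    {p q : ℤ} (h : superCenter x k l n p q) : ∃ e d, IsSupertile n x p q e d := by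
  cases n with
  | zero =>
    obtain ⟨e, d, he, hd, h⟩ := exists_stdTile_eq_of_isCross (isCross_of_dvd hk h.1 h.2) 0
    refine ⟨e, d, he, hd, fun i j hi hj => ?_⟩
    rw [pow_zero, abs_lt] at hi hj
    obtain rfl : i = 0 := by omega
    obtain rfl : j = 0 := by omega
    simpa using h
  | succ n => exact h

theorem superCenter_succ (hx : IsRobinsonTiling x)
    (hk : ∀ i j, (x (k + 2 * i) (l + 2 * j)).IsCross) {n : ℕ} {p q : ℤ} :
    superCenter x k l (n + 1) p q ↔ ∀ s t : ℤ, (s = 1 ∨ s = -1) → (t = 1 ∨ t = -1) →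
      superCenter x k l n (p + 2 ^ n * s) (q + 2 ^ n * t) ∧
      IsSupertile n x (p + 2 ^ n * s) (q + 2 ^ n * t) (-s) (-t) := by
  refine ⟨fun ⟨e, d, h⟩ s t hs ht => ⟨?_, h.corner hs ht⟩, fun h =>
    IsSupertile.of_corners hx fun s t hs ht => (h s t hs ht).2⟩
  cases n with
  | succ n => exact ⟨_, _, h.corner hs ht⟩
  | zero =>
    have hc : (x (p + 2 ^ 0 * s) (q + 2 ^ 0 * t)).IsCross := by
      have h1 := h.corner hs ht
      have := h1.2.2 0 0 (by simp) (by simp)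
      rw [add_zero, add_zero, add_zero, add_zero] at this
      rw [this]
      exact stdTile_isCross 0 (odd_of_sign h1.1) (odd_of_sign h1.2.1)
    rcases parity_of_isCross hx hk hc with h1 | ⟨h1, h2⟩
    · exact h1
    -- Corners on the other coset would put a cross of the main coset at `(p + 2, q)`, next to the
    -- supertile, where a black arrow comes in from the west.
    · exfalso
      have h3 := h.west_right_mid hx (j := 0) (by simp)
      have h4 : (x (p + 2 ^ (0 + 1)) (q + 0)).IsCross := by
        apply isCross_of_dvd hk
        · rcases hs with rfl | rfl <;> norm_num at h1 ⊢ <;> omega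
        · rcases ht with rfl | rfl <;> norm_num at h2 ⊢ <;> omega
      rw [h4.mid.2.2.1] at h3
      cases h3

theorem IsColumnLattice.translate {M : ℤ} {C : ℤ → ℤ → Prop} (hC : IsColumnLattice M C) (a b : ℤ) :
    IsColumnLattice M (fun p q => C (p - a) (q - b)) where
  up {p q} h := by rw [add_sub_right_comm]; exact hC.up h
  down {p q} h := by rw [sub_right_comm]; exact hC.down h
  col h h' := by simpa using hC.col h h'
  row h h' := by simpa using hC.row h h'
  right {p q} h := by
    obtain ⟨q', h'⟩ := hC.right h
    exact ⟨q' + b, by rwa [add_sub_right_comm, add_sub_cancel_right]⟩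
  left {p q} h := by
    obtain ⟨q', h'⟩ := hC.left h
    exact ⟨q' + b, by rwa [sub_right_comm, add_sub_cancel_right]⟩
  nonempty := by
    obtain ⟨p, q, h⟩ := hC.nonempty
    exact ⟨p + a, q + b, by simpa using h⟩

theorem superCenter_succ_iff (hx : IsRobinsonTiling x)
    (hk : ∀ i j, (x (k + 2 * i) (l + 2 * j)).IsCross) {n : ℕ} {e d : ℤ → ℤ → ℤ}
    (hS : ∀ p q, superCenter x k l n p q → IsSupertile n x p q (e p q) (d p q))
    (hF : IsFacing (2 ^ (n + 1)) (superCenter x k l n) e d) (p q : ℤ) :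
    superCenter x k l (n + 1) p q ↔ superCenter x k l n (p - 2 ^ n) (q - 2 ^ n) ∧
      e (p - 2 ^ n) (q - 2 ^ n) = 1 ∧ d (p - 2 ^ n) (q - 2 ^ n) = 1 := by
  have hM : (2 : ℤ) ^ (n + 1) = 2 * 2 ^ n := pow_succ' 2 n
  rw [superCenter_succ hx hk]
  constructor
  · intro h
    obtain ⟨h1, h2⟩ := h (-1) (-1) (by simp) (by simp)
    rw [mul_neg_one, ← sub_eq_add_neg, ← sub_eq_add_neg] at h1 h2
    rw [neg_neg] at h2
    exact ⟨h1, (hS _ _ h1).unique h2⟩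
  · rintro ⟨h, he, hd⟩ s t hs ht
    have hsq := hF.square h he hd
    simp only [hM, show ∀ p : ℤ, p - 2 ^ n + 2 * 2 ^ n = p + 2 ^ n by intro p; ring] at hsq
    obtain ⟨⟨h1, h2, h3⟩, ⟨h4, h5, h6⟩, ⟨h7, h8, h9⟩⟩ := hsq
    rcases hs with rfl | rfl <;> rcases ht with rfl | rfl <;>
      simp only [mul_one, mul_neg, ← sub_eq_add_neg, neg_neg]
    · exact ⟨h7, by have := hS _ _ h7; rwa [h8, h9] at this⟩
    · exact ⟨h1, by have := hS _ _ h1; rwa [h2, h3] at this⟩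
    · exact ⟨h4, by have := hS _ _ h4; rwa [h5, h6] at this⟩
    · exact ⟨h, by have := hS _ _ h; rwa [he, hd] at this⟩

theorem exists_facing (hk : ∀ i j, (x (k + 2 * i) (l + 2 * j)).IsCross) (n : ℕ) :
    ∃ e d : ℤ → ℤ → ℤ, ∀ p q, superCenter x k l n p q → IsSupertile n x p q (e p q) (d p q) := by
  have h : ∀ p q, ∃ e d, superCenter x k l n p q → IsSupertile n x p q e d := by
    intro p q
    by_cases h : superCenter x k l n p q
    · obtain ⟨e, d, h'⟩ := h.exists_isSupertile hk
      exact ⟨e, d, fun _ => h'⟩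
    · exact ⟨0, 0, fun h' => absurd h' h⟩
  choose e d h using h
  exact ⟨e, d, h⟩

theorem isColumnLattice_succ_or (hx : IsRobinsonTiling x)
    (hk : ∀ i j, (x (k + 2 * i) (l + 2 * j)).IsCross) {n : ℕ}
    (hC : IsColumnLattice (2 ^ (n + 1)) (superCenter x k l n)) :
    IsColumnLattice (2 ^ (n + 1 + 1)) (superCenter x k l (n + 1)) ∨
      IsColumnLattice (2 ^ (n + 1 + 1)) (superCenter (transposeTiling x) l k (n + 1)) := by
  obtain ⟨e, d, hS⟩ := exists_facing hk n
  have hF := hC.isFacing hx hS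
  have hiff := superCenter_succ_iff hx hk hS hF
  rw [pow_succ']
  rcases hC.double_or hF with h | h
  · left
    convert h.translate (2 ^ n) (2 ^ n) using 3
    rw [hiff]
  · right
    convert h.translate (2 ^ n) (2 ^ n) using 3
    rw [superCenter_transpose, hiff]

theorem crosses_transpose (hk : ∀ i j, (x (k + 2 * i) (l + 2 * j)).IsCross) (i j : ℤ) :
    (transposeTiling x (l + 2 * i) (k + 2 * j)).IsCross := (hk j i).transpose

/-- The doubling step guarantees alignment in only one of the two directions and does not say which,
so the induction has to allow for both. -/
theorem isColumnLattice_or (hx : IsRobinsonTiling x)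
    (hk : ∀ i j, (x (k + 2 * i) (l + 2 * j)).IsCross) (n : ℕ) :
    IsColumnLattice (2 ^ (n + 1)) (superCenter x k l n) ∨
      IsColumnLattice (2 ^ (n + 1)) (superCenter (transposeTiling x) l k n) := by
  induction n with
  | zero =>
    left
    have h0 : ∀ p q, superCenter x k l 0 p q ↔ 2 ∣ p - k ∧ 2 ∣ q - l := fun _ _ => Iff.rfl
    rw [zero_add, pow_one]
    refine ⟨?_, ?_, ?_, ?_, ?_, ?_, k, l, by simp [h0]⟩ <;> simp only [h0]
    · intros; omega
    · intros; omega
    · intros; omega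
    · intros; omega
    · exact fun {p q} h => ⟨q, by omega⟩
    · exact fun {p q} h => ⟨q, by omega⟩
  | succ n ih =>
    rcases ih with h | h
    · exact isColumnLattice_succ_or hx hk h
    · have := isColumnLattice_succ_or hx.transpose (crosses_transpose hk) h
      rw [transposeTiling_transposeTiling] at this
      exact this.symm

theorem exists_isFacing (hx : IsRobinsonTiling x)
    (hk : ∀ i j, (x (k + 2 * i) (l + 2 * j)).IsCross) (n : ℕ) :
    ∃ e d : ℤ → ℤ → ℤ,
      (∀ p q, superCenter x k l n p q → IsSupertile n x p q (e p q) (d p q)) ∧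
      IsFacing (2 ^ (n + 1)) (superCenter x k l n) e d := by
  rcases isColumnLattice_or hx hk n with h | h
  · obtain ⟨e, d, hS⟩ := exists_facing hk n
    exact ⟨e, d, hS, h.isFacing hx hS⟩
  · obtain ⟨e, d, hS⟩ := exists_facing (crosses_transpose hk) n
    have hF := (h.isFacing hx.transpose hS).swap
    refine ⟨Function.swap d, Function.swap e,
      fun p q hpq => (hS q p ((superCenter_transpose n p q).mpr hpq)).transpose, ?_⟩
    convert hF using 1
    funext p q
    exact propext (superCenter_transpose n p q).symm

/-- Every supertile lies in a corner of a supertile of the next level. -/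
theorem exists_parent (hx : IsRobinsonTiling x)
    (hk : ∀ i j, (x (k + 2 * i) (l + 2 * j)).IsCross) {n : ℕ} {p q : ℤ}
    (h : superCenter x k l n p q) : ∃ s t : ℤ, (s = 1 ∨ s = -1) ∧ (t = 1 ∨ t = -1) ∧
      superCenter x k l (n + 1) (p + 2 ^ n * s) (q + 2 ^ n * t) := by
  obtain ⟨e, d, hS, hF⟩ := exists_isFacing hx hk n
  have hiff := superCenter_succ_iff hx hk hS hF
  obtain ⟨s, t, hs, ht, h1⟩ := hF.exists_square h
  refine ⟨1 - 2 * s, 1 - 2 * t, by omega, by omega, ?_⟩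
  rw [hiff]
  convert h1 using 2 <;> ring_nf

/-- Columns that are not aligned stay so at the next level. -/
theorem jump_succ (hx : IsRobinsonTiling x)
    (hk : ∀ i j, (x (k + 2 * i) (l + 2 * j)).IsCross) {n : ℕ} {c : ℤ}
    (hC : IsColumnLattice (2 ^ (n + 1)) (superCenter x k l n))
    (hj : ∃ q, superCenter x k l n (c - 2 ^ n) q ∧ ¬ superCenter x k l n (c + 2 ^ n) q) :
    IsColumnLattice (2 ^ (n + 1 + 1)) (superCenter x k l (n + 1)) ∧
      ∃ q, superCenter x k l (n + 1) (c - 2 ^ (n + 1)) q ∧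
        ¬ superCenter x k l (n + 1) (c + 2 ^ (n + 1)) q := by
  have hM : (2 : ℤ) ^ (n + 1) = 2 * 2 ^ n := pow_succ' 2 n
  obtain ⟨q, h1, h2⟩ := hj
  obtain ⟨e, d, hS⟩ := exists_facing hk n
  have hF := hC.isFacing hx hS
  have hiff := superCenter_succ_iff hx hk hS hF
  have h2' : ¬ superCenter x k l n (c - 2 ^ n + 2 ^ (n + 1)) q := by
    rwa [show c - 2 ^ n + 2 ^ (n + 1) = c + 2 ^ n by rw [hM]; ring]
  constructor
  · rw [pow_succ']
    convert (hC.double hF (hC.isCoherent_of_jump hF h1 h2')).translate (2 ^ n) (2 ^ n) using 3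
    rw [hiff]
  -- Opening east would force alignment across `c`. So the parents of the column left of `c` lie
  -- further left, in column `c - 2 ^ (n + 1)`, and the gap stays at `c`.
  · have he : e (c - 2 ^ n) q = -1 :=
      (hF.sign_left h1).resolve_left fun h => h2' (hF.east h1 h).1
    obtain ⟨q', h3⟩ : ∃ q', superCenter x k l (n + 1) (c - 2 ^ (n + 1)) q' := by
      obtain ⟨h3, h4, h5⟩ := hF.west h1 he
      rw [show c - 2 ^ n - 2 ^ (n + 1) = c - 2 ^ (n + 1) - 2 ^ n by ring] at h3 h4 h5
      rcases hF.sign_right h3 with h6 | h6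
      · exact ⟨q + 2 ^ n, by rw [hiff, add_sub_cancel_right]; exact ⟨h3, h4, h6⟩⟩
      · obtain ⟨h7, h8, h9⟩ := hF.south h3 h6
        exact ⟨q - 2 ^ (n + 1) + 2 ^ n, by
          rw [hiff, add_sub_cancel_right]; exact ⟨h7, h9.trans h4, h8⟩⟩
    refine ⟨q', h3, fun h4 => h2 ?_⟩
    have h5 := ((superCenter_succ hx hk).mp h3 1 1 (by simp) (by simp)).1
    have h6 := ((superCenter_succ hx hk).mp h4 (-1) 1 (by simp) (by simp)).1
    rw [show c - 2 ^ (n + 1) + 2 ^ n * 1 = c - 2 ^ n by rw [hM]; ring] at h5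
    rw [show c + 2 ^ (n + 1) + 2 ^ n * -1 = c + 2 ^ n by rw [hM]; ring] at h6
    exact hC.of_dvd h6 (hC.row h5 h1)

theorem jump_le (hx : IsRobinsonTiling x)
    (hk : ∀ i j, (x (k + 2 * i) (l + 2 * j)).IsCross) {n N : ℕ} (hN : n ≤ N) {c : ℤ}
    (hC : IsColumnLattice (2 ^ (n + 1)) (superCenter x k l n))
    (hj : ∃ q, superCenter x k l n (c - 2 ^ n) q ∧ ¬ superCenter x k l n (c + 2 ^ n) q) :
    IsColumnLattice (2 ^ (N + 1)) (superCenter x k l N) ∧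
      ∃ q, superCenter x k l N (c - 2 ^ N) q ∧ ¬ superCenter x k l N (c + 2 ^ N) q := by
  induction N, hN using Nat.le_induction with
  | base => exact ⟨hC, hj⟩
  | succ N _ ih => exact jump_succ hx hk ih.1 ih.2

end Hierarchy

theorem eq_zero_of_forall_two_pow_dvd {m : ℤ} {n : ℕ} (h : ∀ N ≥ n, (2 : ℤ) ^ N ∣ m) : m = 0 := by
  by_contra h0
  have h1 := Int.le_of_dvd (abs_pos.mpr h0) ((dvd_abs _ _).mpr (h (n + m.natAbs) (by omega)))
  rw [Int.abs_eq_natAbs] at h1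
  have h2 : m.natAbs < 2 ^ (n + m.natAbs) :=
    lt_of_le_of_lt (Nat.le_add_left _ n) Nat.lt_two_pow_self
  have h3 : (m.natAbs : ℤ) < 2 ^ (n + m.natAbs) := by exact_mod_cast h2
  omega

/-! ### The shape of the lattices of centres -/

/-- `C` is made up of cosets of `2 ^ (n + 1) ℤ²` to the left and to the right of the column `c`,
where the gaps between the supertiles are at the column `c` and at the rows `a` and `b`. -/
def HasShape (C : ℤ → ℤ → Prop) (n : ℕ) (c a b : ℤ) : Prop :=
  ∀ p q, C p q ↔ (2 : ℤ) ^ (n + 1) ∣ p - c - 2 ^ n ∧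
    (p < c → (2 : ℤ) ^ (n + 1) ∣ q - a - 2 ^ n) ∧ (c < p → (2 : ℤ) ^ (n + 1) ∣ q - b - 2 ^ n)

theorem ne_of_two_pow_dvd {n : ℕ} {p c : ℤ} (h : (2 : ℤ) ^ (n + 1) ∣ p - c - 2 ^ n) : p ≠ c := by
  rintro rfl
  rw [sub_self, zero_sub, dvd_neg, pow_succ] at h
  have h1 : (0 : ℤ) < 2 ^ n := by positivity
  have := Int.le_of_dvd h1 h
  omega

theorem hasShape_self_iff {C : ℤ → ℤ → Prop} {n : ℕ} {c a : ℤ} :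
    HasShape C n c a a ↔ ∀ p q, C p q ↔ (2 : ℤ) ^ (n + 1) ∣ p - c - 2 ^ n ∧
      (2 : ℤ) ^ (n + 1) ∣ q - a - 2 ^ n := by
  refine forall_congr' fun p => forall_congr' fun q => iff_congr Iff.rfl
    (and_congr_right fun h => ?_)
  rcases lt_or_gt_of_ne (ne_of_two_pow_dvd h) with h1 | h1
  · simp [h1, h1.le]
  · simp [h1, h1.le]

/-- Only the step across `c` may break the alignment, so all columns on the left share the residue
of `q₀` and all columns on the right that of `q₁`. -/
theorem IsColumnLattice.hasShape {n : ℕ} {C : ℤ → ℤ → Prop}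
    (hC : IsColumnLattice (2 ^ (n + 1)) C) {c q₀ q₁ : ℤ} (h0 : C (c - 2 ^ n) q₀)
    (h1 : C (c + 2 ^ n) q₁) (hj : ∀ p q, C p q → p ≠ c - 2 ^ n → C (p + 2 ^ (n + 1)) q) :
    HasShape C n c (q₀ - 2 ^ n) (q₁ - 2 ^ n) := by
  have hM : (2 : ℤ) ^ (n + 1) = 2 * 2 ^ n := pow_succ' 2 n
  have hpos : (0 : ℤ) < 2 ^ n := by positivity
  have hR : ∀ i : ℕ, C (c + 2 ^ n + 2 ^ (n + 1) * i) q₁ := by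
    intro i
    induction i with
    | zero => simpa using h1
    | succ i ih =>
      have := hj _ _ ih (by have : 0 ≤ (2 : ℤ) ^ (n + 1) * i := by positivity
                            linarith)
      push_cast
      rwa [mul_add, mul_one, ← add_assoc]
  have hL : ∀ i : ℕ, C (c - 2 ^ n - 2 ^ (n + 1) * i) q₀ := by
    intro i
    induction i with
    | zero => simpa using h0
    | succ i ih =>
      obtain ⟨q', h'⟩ := hC.left ih
      have h2 := hj _ _ h' (by have : 0 ≤ (2 : ℤ) ^ (n + 1) * i := by positivity
                               linarith)
      rw [sub_add_cancel] at h2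
      push_cast
      rw [mul_add, mul_one, ← sub_sub]
      exact hC.of_dvd h' (hC.row h2 ih)
  have hres : ∀ p, (2 : ℤ) ^ (n + 1) ∣ p - c - 2 ^ n →
      (p < c ∧ C p q₀) ∨ (c < p ∧ C p q₁) := by
    rintro p ⟨i, hi⟩
    rcases le_or_gt 0 i with h2 | h2
    · right
      lift i to ℕ using h2
      obtain rfl : p = c + 2 ^ n + 2 ^ (n + 1) * i := by linarith
      refine ⟨?_, hR i⟩
      have : 0 ≤ (2 : ℤ) ^ (n + 1) * i := by positivity
      linarith
    · left
      obtain ⟨m, rfl⟩ : ∃ m : ℕ, i = -(m + 1 : ℤ) := ⟨(-i - 1).toNat, by omega⟩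
      obtain rfl : p = c - 2 ^ n - 2 ^ (n + 1) * m := by rw [hM] at *; linarith
      refine ⟨?_, hL m⟩
      have : 0 ≤ (2 : ℤ) ^ (n + 1) * m := by positivity
      linarith
  intro p q
  simp only [show ∀ r : ℤ, q - (r - 2 ^ n) - 2 ^ n = q - r by intro r; ring]
  constructor
  · intro h
    have h2 : (2 : ℤ) ^ (n + 1) ∣ p - c - 2 ^ n := by
      have := hC.col h1 h
      rwa [← sub_sub] at this
    rcases hres p h2 with ⟨h3, h4⟩ | ⟨h3, h4⟩
    · exact ⟨h2, fun _ => hC.row h4 h, fun h5 => by linarith⟩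
    · exact ⟨h2, fun h5 => by linarith, fun _ => hC.row h4 h⟩
  · rintro ⟨h2, h5, h6⟩
    rcases hres p h2 with ⟨h3, h4⟩ | ⟨h3, h4⟩
    · exact hC.of_dvd h4 (h5 h3)
    · exact hC.of_dvd h4 (h6 h3)

section Shape

variable {x : ℤ → ℤ → MarkedSquare} {k l : ℤ}

/-- The parent is at distance at least `2 ^ (n + 1)` from `c` and its child only `2 ^ n` away from
it, so both lie on the same side of `c`. -/
theorem parent_residue {n : ℕ} {p c s : ℤ} (hs : s = 1 ∨ s = -1)
    (h : (2 : ℤ) ^ (n + 1 + 1) ∣ p + 2 ^ n * s - c - 2 ^ (n + 1)) :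
    (2 : ℤ) ^ (n + 1) ∣ p - c - 2 ^ n ∧ (p < c ↔ p + 2 ^ n * s < c) ∧
      (c < p ↔ c < p + 2 ^ n * s) := by
  obtain ⟨m, hm⟩ := h
  have hM : (2 : ℤ) ^ (n + 1) = 2 * 2 ^ n := pow_succ' 2 n
  have hM' : (2 : ℤ) ^ (n + 1 + 1) = 4 * 2 ^ n := by rw [pow_succ', hM]; ring
  have hpos : (0 : ℤ) < 2 ^ n := by positivity
  rw [hM'] at hm
  rw [hM] at hm ⊢
  have hp : p = c + 2 ^ n * (2 + 4 * m - s) := by linarith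
  have hp' : p + 2 ^ n * s = c + 2 ^ n * (2 + 4 * m) := by linarith
  have hneg : ∀ z : ℤ, c + 2 ^ n * z < c ↔ z < 0 := fun z => by
    rw [add_lt_iff_neg_left]
    constructor <;> intro h <;> nlinarith
  have hpos' : ∀ z : ℤ, c < c + 2 ^ n * z ↔ 0 < z := fun z => by
    rw [lt_add_iff_pos_right]
    constructor <;> intro h <;> nlinarith
  rw [hp', hp, hneg, hneg, hpos', hpos']
  refine ⟨?_, by omega, by omega⟩
  rcases hs with rfl | rfl
  · exact ⟨2 * m, by ring⟩
  · exact ⟨2 * m + 1, by ring⟩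

theorem exists_parent_residue {n : ℕ} {p c : ℤ} (h : (2 : ℤ) ^ (n + 1) ∣ p - c - 2 ^ n) :
    ∃ s : ℤ, (s = 1 ∨ s = -1) ∧ (2 : ℤ) ^ (n + 1 + 1) ∣ p + 2 ^ n * s - c - 2 ^ (n + 1) := by
  obtain ⟨m, hm⟩ := h
  have hM : (2 : ℤ) ^ (n + 1) = 2 * 2 ^ n := pow_succ' 2 n
  have hM' : (2 : ℤ) ^ (n + 1 + 1) = 4 * 2 ^ n := by rw [pow_succ', hM]; ring
  rw [hM] at hm
  rw [hM', hM]
  obtain ⟨i, rfl | rfl⟩ := Int.even_or_odd' m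
  · exact ⟨1, by simp, i, by linarith⟩
  · exact ⟨-1, by simp, i, by linarith⟩

/-- Every centre has a parent and every parent has all four children, so the centres of one level
are read off from those of the next, with the same gap lines. -/
theorem HasShape.of_succ (hx : IsRobinsonTiling x)
    (hk : ∀ i j, (x (k + 2 * i) (l + 2 * j)).IsCross) {n : ℕ} {c a b : ℤ}
    (h : HasShape (superCenter x k l (n + 1)) (n + 1) c a b) :
    HasShape (superCenter x k l n) n c a b := by
  intro p q
  constructor
  · intro hpq
    obtain ⟨s, t, hs, ht, h1⟩ := exists_parent hx hk hpq
    rw [h] at h1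
    obtain ⟨h2, h3, h4⟩ := parent_residue hs h1.1
    refine ⟨h2, fun h5 => ?_, fun h5 => ?_⟩
    · exact (parent_residue ht (h1.2.1 (h3.mp h5))).1
    · exact (parent_residue ht (h1.2.2 (h4.mp h5))).1
  · rintro ⟨h1, h2, h3⟩
    obtain ⟨s, hs, h4⟩ := exists_parent_residue h1
    obtain ⟨-, h5, h6⟩ := parent_residue hs h4
    obtain ⟨t, ht, h7⟩ : ∃ t : ℤ, (t = 1 ∨ t = -1) ∧
        superCenter x k l (n + 1) (p + 2 ^ n * s) (q + 2 ^ n * t) := by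
      rcases lt_or_gt_of_ne (ne_of_two_pow_dvd h1) with h8 | h8
      · obtain ⟨t, ht, h9⟩ := exists_parent_residue (h2 h8)
        exact ⟨t, ht, (h _ _).mpr ⟨h4, fun _ => h9, fun h10 => by have := h6.mpr h10; omega⟩⟩
      · obtain ⟨t, ht, h9⟩ := exists_parent_residue (h3 h8)
        exact ⟨t, ht, (h _ _).mpr ⟨h4, fun h10 => by have := h5.mpr h10; omega, fun _ => h9⟩⟩
    have := ((superCenter_succ hx hk).mp h7 (-s) (-t) (by omega) (by omega)).1
    rwa [show p + 2 ^ n * s + 2 ^ n * -s = p by ring,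
      show q + 2 ^ n * t + 2 ^ n * -t = q by ring] at this

/-- Unless all columns are aligned, the supertiles of all levels are placed on both sides of one
column. -/
theorem exists_hasShape_of_jump (hx : IsRobinsonTiling x)
    (hk : ∀ i j, (x (k + 2 * i) (l + 2 * j)).IsCross) {n : ℕ} {c : ℤ}
    (hC : IsColumnLattice (2 ^ (n + 1)) (superCenter x k l n))
    (hj : ∃ q, superCenter x k l n (c - 2 ^ n) q ∧ ¬ superCenter x k l n (c + 2 ^ n) q) (N : ℕ) :
    ∃ a b, HasShape (superCenter x k l N) N c a b := by
  have hlarge : ∀ N ≥ n, ∃ a b, HasShape (superCenter x k l N) N c a b := by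
    intro N hN
    obtain ⟨hCN, q₀, h0, h0'⟩ := jump_le hx hk hN hC hj
    obtain ⟨q₁, h1⟩ := hCN.right h0
    rw [show c - 2 ^ N + 2 ^ (N + 1) = c + 2 ^ N by ring] at h1
    refine ⟨_, _, hCN.hasShape h0 h1 fun p q hpq hp => ?_⟩
    by_contra hcon
    have hj' : ∃ q, superCenter x k l N (p + 2 ^ N - 2 ^ N) q ∧
        ¬ superCenter x k l N (p + 2 ^ N + 2 ^ N) q :=
      ⟨q, by rwa [add_sub_cancel_right],
        by rwa [show p + 2 ^ N + 2 ^ N = p + 2 ^ (N + 1) by ring]⟩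
    -- A second misaligned gap column would persist at all higher levels as well, and gap columns of
    -- one level are congruent modulo its spacing; so the two agree modulo every power of two.
    have : p + 2 ^ N - c = 0 := by
      refine eq_zero_of_forall_two_pow_dvd (n := N) fun N' hN' => ?_
      obtain ⟨h3, q3, h4, -⟩ := jump_le hx hk hN' hCN hj'
      obtain ⟨-, q5, h5, -⟩ := jump_le hx hk (hN.trans hN') hC hj
      have := h3.col h5 h4
      refine (pow_dvd_pow 2 (Nat.le_succ N')).trans ?_
      rwa [sub_sub_sub_cancel_right] at this
    exact hp (by linarith)
  rcases le_total n N with h | h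
  · exact hlarge N h
  · obtain ⟨a, b, hab⟩ := hlarge n le_rfl
    refine ⟨a, b, ?_⟩
    clear hlarge hj hC
    induction n, h using Nat.le_induction with
    | base => exact hab
    | succ n _ ih => exact ih (hab.of_succ hx hk)

/-- The supertiles of a Robinson tiling form full lattices, or are placed on both sides of one
column, or on both sides of one row. -/
theorem exists_hasShape (hx : IsRobinsonTiling x)
    (hk : ∀ i j, (x (k + 2 * i) (l + 2 * j)).IsCross) :
    (∀ n, ∃ c a, HasShape (superCenter x k l n) n c a a) ∨
    (∃ c, ∀ n, ∃ a b, HasShape (superCenter x k l n) n c a b) ∨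
    (∃ c, ∀ n, ∃ a b, HasShape (superCenter (transposeTiling x) l k n) n c a b) := by
  by_cases h1 : ∃ (n : ℕ) (c : ℤ), IsColumnLattice (2 ^ (n + 1)) (superCenter x k l n) ∧
      ∃ q, superCenter x k l n (c - 2 ^ n) q ∧ ¬ superCenter x k l n (c + 2 ^ n) q
  · obtain ⟨n, c, hC, hj⟩ := h1
    exact Or.inr (Or.inl ⟨c, exists_hasShape_of_jump hx hk hC hj⟩)
  by_cases h2 : ∃ (n : ℕ) (c : ℤ),
      IsColumnLattice (2 ^ (n + 1)) (superCenter (transposeTiling x) l k n) ∧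
      ∃ q, superCenter (transposeTiling x) l k n (c - 2 ^ n) q ∧
        ¬ superCenter (transposeTiling x) l k n (c + 2 ^ n) q
  · obtain ⟨n, c, hC, hj⟩ := h2
    exact Or.inr (Or.inr
      ⟨c, exists_hasShape_of_jump hx.transpose (crosses_transpose hk) hC hj⟩)
  left
  have key : ∀ {C : ℤ → ℤ → Prop} {n : ℕ}, IsColumnLattice (2 ^ (n + 1)) C →
      (¬ ∃ c q, C (c - 2 ^ n) q ∧ ¬ C (c + 2 ^ n) q) → ∃ c a, HasShape C n c a a := by
    intro C n hC hno
    have hR : ∀ p q, C p q → C (p + 2 ^ (n + 1)) q := fun p q h => by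
      by_contra hcon
      exact hno ⟨p + 2 ^ n, q, by rwa [add_sub_cancel_right],
        by rwa [show p + 2 ^ n + 2 ^ n = p + 2 ^ (n + 1) by ring]⟩
    obtain ⟨p, q, h⟩ := hC.nonempty
    exact ⟨p + 2 ^ n, q - 2 ^ n, hC.hasShape (by rwa [add_sub_cancel_right])
      (by have := hR _ _ h; rwa [show p + 2 ^ n + 2 ^ n = p + 2 ^ (n + 1) by ring])
      fun p q h _ => hR p q h⟩
  intro n
  rcases isColumnLattice_or hx hk n with h | h
  · exact key h fun ⟨c, hc⟩ => h1 ⟨n, c, h, hc⟩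
  · obtain ⟨c, a, hca⟩ := key h fun ⟨c, hc⟩ => h2 ⟨n, c, h, hc⟩
    refine ⟨a, c, hasShape_self_iff.mpr fun p q => ?_⟩
    rw [← superCenter_transpose, hasShape_self_iff.mp hca]
    exact and_comm

end Shape

/-! ### Phases of a Robinson tiling -/

/-- The centres of the supertiles of level `n`. -/
def centers (x : ℤ → ℤ → MarkedSquare) (n : ℕ) (p q : ℤ) : Prop :=
  ∃ e d, IsSupertile n x p q e d

theorem centers_transpose {x : ℤ → ℤ → MarkedSquare} {n : ℕ} {p q : ℤ} :
    centers (transposeTiling x) n q p ↔ centers x n p q :=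
  ⟨fun ⟨e, d, h⟩ => ⟨d, e, h.transpose⟩, fun ⟨e, d, h⟩ => ⟨d, e, h.transpose⟩⟩

theorem HasShape.congr {C : ℤ → ℤ → Prop} {n : ℕ} {c a b a' b' : ℤ} (h : HasShape C n c a b)
    (ha : (2 : ℤ) ^ (n + 1) ∣ a' - a) (hb : (2 : ℤ) ^ (n + 1) ∣ b' - b) :
    HasShape C n c a' b' := by
  intro p q
  rw [h]
  have aux : ∀ {a a' : ℤ}, (2 : ℤ) ^ (n + 1) ∣ a' - a →
      ((2 : ℤ) ^ (n + 1) ∣ q - a - 2 ^ n ↔ (2 : ℤ) ^ (n + 1) ∣ q - a' - 2 ^ n) := by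
    intro a a' h
    rw [← dvd_sub_left h (b := q - a - 2 ^ n), show q - a - 2 ^ n - (a' - a) = q - a' - 2 ^ n by
      ring]
  rw [aux ha, aux hb]

theorem exists_dvd_and_lt {σ : ℤ} (hσ : σ = 1 ∨ σ = -1) {M : ℤ} (hM : 0 < M) (r K : ℤ) :
    ∃ p, M ∣ p - r ∧ K < σ * p := by
  refine ⟨r + σ * (M * (|K| + |r| + 1)), ⟨σ * (|K| + |r| + 1), by ring⟩, ?_⟩
  have h1 : |K| + |r| + 1 ≤ M * (|K| + |r| + 1) :=
    le_mul_of_one_le_left (by positivity) hM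
  have h2 := le_abs_self K
  have h3 := abs_le.mp (le_refl |r|)
  rcases hσ with rfl | rfl <;> linarith

/-- Far out in one of the four quadrants, which is given by the signs `σ` and `τ`, the supertiles
of level `n` form a full lattice, and the gaps between them are at the columns `s` and rows `t`
modulo `2 ^ (n + 1)`. -/
def HasPhase (x : ℤ → ℤ → MarkedSquare) (σ τ : ℤ) (n : ℕ) (s t : ℤ) : Prop :=
  ∃ B, ∀ p q, B < σ * p → B < τ * q →
    (centers x n p q ↔ (2 : ℤ) ^ (n + 1) ∣ p - s - 2 ^ n ∧ (2 : ℤ) ^ (n + 1) ∣ q - t - 2 ^ n)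

/-- The tilings `x` and `y` agree far out in a quadrant. -/
def FarEq (x y : ℤ → ℤ → MarkedSquare) (σ τ : ℤ) : Prop :=
  ∃ B, ∀ i j, B < σ * i → B < τ * j → x i j = y i j

section Phase

variable {x y : ℤ → ℤ → MarkedSquare} {n : ℕ} {c a b : ℤ} {σ τ s t s' t' : ℤ}

theorem FarEq.symm (h : FarEq x y σ τ) : FarEq y x σ τ := by
  obtain ⟨B, h⟩ := h
  exact ⟨B, fun i j hi hj => (h i j hi hj).symm⟩

theorem FarEq.transpose (h : FarEq x y σ τ) :
    FarEq (transposeTiling x) (transposeTiling y) τ σ := by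
  obtain ⟨B, h⟩ := h
  exact ⟨B, fun i j hi hj => congrArg _ (h j i hj hi)⟩

theorem IsSupertile.of_eqOn {p q e d : ℤ} (h : IsSupertile n x p q e d)
    (hxy : ∀ i j, |i| < 2 ^ n → |j| < 2 ^ n → x (p + i) (q + j) = y (p + i) (q + j)) :
    IsSupertile n y p q e d :=
  ⟨h.1, h.2.1, fun i j hi hj => by rw [← hxy i j hi hj, h.2.2 i j hi hj]⟩

theorem FarEq.centers (h : FarEq x y σ τ) (hσ : σ = 1 ∨ σ = -1) (hτ : τ = 1 ∨ τ = -1) (n : ℕ) :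
    ∃ B, ∀ p q, B < σ * p → B < τ * q → (centers x n p q ↔ centers y n p q) := by
  obtain ⟨B, h⟩ := h
  refine ⟨B + 2 ^ n, fun p q hp hq => ?_⟩
  have key : ∀ i j, |i| < 2 ^ n → |j| < 2 ^ n → x (p + i) (q + j) = y (p + i) (q + j) := by
    intro i j hi hj
    rw [abs_lt] at hi hj
    apply h
    · rcases hσ with rfl | rfl <;> linarith
    · rcases hτ with rfl | rfl <;> linarith
  exact ⟨fun ⟨e, d, h1⟩ => ⟨e, d, h1.of_eqOn key⟩,
    fun ⟨e, d, h1⟩ => ⟨e, d, h1.of_eqOn fun i j hi hj => (key i j hi hj).symm⟩⟩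

theorem HasPhase.of_farEq (h : HasPhase x σ τ n s t) (hxy : FarEq x y σ τ)
    (hσ : σ = 1 ∨ σ = -1) (hτ : τ = 1 ∨ τ = -1) : HasPhase y σ τ n s t := by
  obtain ⟨B, h⟩ := h
  obtain ⟨B', h'⟩ := hxy.centers hσ hτ n
  exact ⟨max B B', fun p q hp hq => by
    rw [max_lt_iff] at hp hq
    rw [← h' p q hp.2 hq.2, h p q hp.1 hq.1]⟩

theorem HasPhase.transpose (h : HasPhase x σ τ n s t) :
    HasPhase (transposeTiling x) τ σ n t s := by
  obtain ⟨B, h⟩ := h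
  exact ⟨B, fun p q hp hq => by rw [centers_transpose, h q p hq hp, and_comm]⟩

theorem HasPhase.unique (hσ : σ = 1 ∨ σ = -1) (hτ : τ = 1 ∨ τ = -1)
    (h : HasPhase x σ τ n s t) (h' : HasPhase x σ τ n s' t') :
    (2 : ℤ) ^ (n + 1) ∣ s - s' ∧ (2 : ℤ) ^ (n + 1) ∣ t - t' := by
  obtain ⟨B, h⟩ := h
  obtain ⟨B', h'⟩ := h'
  have hM : (0 : ℤ) < 2 ^ (n + 1) := by positivity
  obtain ⟨p, hp, hp'⟩ := exists_dvd_and_lt hσ hM (s + 2 ^ n) (max B B')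
  obtain ⟨q, hq, hq'⟩ := exists_dvd_and_lt hτ hM (t + 2 ^ n) (max B B')
  rw [max_lt_iff] at hp' hq'
  rw [← sub_sub] at hp hq
  obtain ⟨h1, h2⟩ := (h' p q hp'.2 hq'.2).mp ((h p q hp'.1 hq'.1).mpr ⟨hp, hq⟩)
  constructor
  · have := dvd_sub h1 hp
    rwa [show p - s' - 2 ^ n - (p - s - 2 ^ n) = s - s' by ring] at this
  · have := dvd_sub h2 hq
    rwa [show q - t' - 2 ^ n - (q - t - 2 ^ n) = t - t' by ring] at this

theorem HasPhase.congr (h : HasPhase x σ τ n s t) (hs : (2 : ℤ) ^ (n + 1) ∣ s' - s)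
    (ht : (2 : ℤ) ^ (n + 1) ∣ t' - t) : HasPhase x σ τ n s' t' := by
  obtain ⟨B, h⟩ := h
  refine ⟨B, fun p q hp hq => ?_⟩
  rw [h p q hp hq, ← dvd_sub_left hs (b := p - s - 2 ^ n), ← dvd_sub_left ht (b := q - t - 2 ^ n),
    show p - s - 2 ^ n - (s' - s) = p - s' - 2 ^ n by ring,
    show q - t - 2 ^ n - (t' - t) = q - t' - 2 ^ n by ring]

theorem HasShape.hasPhase_right (h : HasShape (centers x n) n c a b) (τ : ℤ) :
    HasPhase x 1 τ n c b := by
  refine ⟨|c|, fun p q hp _ => ?_⟩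
  have := le_abs_self c
  rw [one_mul] at hp
  rw [h, and_congr_right]
  intro _
  simp [show c < p by linarith, show ¬ p < c by linarith]

theorem HasShape.hasPhase_left (h : HasShape (centers x n) n c a b) (τ : ℤ) :
    HasPhase x (-1) τ n c a := by
  refine ⟨|c|, fun p q hp _ => ?_⟩
  have := neg_abs_le c
  rw [h, and_congr_right]
  intro _
  simp [show p < c by linarith, show ¬ c < p by linarith]

theorem HasShape.hasPhase (h : HasShape (centers x n) n c a a) (hσ : σ = 1 ∨ σ = -1) (τ : ℤ) :
    HasPhase x σ τ n c a := by
  rcases hσ with rfl | rfl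
  · exact h.hasPhase_right τ
  · exact h.hasPhase_left τ

theorem HasShape.of_le (hx : IsRobinsonTiling x) {m : ℕ} (hm : m ≤ n)
    (h : HasShape (centers x (n + 1)) (n + 1) c a b) :
    HasShape (centers x (m + 1)) (m + 1) c a b := by
  obtain ⟨k, l, hk⟩ := hx.cross
  induction n, hm using Nat.le_induction with
  | base => exact h
  | succ n _ ih => exact ih (HasShape.of_succ (k := k) (l := l) hx hk h)

/-- Descending to level 0 compares the gap lines with the main coset of crosses; points far on both
sides of `c` reach both `a` and `b`. -/
theorem HasShape.parity (hx : IsRobinsonTiling x) {k l : ℤ}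
    (hk : ∀ i j, (x (k + 2 * i) (l + 2 * j)).IsCross)
    (h : HasShape (centers x (n + 1)) (n + 1) c a b) :
    2 ∣ c - k - 1 ∧ 2 ∣ a - l - 1 ∧ 2 ∣ b - l - 1 := by
  have h0 := HasShape.of_succ hx hk (h.of_le hx (Nat.zero_le n))
  have h1 : ∀ p q, (2 ∣ p - k ∧ 2 ∣ q - l) ↔ 2 ∣ p - c - 1 ∧ (p < c → 2 ∣ q - a - 1) ∧
      (c < p → 2 ∣ q - b - 1) := h0
  have h2 := (h1 (k + 2 * (|c| + |k| + 1)) l).mp ⟨by omega, by omega⟩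
  have h3 := (h1 (k - 2 * (|c| + |k| + 1)) l).mp ⟨by omega, by omega⟩
  have h4 := abs_le.mp (le_refl |c|)
  have h5 := abs_le.mp (le_refl |k|)
  have h6 := h2.2.2 (by omega)
  have h7 := h3.2.1 (by omega)
  omega

/-- Only positive levels appear, because `centers` at level 0 counts every cross and not just those
of the main coset. -/
theorem exists_hasShape_centers (hx : IsRobinsonTiling x) :
    (∀ n, ∃ c a, HasShape (centers x (n + 1)) (n + 1) c a a) ∨
    (∃ c, ∀ n, ∃ a b, HasShape (centers x (n + 1)) (n + 1) c a b) ∨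
    (∃ c, ∀ n, ∃ a b, HasShape (centers (transposeTiling x) (n + 1)) (n + 1) c a b) := by
  obtain ⟨k, l, hk⟩ := hx.cross
  rcases exists_hasShape hx hk with h | ⟨c, h⟩ | ⟨c, h⟩
  · exact Or.inl fun n => h (n + 1)
  · exact Or.inr (Or.inl ⟨c, fun n => h (n + 1)⟩)
  · exact Or.inr (Or.inr ⟨c, fun n => h (n + 1)⟩)

theorem HasShape.swap (h : HasShape (centers x n) n c a a) :
    HasShape (centers (transposeTiling x) n) n a c c := by
  rw [hasShape_self_iff] at h ⊢
  intro p q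
  rw [centers_transpose, h, and_comm]

theorem HasShape.centers_iff (h : HasShape (centers x n) n c a b)
    (h' : HasShape (centers y n) n c a b) (p q : ℤ) : centers x n p q ↔ centers y n p q := by
  rw [h p q, h' p q]

/-! ### The quadrants at infinity determine all centres -/

/-- Two tilings with the same phases in all quadrants, one of whose lattices of centres are
aligned, have the same centres. -/
theorem centers_iff_of_flat (hy : IsRobinsonTiling y)
    (hxy : ∀ σ τ : ℤ, (σ = 1 ∨ σ = -1) → (τ = 1 ∨ τ = -1) → FarEq x y σ τ)
    (h : HasShape (centers x (n + 1)) (n + 1) c a a) (p q : ℤ) :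
    centers x (n + 1) p q ↔ centers y (n + 1) p q := by
  have hph : ∀ σ τ : ℤ, (σ = 1 ∨ σ = -1) → (τ = 1 ∨ τ = -1) → HasPhase y σ τ (n + 1) c a :=
    fun σ τ hσ hτ => (h.hasPhase hσ τ).of_farEq (hxy σ τ hσ hτ) hσ hτ
  have flat : ∀ {c' a'}, HasShape (centers y (n + 1)) (n + 1) c' a' a' →
      (centers x (n + 1) p q ↔ centers y (n + 1) p q) := by
    intro c' a' h'
    obtain ⟨h1, h2⟩ := (hph 1 1 (by simp) (by simp)).unique (by simp) (by simp)
      (h'.hasPhase_right 1)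
    have h3 := h'.congr h2 h2
    have h4 := (h3.swap.congr h1 h1).swap
    exact h.centers_iff h4 p q
  rcases exists_hasShape_centers hy with h1 | ⟨c', h1⟩ | ⟨c', h1⟩
  · obtain ⟨c', a', h2⟩ := h1 n
    exact flat h2
  · obtain ⟨a', b', h2⟩ := h1 n
    -- Both sides of the column of `y` have row phase `a`, so at this level there is no shift across
    -- it.
    have h3 := ((hph 1 1 (by simp) (by simp)).unique (by simp) (by simp) (h2.hasPhase_right 1)).2
    have h4 := ((hph (-1) 1 (by simp) (by simp)).unique (by simp) (by simp)
      (h2.hasPhase_left 1)).2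
    exact flat (h2.congr h4 h3)
  · obtain ⟨a', b', h2⟩ := h1 n
    have h3 := ((hph 1 1 (by simp) (by simp)).transpose.unique (by simp) (by simp)
      (h2.hasPhase_right 1)).2
    have h4 := ((hph 1 (-1) (by simp) (by simp)).transpose.unique (by simp) (by simp)
      (h2.hasPhase_left 1)).2
    exact flat (h2.congr h4 h3).swap

/-- Tilings that agree far out in all four quadrants have the same centres of supertiles. -/
theorem centers_iff_of_farEq (hx : IsRobinsonTiling x) (hy : IsRobinsonTiling y)
    (hxy : ∀ σ τ : ℤ, (σ = 1 ∨ σ = -1) → (τ = 1 ∨ τ = -1) → FarEq x y σ τ) (n : ℕ) (p q : ℤ) :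
    centers x (n + 1) p q ↔ centers y (n + 1) p q := by
  have hyx := fun σ τ hσ hτ => (hxy σ τ hσ hτ).symm
  have two : ∀ {x y : ℤ → ℤ → MarkedSquare},
      (∀ σ τ : ℤ, (σ = 1 ∨ σ = -1) → (τ = 1 ∨ τ = -1) → FarEq x y σ τ) →
      (∃ c, ∀ n, ∃ a b, HasShape (centers x (n + 1)) (n + 1) c a b) →
      (∃ c, ∀ n, ∃ a b, HasShape (centers y (n + 1)) (n + 1) c a b) →
      ∀ p q, centers x (n + 1) p q ↔ centers y (n + 1) p q := by
    rintro x y hxy ⟨c, h⟩ ⟨c', h'⟩ p q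
    -- The phases in one quadrant identify the two fault columns modulo every power of two.
    obtain rfl : c = c' := by
      rw [← sub_eq_zero]
      refine eq_zero_of_forall_two_pow_dvd (n := 0) fun N _ => ?_
      obtain ⟨a, b, h1⟩ := h N
      obtain ⟨a', b', h2⟩ := h' N
      exact (pow_dvd_pow 2 (by omega)).trans
        (((h1.hasPhase_right 1).of_farEq (hxy 1 1 (by simp) (by simp)) (by simp)
          (by simp)).unique (by simp) (by simp) (h2.hasPhase_right 1)).1
    obtain ⟨a, b, h1⟩ := h n
    obtain ⟨a', b', h2⟩ := h' n
    have h3 := (((h1.hasPhase_right 1).of_farEq (hxy 1 1 (by simp) (by simp)) (by simp)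
      (by simp)).unique (by simp) (by simp) (h2.hasPhase_right 1)).2
    have h4 := (((h1.hasPhase_left 1).of_farEq (hxy (-1) 1 (by simp) (by simp)) (by simp)
      (by simp)).unique (by simp) (by simp) (h2.hasPhase_left 1)).2
    exact h1.centers_iff (h2.congr h4 h3) p q
  have mixed : ∀ {x y : ℤ → ℤ → MarkedSquare}, IsRobinsonTiling y →
      (∀ σ τ : ℤ, (σ = 1 ∨ σ = -1) → (τ = 1 ∨ τ = -1) → FarEq x y σ τ) →
      (∃ c, ∀ n, ∃ a b, HasShape (centers x (n + 1)) (n + 1) c a b) →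
      (∃ c, ∀ n, ∃ a b, HasShape (centers (transposeTiling y) (n + 1)) (n + 1) c a b) →
      ∀ p q, centers x (n + 1) p q ↔ centers y (n + 1) p q := by
    rintro x y hy hxy ⟨c, h⟩ ⟨c', h'⟩ p q
    obtain ⟨a, b, h1⟩ := h n
    obtain ⟨a', b', h2⟩ := h' n
    -- A tiling split along a row has one row phase for left and right. Comparison gives `a ≡ b`, so
    -- `x` is unbroken at this level.
    have h3 := (((h1.hasPhase_right 1).of_farEq (hxy 1 1 (by simp) (by simp)) (by simp)
      (by simp)).transpose.unique (by simp) (by simp) (h2.hasPhase_right 1)).1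
    have h4 := (((h1.hasPhase_left 1).of_farEq (hxy (-1) 1 (by simp) (by simp)) (by simp)
      (by simp)).transpose.unique (by simp) (by simp) (h2.hasPhase_right (-1))).1
    have h5 := dvd_sub h3 h4
    rw [sub_sub_sub_cancel_right] at h5
    exact centers_iff_of_flat hy hxy (h1.congr h5 (by simp)) p q
  rcases exists_hasShape_centers hx with h | h | h
  · obtain ⟨c, a, h⟩ := h n
    exact centers_iff_of_flat hy hxy h p q
  · rcases exists_hasShape_centers hy with h' | h' | h'
    · obtain ⟨c, a, h'⟩ := h' n
      exact (centers_iff_of_flat hx hyx h' p q).symm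
    · exact two hxy h h' p q
    · exact mixed hy hxy h h' p q
  · rcases exists_hasShape_centers hy with h' | h' | h'
    · obtain ⟨c, a, h'⟩ := h' n
      exact (centers_iff_of_flat hx hyx h' p q).symm
    · exact (mixed hx hyx h' h p q).symm
    · rw [← centers_transpose, ← centers_transpose (x := y)]
      exact two (fun σ τ hσ hτ => (hxy τ σ hτ hσ).transpose) h h' q p

/-! ### The tiles inside supertiles -/

/-- Off the central row and column the tiles do not depend on the directions of the central cross,
so the positions of the gaps determine them. -/
theorem IsSupertile.apply_eq {p q e d v w : ℤ} (h : IsSupertile (n + 1) x p q e d)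
    (hv : |v - p| < 2 ^ (n + 1)) (hw : |w - q| < 2 ^ (n + 1)) (hv0 : v ≠ p) (hw0 : w ≠ q)
    (hs : (2 : ℤ) ^ (n + 1 + 1) ∣ p - s - 2 ^ (n + 1))
    (ht : (2 : ℤ) ^ (n + 1 + 1) ∣ q - t - 2 ^ (n + 1)) : x v w = stdTile (v - s) (w - t) := by
  have h1 := h.2.2 _ _ hv hw
  rw [add_sub_cancel, add_sub_cancel] at h1
  rw [h1]
  have aux : ∀ {e p v s : ℤ}, (e = 1 ∨ e = -1) → (2 : ℤ) ^ (n + 1 + 1) ∣ p - s - 2 ^ (n + 1) →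
      (2 : ℤ) ^ (n + 1 + 1) ∣ v - s - (2 ^ (n + 1) * e + (v - p)) := by
    intro e p v s he hs
    have h2 := two_pow_succ_dvd (n := n + 1) (e := 1) (f := -e) (Or.inl rfl)
      (by rcases he with rfl | rfl <;> simp)
    have h3 := dvd_add hs h2
    have h4 : p - s - 2 ^ (n + 1) + (2 ^ (n + 1) * 1 + 2 ^ (n + 1) * -e) =
        v - s - (2 ^ (n + 1) * e + (v - p)) := by ring
    rwa [h4] at h3
  exact (stdTile_congr (not_dvd_sign_mul_add' hv (sub_ne_zero.mpr hv0))
    (not_dvd_sign_mul_add' hw (sub_ne_zero.mpr hw0)) (aux h.1 hs) (aux h.2.1 ht)).symm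

/-- The centre next to a point that is not on a gap. -/
theorem exists_center_near {v s : ℤ} (hv : ¬ (2 : ℤ) ^ (n + 1) ∣ v - s) :
    ∃ p, (2 : ℤ) ^ (n + 1 + 1) ∣ p - s - 2 ^ (n + 1) ∧ |v - p| < 2 ^ (n + 1) ∧ v ≠ p ∧
      (v < s → p < s) ∧ (s < v → s < p) := by
  have hM : (2 : ℤ) ^ (n + 1 + 1) = 2 * 2 ^ (n + 1) := pow_succ' 2 (n + 1)
  have hpos : (0 : ℤ) < 2 ^ (n + 1) := by positivity
  set L : ℤ := 2 ^ (n + 1) with hL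
  rw [hM]
  have h1 := Int.emod_add_mul_ediv (v - s) (2 * L)
  set r := (v - s) % (2 * L) with hr
  set m := (v - s) / (2 * L) with hm
  have h2 : 0 ≤ r := Int.emod_nonneg _ (by positivity)
  have h3 : r < 2 * L := Int.emod_lt_of_pos _ (by positivity)
  have h4 : r ≠ 0 := fun h => hv ⟨2 * m, by rw [← h1, h]; ring⟩
  have h0 : 0 < r := lt_of_le_of_ne h2 (Ne.symm h4)
  have h5 : r ≠ L := fun h => hv ⟨2 * m + 1, by rw [← h1, h]; ring⟩
  refine ⟨v - r + L, ⟨m, by linarith⟩, by rw [abs_lt]; constructor <;> linarith,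
    fun h => h5 (by linarith), fun h => ?_, fun h => ?_⟩
  · have : m < 0 := by
      by_contra! hm0
      nlinarith
    nlinarith
  · have : 0 ≤ m := by
      by_contra! hm0
      nlinarith
    nlinarith

theorem HasShape.apply_left (h : HasShape (centers x (n + 1)) (n + 1) c a b) {v w : ℤ}
    (hv : v < c) (hv' : ¬ (2 : ℤ) ^ (n + 1) ∣ v - c) (hw : ¬ (2 : ℤ) ^ (n + 1) ∣ w - a) :
    x v w = stdTile (v - c) (w - a) := by
  obtain ⟨p, h1, h2, h3, h4, -⟩ := exists_center_near hv'
  obtain ⟨q, h5, h6, h7, -⟩ := exists_center_near hw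
  obtain ⟨e, d, h8⟩ := (h p q).mpr ⟨h1, fun _ => h5, fun hp => by have := h4 hv; omega⟩
  exact h8.apply_eq h2 h6 h3 h7 h1 h5

theorem HasShape.apply_right (h : HasShape (centers x (n + 1)) (n + 1) c a b) {v w : ℤ}
    (hv : c < v) (hv' : ¬ (2 : ℤ) ^ (n + 1) ∣ v - c) (hw : ¬ (2 : ℤ) ^ (n + 1) ∣ w - b) :
    x v w = stdTile (v - c) (w - b) := by
  obtain ⟨p, h1, h2, h3, -, h4⟩ := exists_center_near hv'
  obtain ⟨q, h5, h6, h7, -⟩ := exists_center_near hw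
  obtain ⟨e, d, h8⟩ := (h p q).mpr ⟨h1, fun hp => by have := h4 hv; omega, fun _ => h5⟩
  exact h8.apply_eq h2 h6 h3 h7 h1 h5

theorem HasPhase.apply_eq (hσ : σ = 1 ∨ σ = -1) (hτ : τ = 1 ∨ τ = -1)
    (h : HasPhase x σ τ (n + 1) s t) : ∃ B, ∀ v w, B < σ * v → B < τ * w →
      ¬ (2 : ℤ) ^ (n + 1) ∣ v - s → ¬ (2 : ℤ) ^ (n + 1) ∣ w - t →
      x v w = stdTile (v - s) (w - t) := by
  obtain ⟨B, h⟩ := h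
  refine ⟨B + 2 ^ (n + 1), fun v w hv hw hv' hw' => ?_⟩
  obtain ⟨p, h1, h2, h3, -⟩ := exists_center_near hv'
  obtain ⟨q, h5, h6, h7, -⟩ := exists_center_near hw'
  have h2' := abs_lt.mp h2
  have h6' := abs_lt.mp h6
  obtain ⟨e, d, h8⟩ := (h p q (by rcases hσ with rfl | rfl <;> linarith)
    (by rcases hτ with rfl | rfl <;> linarith)).mpr ⟨h1, h5⟩
  exact h8.apply_eq h2 h6 h3 h7 h1 h5

/-! ### Gaps of all levels -/

/-- The point `(v, w)` is on a gap of level `n` between the supertiles of the given shape. -/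
def OnGap (n : ℕ) (c a b v w : ℤ) : Prop :=
  (2 : ℤ) ^ (n + 1) ∣ v - c ∨ (v < c ∧ (2 : ℤ) ^ (n + 1) ∣ w - a) ∨
    (c < v ∧ (2 : ℤ) ^ (n + 1) ∣ w - b)

/-- The point `(v, w)` is not inside a supertile of any level. -/
def Uncovered (x : ℤ → ℤ → MarkedSquare) (v w : ℤ) : Prop :=
  ∀ n c a b, (HasShape (centers x (n + 1)) (n + 1) c a b → OnGap n c a b v w) ∧
    (HasShape (centers (transposeTiling x) (n + 1)) (n + 1) c a b → OnGap n c a b w v)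

theorem HasShape.eq_of_not_onGap (h : HasShape (centers x (n + 1)) (n + 1) c a b)
    (h' : HasShape (centers y (n + 1)) (n + 1) c a b) {v w : ℤ} (hg : ¬ OnGap n c a b v w) :
    x v w = y v w := by
  unfold OnGap at hg
  push Not at hg
  obtain ⟨h1, h2, h3⟩ := hg
  rcases lt_trichotomy v c with h4 | rfl | h4
  · rw [h.apply_left h4 h1 (h2 h4), h'.apply_left h4 h1 (h2 h4)]
  · simp at h1
  · rw [h.apply_right h4 h1 (h3 h4), h'.apply_right h4 h1 (h3 h4)]

/-- The two tilings have the same centres, and the centres determine every tile off the gaps and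
central arms of any given level. -/
theorem uncovered_of_ne (hx : IsRobinsonTiling x) (hy : IsRobinsonTiling y)
    (hxy : ∀ σ τ : ℤ, (σ = 1 ∨ σ = -1) → (τ = 1 ∨ τ = -1) → FarEq x y σ τ) {v w : ℤ}
    (h : x v w ≠ y v w) : Uncovered x v w := by
  have hc := centers_iff_of_farEq hx hy hxy
  intro n c a b
  constructor
  · intro h1
    by_contra h2
    exact h (h1.eq_of_not_onGap (fun p q => by rw [← hc, h1 p q]) h2)
  · intro h1
    by_contra h2
    have := h1.eq_of_not_onGap (y := transposeTiling y)
      (fun p q => by rw [centers_transpose, ← hc, ← centers_transpose, h1 p q]) h2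
    apply h
    rw [← MarkedSquare.transpose_transpose (x v w), ← MarkedSquare.transpose_transpose (y v w)]
    exact congrArg _ this

/-- On one side of a column, the gaps of all levels are at the row `t`. -/
def HasRowPhase (x : ℤ → ℤ → MarkedSquare) (t : ℤ) : Prop :=
  ∃ σ : ℤ, (σ = 1 ∨ σ = -1) ∧ ∀ τ : ℤ, (τ = 1 ∨ τ = -1) → ∀ n, ∃ s, HasPhase x σ τ (n + 1) s t

theorem exists_not_dvd {v c : ℤ} (h : v ≠ c) : ∃ N : ℕ, ∀ n ≥ N, ¬ (2 : ℤ) ^ (n + 1) ∣ v - c := by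
  by_contra! hcon
  apply h
  rw [← sub_eq_zero]
  refine eq_zero_of_forall_two_pow_dvd (n := 0) fun N _ => ?_
  obtain ⟨n, hn, hd⟩ := hcon N
  exact (pow_dvd_pow 2 (by omega)).trans hd

theorem hasRowPhase_of_dvd {x : ℤ → ℤ → MarkedSquare} {t : ℤ} (hx : IsRobinsonTiling x) {N : ℕ}
    {σ : ℤ} (hσ : σ = 1 ∨ σ = -1)
    (h : ∀ n ≥ N, ∃ c a b, HasShape (centers x (n + 1)) (n + 1) c a b ∧
      (σ = -1 → (2 : ℤ) ^ (n + 1) ∣ t - a) ∧ (σ = 1 → (2 : ℤ) ^ (n + 1) ∣ t - b)) :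
    HasRowPhase x t := by
  refine ⟨σ, hσ, fun τ hτ n => ?_⟩
  obtain ⟨c, a, b, h1, h2, h3⟩ := h (max (n + 1) N) (le_max_right _ _)
  have h4 := h1.of_le hx (m := n) (by have := le_max_left (n + 1) N; omega)
  have h5 : (2 : ℤ) ^ (n + 1 + 1) ∣ 2 ^ (max (n + 1) N + 1) :=
    pow_dvd_pow 2 (by have := le_max_left (n + 1) N; omega)
  refine ⟨c, ?_⟩
  rcases hσ with rfl | rfl
  · exact (h4.hasPhase_right τ).congr (by simp) (h5.trans (h3 rfl))
  · exact (h4.hasPhase_left τ).congr (by simp) (h5.trans (h2 rfl))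

/-- Beside the fault column, `v - c` is not divisible by high powers of two, so at high levels only
the row of the point can be a gap. On the fault column, the column itself has gaps of all levels. -/
theorem hasRowPhase_or_of_shape {x : ℤ → ℤ → MarkedSquare} (hx : IsRobinsonTiling x) {v w c : ℤ}
    (h : Uncovered x v w)
    (hc : ∀ n, ∃ a b, HasShape (centers x (n + 1)) (n + 1) c a b) :
    HasRowPhase x w ∨ HasRowPhase (transposeTiling x) v := by
  rcases lt_trichotomy v c with hv | rfl | hv
  · left
    obtain ⟨N, hN⟩ := exists_not_dvd hv.ne
    refine hasRowPhase_of_dvd hx (N := N) (σ := -1) (by simp) fun n hn => ?_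
    obtain ⟨a, b, hab⟩ := hc n
    refine ⟨c, a, b, hab, fun _ => ?_, by simp⟩
    rcases (h n c a b).1 hab with h1 | h1 | h1
    · exact absurd h1 (hN n hn)
    · exact h1.2
    · omega
  · right
    refine ⟨1, by simp, fun τ hτ n => ?_⟩
    obtain ⟨a, b, hab⟩ := hc n
    rcases hτ with rfl | rfl
    · exact ⟨_, (hab.hasPhase_right 1).transpose⟩
    · exact ⟨_, (hab.hasPhase_left 1).transpose⟩
  · left
    obtain ⟨N, hN⟩ := exists_not_dvd hv.ne'
    refine hasRowPhase_of_dvd hx (N := N) (σ := 1) (by simp) fun n hn => ?_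
    obtain ⟨a, b, hab⟩ := hc n
    refine ⟨c, a, b, hab, by simp, fun _ => ?_⟩
    rcases (h n c a b).1 hab with h1 | h1 | h1
    · exact absurd h1 (hN n hn)
    · omega
    · exact h1.2

/-- A point outside all supertiles is on a row or column of gaps of all levels. -/
theorem Uncovered.hasRowPhase_or {x : ℤ → ℤ → MarkedSquare} (hx : IsRobinsonTiling x) {v w : ℤ}
    (h : Uncovered x v w) : HasRowPhase x w ∨ HasRowPhase (transposeTiling x) v := by
  rcases exists_hasShape_centers hx with h1 | ⟨c, h1⟩ | ⟨c, h1⟩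
  · by_cases h2 : ∀ n, ∃ c a, HasShape (centers x (n + 1)) (n + 1) c a a ∧
        (2 : ℤ) ^ (n + 1) ∣ w - a
    · left
      refine hasRowPhase_of_dvd hx (N := 0) (σ := 1) (by simp) fun n _ => ?_
      obtain ⟨c, a, h3, h4⟩ := h2 n
      exact ⟨c, a, a, h3, fun _ => h4, fun _ => h4⟩
    -- A row that is not a gap line at level `N` is none at any higher level, which leaves the
    -- column.
    · right
      push Not at h2
      obtain ⟨N, h2⟩ := h2
      refine hasRowPhase_of_dvd hx.transpose (N := N) (σ := 1) (by simp) fun n hn => ?_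
      obtain ⟨c, a, h3⟩ := h1 n
      have h4 : (2 : ℤ) ^ (n + 1) ∣ v - c := by
        have h5 : ¬ (2 : ℤ) ^ (n + 1) ∣ w - a := fun h5 =>
          h2 c a (h3.of_le hx hn) ((pow_dvd_pow 2 (by omega)).trans h5)
        rcases (h n c a a).1 h3 with h6 | h6 | h6
        · exact h6
        · exact absurd h6.2 h5
        · exact absurd h6.2 h5
      exact ⟨a, c, c, h3.swap, fun _ => h4, fun _ => h4⟩
  · exact hasRowPhase_or_of_shape hx h h1
  · have h2 : Uncovered (transposeTiling x) w v := fun n c a b => (h n c a b).symm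
    exact (hasRowPhase_or_of_shape hx.transpose h2 h1).symm

end Phase

section Faults

open MarkedSquare SideMarks

variable {R : ℤ} {g h : (ℤ → ℤ → MarkedSquare) → ℤ → ℤ → MarkedSquare}

/-! ### Aperiodicity -/

theorem exists_two_pow_gt (m : ℤ) : ∃ N : ℕ, ∀ n ≥ N, m < 2 ^ n := by
  refine ⟨m.natAbs, fun n hn => ?_⟩
  have h1 : m.natAbs < 2 ^ n := lt_of_le_of_lt hn Nat.lt_two_pow_self
  have h2 : (m.natAbs : ℤ) < 2 ^ n := by exact_mod_cast h1
  omega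

theorem HasShape.exists_right {C : ℤ → ℤ → Prop} {n : ℕ} {c a b : ℤ} (h : HasShape C n c a b) :
    ∀ q, (2 : ℤ) ^ (n + 1) ∣ q - b - 2 ^ n → C (c + 2 ^ n) q := by
  intro q hq
  have : (0 : ℤ) < 2 ^ n := by positivity
  exact (h _ _).mpr ⟨by simp, fun h => by omega, fun _ => hq⟩

theorem IsRobinsonTiling.exists_centers {x : ℤ → ℤ → MarkedSquare} (hx : IsRobinsonTiling x)
    (n : ℕ) : ∃ p q, centers x (n + 1) p q := by
  have h0 : ∀ b : ℤ, (2 : ℤ) ^ (n + 1 + 1) ∣ b + 2 ^ (n + 1) - b - 2 ^ (n + 1) := by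
    intro b; ring_nf; simp
  rcases exists_hasShape_centers hx with h | ⟨c, h⟩ | ⟨c, h⟩
  · obtain ⟨c, a, h⟩ := h n
    exact ⟨_, _, h.exists_right _ (h0 a)⟩
  · obtain ⟨a, b, h⟩ := h n
    exact ⟨_, _, h.exists_right _ (h0 b)⟩
  · obtain ⟨a, b, h⟩ := h n
    exact ⟨_, _, centers_transpose.mp (h.exists_right _ (h0 b))⟩

/-- A cross needs row and column of equal level, and within the supertile the central column has
higher level than every row but the central one. -/
theorem IsSupertile.eq_zero_of_isCross {x : ℤ → ℤ → MarkedSquare} {n : ℕ} {p q e d j : ℤ}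
    (h : IsSupertile n x p q e d) (hj : |j| < 2 ^ n) (hc : (x p (q + j)).IsCross) : j = 0 := by
  by_contra h0
  have h1 := h.2.2 0 j (by simp) hj
  rw [add_zero, add_zero] at h1
  rw [h1] at hc
  have h2 := sign_mul_add_ne_zero h.2.1 hj
  obtain ⟨b, o, ho, hb⟩ := exists_eq_two_pow_mul h2
  rw [hb] at hc
  refine not_isCross_stdTile (a := n) ?_ (odd_of_sign h.1) ho hc
  by_contra! hn
  exact not_dvd_sign_mul_add' (e := d) hj h0 (hb ▸ Dvd.dvd.mul_right (pow_dvd_pow 2 hn) o)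

theorem IsSupertile.isCross {x : ℤ → ℤ → MarkedSquare} {n b : ℕ} {p q e d m o : ℤ}
    (h : IsSupertile n x p q e d) (hm : Odd m) (ho : Odd o) (hi : |2 ^ b * m| < 2 ^ n)
    (hj : |2 ^ b * o| < 2 ^ n) : (x (p + 2 ^ b * m) (q + 2 ^ b * o)).IsCross := by
  rw [h.2.2 _ _ hi hj]
  have hb : b < n := by
    by_contra! hb
    have h1 : (1 : ℤ) ≤ |m| := Int.one_le_abs (by rintro rfl; simp at hm)
    rw [abs_mul, abs_pow, abs_two] at hi
    have h2 : (2 : ℤ) ^ n ≤ 2 ^ b := pow_le_pow_right₀ (by norm_num) hb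
    nlinarith [show (0 : ℤ) < 2 ^ b by positivity]
  obtain ⟨c, rfl⟩ := Nat.exists_eq_add_of_lt hb
  have aux : ∀ {e m : ℤ}, Odd m → Odd (2 ^ (c + 1) * e + m) := fun {e m} hm => by
    rw [pow_succ]
    exact Even.add_odd ⟨2 ^ c * e, by ring⟩ hm
  have h3 := stdTile_isCross b (aux (e := e) hm) (aux (e := d) ho)
  rw [show (2 : ℤ) ^ b * (2 ^ (c + 1) * e + m) = 2 ^ (b + c + 1) * e + 2 ^ b * m by
    rw [pow_succ, pow_succ, pow_add]; ring, show (2 : ℤ) ^ b * (2 ^ (c + 1) * d + o) =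
    2 ^ (b + c + 1) * d + 2 ^ b * o by rw [pow_succ, pow_succ, pow_add]; ring] at h3
  exact h3

/-- Write `s = 2 ^ b * m` with `m` odd. In a large supertile around `(p, q)` there are crosses at
`(p + s, q ± 2 ^ b)`. Moved back by the period they lie in the central column, where the centre is
the only cross; so `t` is both `2 ^ b` and `-2 ^ b`. -/
theorem IsRobinsonTiling.period_left {x : ℤ → ℤ → MarkedSquare} (hx : IsRobinsonTiling x)
    {s t : ℤ} (h : ∀ i j, x (i + s) (j + t) = x i j) : s = 0 := by
  by_contra hs
  obtain ⟨b, m, hm, rfl⟩ := exists_eq_two_pow_mul hs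
  obtain ⟨n, hn⟩ := exists_two_pow_gt (|2 ^ b * m| + |t|)
  obtain ⟨p, q, e, d, hsup⟩ := hx.exists_centers n
  have hn' := hn (n + 1) (by omega)
  have hb : |(2 : ℤ) ^ b| ≤ |2 ^ b * m| := by
    rw [abs_mul]
    exact le_mul_of_one_le_right (abs_nonneg _) (Int.one_le_abs (by rintro rfl; simp at hm))
  have key : ∀ o : ℤ, Odd o → |2 ^ b * o| = |(2 : ℤ) ^ b| → 2 ^ b * o = t := by
    intro o ho hob
    have h1 := hsup.isCross hm ho (by linarith [abs_nonneg t])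
      (by rw [hob]; linarith [abs_nonneg t])
    have h2 := h p (q + 2 ^ b * o - t)
    rw [sub_add_cancel] at h2
    rw [h2, add_sub_assoc] at h1
    have h3 := hsup.eq_zero_of_isCross (lt_of_le_of_lt (abs_sub _ _) (by rw [hob]; linarith)) h1
    linarith
  have h1 := key 1 (by decide) (by simp)
  have h2 := key (-1) (by decide) (by simp)
  have : (0 : ℤ) < 2 ^ b := by positivity
  linarith

theorem IsRobinsonTiling.period_eq_zero {x : ℤ → ℤ → MarkedSquare} (hx : IsRobinsonTiling x)
    {s t : ℤ} (h : ∀ i j, x (i + s) (j + t) = x i j) : s = 0 ∧ t = 0 :=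
  ⟨hx.period_left h, hx.transpose.period_left fun i j => congrArg _ (h j i)⟩

/-! ### Tilings with a fault -/

/-- A tile of a vertical line without horizontal marks. -/
def colTile (s : SideMarks) : MarkedSquare := ⟨bareTail, s, bareTail, s.opp⟩

/-- A tile of a horizontal line without vertical marks. -/
def rowTile (s : SideMarks) : MarkedSquare := ⟨s, bareTail, s.opp, bareTail⟩

theorem MarkedSquare.IsRobinson.rowTile {t : MarkedSquare} (h : t.IsRobinson) :
    (rowTile t.east).IsRobinson ∧ (_root_.rowTile t.west.opp).IsRobinson :=
  forall_isRobinson (p := fun t => (_root_.rowTile t.east).IsRobinson ∧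
    (_root_.rowTile t.west.opp).IsRobinson) (by decide) h

theorem MarkedSquare.IsRobinson.colTile {t : MarkedSquare} (h : t.IsRobinson) :
    (colTile t.north).IsRobinson ∧ (_root_.colTile t.south.opp).IsRobinson :=
  ⟨h.transpose.rowTile.1.transpose, h.transpose.rowTile.2.transpose⟩

theorem MarkedSquare.IsRobinson.eq_rowTile {t : MarkedSquare} (h : t.IsRobinson)
    (hn : t.north = bareTail) (hs : t.south = bareTail) : t = _root_.rowTile t.east := by
  have := (h.of_tails' (by rw [hn]; rfl) (by rw [hs]; rfl)).2
  exact ext_sides rfl hn (by rw [this]; simp [_root_.rowTile]) hs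

theorem MarkedSquare.IsRobinson.eq_colTile {t : MarkedSquare} (h : t.IsRobinson)
    (he : t.east = bareTail) (hw : t.west = bareTail) : t = _root_.colTile t.north := by
  have := h.transpose.eq_rowTile he hw
  rw [← transpose_transpose t, this]
  rfl

/-- Standard patterns to the left and to the right of a column `c`, with rows `a` and `b` that
start at this column. -/
def faultTiling (c a b : ℤ) (K : ℤ → MarkedSquare) (i j : ℤ) : MarkedSquare :=
  if i < c then (if j = a then rowTile (K a).west.opp else stdTile (i - c) (j - a))
  else if c < i then (if j = b then rowTile (K b).east else stdTile (i - c) (j - b))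
  else K j

/-- The columns that can separate two standard patterns. -/
structure IsFaultColumn (a b : ℤ) (K : ℤ → MarkedSquare) : Prop where
  tile : ∀ j, (K j).IsRobinson
  ver : ∀ j, (K (j + 1)).south = (K j).north.opp
  west : ∀ j, j ≠ a → (K j).west = bareTail
  east : ∀ j, j ≠ b → (K j).east = bareTail
  even : 2 ∣ a - b

theorem faultTiling_of_lt {c a b : ℤ} {K : ℤ → MarkedSquare} {i j : ℤ} (hi : i < c) :
    faultTiling c a b K i j =
      if j = a then rowTile (K a).west.opp else stdTile (i - c) (j - a) := by
  simp [faultTiling, hi]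

theorem faultTiling_of_gt {c a b : ℤ} {K : ℤ → MarkedSquare} {i j : ℤ} (hi : c < i) :
    faultTiling c a b K i j =
      if j = b then rowTile (K b).east else stdTile (i - c) (j - b) := by
  simp [faultTiling, hi, hi.le]

theorem faultTiling_self {c a b : ℤ} {K : ℤ → MarkedSquare} {j : ℤ} :
    faultTiling c a b K c j = K j := by
  simp [faultTiling]

theorem stdTile_south_one {i : ℤ} (hi : i ≠ 0) : (stdTile i 1).south = bareHead := by
  simp [stdTile, lineMark_zero_left hi]

theorem stdTile_north_neg_one {i : ℤ} (hi : i ≠ 0) : (stdTile i (-1)).north = bareHead := by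
  simp [stdTile, lineMark_neg_one_left hi]

theorem stdTile_west_one {j : ℤ} (hj : j ≠ 0) : (stdTile 1 j).west = bareHead := by
  simp [stdTile, lineMark_zero_left hj]

theorem stdTile_east_neg_one {j : ℤ} (hj : j ≠ 0) : (stdTile (-1) j).east = bareHead := by
  simp [stdTile, lineMark_neg_one_left hj]

theorem stdTile_hor (i j : ℤ) : (stdTile (i + 1) j).west = (stdTile i j).east.opp := by
  simp [stdTile]

theorem stdTile_ver (i j : ℤ) : (stdTile i (j + 1)).south = (stdTile i j).north.opp := by
  simp [stdTile]

/-- The vertical arrow rule in a standard pattern whose axis row is replaced by a row of tiles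
without vertical marks. -/
theorem ver_of_row {i j a : ℤ} (hi : i ≠ 0) (s : SideMarks) :
    (if j + 1 = a then rowTile s else stdTile i (j + 1 - a)).south =
      (if j = a then rowTile s else stdTile i (j - a)).north.opp := by
  by_cases h1 : j = a
  · subst h1
    rw [if_neg (by omega), if_pos rfl, add_sub_cancel_left, stdTile_south_one hi]
    rfl
  · rw [if_neg h1]
    by_cases h2 : j + 1 = a
    · rw [if_pos h2, show j - a = -1 by omega, stdTile_north_neg_one hi]
      rfl
    · rw [if_neg h2, ← stdTile_ver, add_sub_right_comm]

theorem IsFaultColumn.isRobinsonTiling {a b : ℤ} {K : ℤ → MarkedSquare}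
    (hK : IsFaultColumn a b K) (c : ℤ) : IsRobinsonTiling (faultTiling c a b K) where
  tile i j := by
    rcases lt_trichotomy i c with hi | rfl | hi
    · rw [faultTiling_of_lt hi]
      split_ifs
      · exact (hK.tile a).rowTile.2
      · exact stdTile_isRobinson (by omega) (by omega)
    · rw [faultTiling_self]
      exact hK.tile j
    · rw [faultTiling_of_gt hi]
      split_ifs
      · exact (hK.tile b).rowTile.1
      · exact stdTile_isRobinson (by omega) (by omega)
  hor i j := by
    rcases lt_trichotomy i c with hi | rfl | hi
    · rcases lt_or_eq_of_le (Int.add_one_le_iff.mpr hi) with h | h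
      · rw [faultTiling_of_lt hi, faultTiling_of_lt h]
        split_ifs
        · rfl
        · rw [← stdTile_hor, add_sub_right_comm]
      · rw [faultTiling_of_lt hi, h, faultTiling_self, show i - c = -1 by omega]
        split_ifs with hj
        · subst hj
          simp [rowTile]
        · rw [hK.west j hj, stdTile_east_neg_one (by omega)]
          rfl
    · rw [faultTiling_self, faultTiling_of_gt (by omega), add_sub_cancel_left]
      split_ifs with hj
      · subst hj
        simp [rowTile]
      · rw [hK.east j hj, stdTile_west_one (by omega)]
        rfl
    · rw [faultTiling_of_gt hi, faultTiling_of_gt (by omega)]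
      split_ifs
      · rfl
      · rw [← stdTile_hor, add_sub_right_comm]
  ver i j := by
    rcases lt_trichotomy i c with hi | rfl | hi
    · rw [faultTiling_of_lt hi, faultTiling_of_lt hi]
      exact ver_of_row (by omega) _
    · rw [faultTiling_self, faultTiling_self]
      exact hK.ver j
    · rw [faultTiling_of_gt hi, faultTiling_of_gt hi]
      exact ver_of_row (by omega) _
  cross := by
    -- Points at odd distances from the lines are crosses; the parity of `a - b` puts those of the
    -- two sides into one coset.
    refine ⟨c + 1, a + 1, fun i j => ?_⟩
    have h := hK.even
    have key : ∀ i j : ℤ, Odd i → Odd j → (stdTile i j).IsCross := fun i j hi hj => by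
      simpa using stdTile_isCross 0 hi hj
    rcases lt_trichotomy (c + 1 + 2 * i) c with hi | hi | hi
    · rw [faultTiling_of_lt hi, if_neg (by omega)]
      exact key _ _ ⟨i, by ring⟩ ⟨j, by ring⟩
    · omega
    · rw [faultTiling_of_gt hi, if_neg (by omega)]
      obtain ⟨m, hm⟩ := h
      exact key _ _ ⟨i, by ring⟩ ⟨j + m, by linarith⟩

/-- A Robinson tiling that follows standard patterns to the left and to the right of a column `c`,
except on the column itself and on the rows `a` to the left and `b` to the right of it. -/
structure IsFault (c a b : ℤ) (x : ℤ → ℤ → MarkedSquare) : Prop where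
  rob : IsRobinsonTiling x
  left : ∀ i j, i < c → j ≠ a → x i j = stdTile (i - c) (j - a)
  right : ∀ i j, c < i → j ≠ b → x i j = stdTile (i - c) (j - b)

theorem IsFaultColumn.isFault {a b : ℤ} {K : ℤ → MarkedSquare}
    (hK : IsFaultColumn a b K) (c : ℤ) : IsFault c a b (faultTiling c a b K) where
  rob := hK.isRobinsonTiling c
  left i j hi hj := by rw [faultTiling_of_lt hi, if_neg hj]
  right i j hi hj := by rw [faultTiling_of_gt hi, if_neg hj]

/-- A row without vertical marks is constant. -/
theorem IsRobinsonTiling.row_const {x : ℤ → ℤ → MarkedSquare} (hx : IsRobinsonTiling x)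
    {u v j : ℤ} (huv : u ≤ v)
    (h : ∀ i, u ≤ i → i ≤ v → (x i j).north = bareTail ∧ (x i j).south = bareTail) :
    x u j = rowTile (x v j).east := by
  induction v, huv using Int.leInduction with
  | base => exact (hx.tile u j).eq_rowTile (h u le_rfl le_rfl).1 (h u le_rfl le_rfl).2
  | succ v huv ih =>
    rw [ih fun i h1 h2 => h i h1 (by omega)]
    obtain ⟨h1, h2⟩ := h (v + 1) (by omega) le_rfl
    have h3 := (hx.tile (v + 1) j).eq_rowTile h1 h2
    have h4 := hx.east_eq v j
    rw [h3] at h4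
    rw [h4]
    simp [rowTile]

theorem IsRobinsonTiling.north_south_eq_bareTail {x : ℤ → ℤ → MarkedSquare}
    (hx : IsRobinsonTiling x) {i j m : ℤ} (hm : m ≠ 0) (h1 : x i (j + 1) = stdTile m 1)
    (h2 : x i (j - 1) = stdTile m (-1)) :
    (x i j).north = bareTail ∧ (x i j).south = bareTail := by
  constructor
  · rw [hx.north_eq, h1, stdTile_south_one hm]
    rfl
  · rw [hx.south_eq, h2, stdTile_north_neg_one hm]
    rfl

namespace IsFault

variable {c a b : ℤ} {x y : ℤ → ℤ → MarkedSquare}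

theorem left_row (h : IsFault c a b x) {i : ℤ} (hi : i < c) :
    x i a = rowTile (x c a).west.opp := by
  have h1 := h.rob.row_const (u := i) (v := c - 1) (j := a) (by omega) fun m _ hm =>
    h.rob.north_south_eq_bareTail (m := m - c) (by omega)
      (by rw [h.left m _ (by omega) (by omega), add_sub_cancel_left])
      (by rw [h.left m _ (by omega) (by omega), sub_sub_cancel_left])
  rw [h1, h.rob.east_eq, sub_add_cancel]

theorem right_row (h : IsFault c a b x) {i : ℤ} (hi : c < i) :
    x i b = rowTile (x c b).east := by
  have h0 : ∀ m, c < m → (x m b).north = bareTail ∧ (x m b).south = bareTail := fun m hm =>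
    h.rob.north_south_eq_bareTail (m := m - c) (by omega)
      (by rw [h.right m _ (by omega) (by omega), add_sub_cancel_left])
      (by rw [h.right m _ (by omega) (by omega), sub_sub_cancel_left])
  have h1 := h.rob.row_const (u := c + 1) (v := i) (j := b) (by omega) fun m hm _ =>
    h0 m (by omega)
  have h2 := h.rob.hor c b
  rw [h1] at h2
  have h3 := (h.rob.tile i b).eq_rowTile (h0 i hi).1 (h0 i hi).2
  have h4 : (x i b).east.opp = (x c b).east.opp := h2
  rw [h3, opp_inj.mp h4]

theorem west (h : IsFault c a b x) {j : ℤ} (hj : j ≠ a) : (x c j).west = bareTail := by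
  rw [h.rob.west_eq, h.left _ j (by omega) hj, sub_sub_cancel_left,
    stdTile_east_neg_one (by omega)]
  rfl

theorem east (h : IsFault c a b x) {j : ℤ} (hj : j ≠ b) : (x c j).east = bareTail := by
  rw [h.rob.east_eq, h.right _ j (by omega) hj, add_sub_cancel_left, stdTile_west_one (by omega)]
  rfl

theorem eq_faultTiling (h : IsFault c a b x) : x = faultTiling c a b (x c) := by
  funext i j
  rcases lt_trichotomy i c with hi | rfl | hi
  · rw [faultTiling_of_lt hi]
    split_ifs with hj
    · rw [hj, h.left_row hi]
    · exact h.left i j hi hj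
  · rw [faultTiling_self]
  · rw [faultTiling_of_gt hi]
    split_ifs with hj
    · rw [hj, h.right_row hi]
    · exact h.right i j hi hj

/-- The tiles of the column between two rows that start at it. -/
theorem eq_colTile (h : IsFault c a b x) {j : ℤ} (ha : j ≠ a) (hb : j ≠ b) :
    x c j = colTile (x c j).north :=
  (h.rob.tile c j).eq_colTile (h.east hb) (h.west ha)

/-- Two tilings with the same fault and the same horizontal marks along it agree if they agree at
one tile of the column. -/
theorem eq_of_column (hx : IsFault c a b x) (hy : IsFault c a b y)
    (he : (x c b).east = (y c b).east) (hw : (x c a).west = (y c a).west) {r : ℤ}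
    (hr : x c r = y c r) : x = y := by
  have he' : ∀ j, (x c j).east = (y c j).east := fun j => by
    by_cases hj : j = b
    · rw [hj, he]
    · rw [hx.east hj, hy.east hj]
  have hw' : ∀ j, (x c j).west = (y c j).west := fun j => by
    by_cases hj : j = a
    · rw [hj, hw]
    · rw [hx.west hj, hy.west hj]
  have key : ∀ j, x c j = y c j := by
    intro j
    induction j using Int.inductionOn' (b := r) with
    | zero => exact hr
    | succ j _ ih =>
      exact (hx.rob.tile c _).ext_of_south (hy.rob.tile c _)
        (by rw [hx.rob.ver, hy.rob.ver, ih]) (he' _) (hw' _)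
    | pred j _ ih =>
      exact (hx.rob.tile c _).ext_of_north (hy.rob.tile c _)
        (by rw [hx.rob.north_eq, hy.rob.north_eq, sub_add_cancel, ih]) (he' _) (hw' _)
  rw [hx.eq_faultTiling, hy.eq_faultTiling, funext key]

end IsFault

/-- The column that goes straight except for one tile. -/
def colThrough (t : MarkedSquare) (r j : ℤ) : MarkedSquare :=
  if r < j then colTile t.north else if j < r then colTile t.south.opp else t

theorem colThrough_of_gt {t : MarkedSquare} {r j : ℤ} (h : r < j) :
    colThrough t r j = colTile t.north := by
  simp [colThrough, h]

theorem colThrough_of_lt {t : MarkedSquare} {r j : ℤ} (h : j < r) :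
    colThrough t r j = colTile t.south.opp := by
  simp [colThrough, h, h.le]

@[simp] theorem colThrough_self {t : MarkedSquare} {r : ℤ} : colThrough t r r = t := by
  simp [colThrough]

theorem isFaultColumn_colThrough {t : MarkedSquare} (ht : t.IsRobinson) {a b r : ℤ}
    (hab : 2 ∣ a - b) (hw : r = a ∨ t.west = bareTail) (he : r = b ∨ t.east = bareTail) :
    IsFaultColumn a b (colThrough t r) where
  tile j := by
    unfold colThrough
    split_ifs
    · exact ht.colTile.1
    · exact ht.colTile.2
    · exact ht
  ver j := by
    rcases lt_trichotomy j r with h | rfl | h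
    · rw [colThrough_of_lt h]
      rcases lt_or_eq_of_le (Int.add_one_le_iff.mpr h) with h1 | h1
      · rw [colThrough_of_lt h1]; rfl
      · rw [h1, colThrough_self]; simp [colTile]
    · rw [colThrough_self, colThrough_of_gt (by omega)]; rfl
    · rw [colThrough_of_gt h, colThrough_of_gt (by omega)]; rfl
  west j hj := by
    unfold colThrough
    split_ifs with h1 h2
    · rfl
    · rfl
    · exact hw.resolve_left (by omega)
  east j hj := by
    unfold colThrough
    split_ifs with h1 h2
    · rfl
    · rfl
    · exact he.resolve_left (by omega)
  even := hab

/-! ### Fractures in coordinates -/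

/-- The tiling moved by `(s, t)`. -/
def shiftTiling (s t : ℤ) (x : ℤ → ℤ → MarkedSquare) : ℤ → ℤ → MarkedSquare :=
  fun i j => x (i - s) (j - t)

theorem IsRobinsonTiling.shift {x : ℤ → ℤ → MarkedSquare} (hx : IsRobinsonTiling x) (s t : ℤ) :
    IsRobinsonTiling (shiftTiling s t x) where
  tile i j := hx.tile _ _
  hor i j := by
    have := hx.hor (i - s) (j - t)
    rwa [sub_add_eq_add_sub] at this
  ver i j := by
    have := hx.ver (i - s) (j - t)
    rwa [sub_add_eq_add_sub] at this
  cross := by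
    obtain ⟨k, l, h⟩ := hx.cross
    refine ⟨k + s, l + t, fun i j => ?_⟩
    have := h i j
    rwa [show k + 2 * i = k + s + 2 * i - s by ring,
      show l + 2 * j = l + t + 2 * j - t by ring] at this

theorem centers_shift {x : ℤ → ℤ → MarkedSquare} {n : ℕ} {s t p q : ℤ} :
    centers (shiftTiling s t x) n p q ↔ centers x n (p - s) (q - t) := by
  simp only [centers, IsSupertile, shiftTiling, add_sub_right_comm]

theorem HasShape.shift {x : ℤ → ℤ → MarkedSquare} {n : ℕ} {c a b : ℤ}
    (h : HasShape (centers x n) n c a b) (s t : ℤ) :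
    HasShape (centers (shiftTiling s t x) n) n (c + s) (a + t) (b + t) := by
  intro p q
  rw [centers_shift, h, sub_lt_iff_lt_add, lt_sub_iff_add_lt]
  ring_nf

/-- Every column meets the set in large squares with centres in all residue classes. -/
def IsTall (S : ℤ → ℤ → Prop) : Prop :=
  ∀ (p r R M : ℤ), 0 < M → ∃ q, M ∣ q - r ∧ ∀ i j, |i| ≤ R → |j| ≤ R → S (p + i) (q + j)

theorem HasShape.exists_common {x y : ℤ → ℤ → MarkedSquare} {S : ℤ → ℤ → Prop} {n : ℕ} {c a b : ℤ}
    (hS : IsTall S) (hxy : ∀ i j, S i j → y i j = x i j) (h : HasShape (centers x n) n c a b) :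
    ∃ q, (2 : ℤ) ^ (n + 1) ∣ q - b - 2 ^ n ∧ centers y n (c + 2 ^ n) q := by
  obtain ⟨q, h1, h2⟩ := hS (c + 2 ^ n) (b + 2 ^ n) (2 ^ n) (2 ^ (n + 1)) (by positivity)
  rw [← sub_sub] at h1
  obtain ⟨e, d, h3⟩ := h.exists_right q h1
  exact ⟨q, h1, e, d, h3.of_eqOn fun i j hi hj => (hxy _ _ (h2 i j hi.le hj.le)).symm⟩

/-- The common part of the tilings contains a whole supertile of `x` next to `c`; its centre belongs
to both lattices. -/
theorem HasShape.dvd_of_column {x y : ℤ → ℤ → MarkedSquare} {S : ℤ → ℤ → Prop} {n : ℕ}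
    {c a b c' a' b' : ℤ} (hS : IsTall S) (hxy : ∀ i j, S i j → y i j = x i j)
    (h : HasShape (centers x n) n c a b) (h' : HasShape (centers y n) n c' a' b') :
    (2 : ℤ) ^ (n + 1) ∣ c - c' := by
  obtain ⟨q, -, h2⟩ := h.exists_common hS hxy
  have h3 := ((h' _ _).mp h2).1
  rwa [show c + 2 ^ n - c' - 2 ^ n = c - c' by ring] at h3

theorem HasShape.dvd_of_row {x y : ℤ → ℤ → MarkedSquare} {S : ℤ → ℤ → Prop} {n : ℕ}
    {c a b c' a' b' : ℤ} (hS : IsTall S) (hxy : ∀ i j, S i j → y i j = x i j)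
    (h : HasShape (centers x n) n c a b)
    (h' : HasShape (centers (transposeTiling y) n) n c' a' b') : (2 : ℤ) ^ (n + 1) ∣ b - c' := by
  obtain ⟨q, h1, h2⟩ := h.exists_common hS hxy
  have h3 := ((h' _ _).mp (centers_transpose.mpr h2)).1
  have h4 := dvd_sub h3 h1
  rwa [show q - c' - 2 ^ n - (q - b - 2 ^ n) = b - c' by ring] at h4

theorem IsRobinsonTiling.exists_hasShape_or {x : ℤ → ℤ → MarkedSquare} (hx : IsRobinsonTiling x)
    (n : ℕ) : ∃ c a b, HasShape (centers x (n + 1)) (n + 1) c a b ∨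
      HasShape (centers (transposeTiling x) (n + 1)) (n + 1) c a b := by
  rcases exists_hasShape_centers hx with h | ⟨c, h⟩ | ⟨c, h⟩
  · obtain ⟨c, a, h⟩ := h n
    exact ⟨c, a, a, Or.inl h⟩
  · obtain ⟨a, b, h⟩ := h n
    exact ⟨c, a, b, Or.inl h⟩
  · obtain ⟨a, b, h⟩ := h n
    exact ⟨c, a, b, Or.inr h⟩

/-- `y` has one column phase for the whole plane or one row phase for the whole plane. Its two parts
inherit the phases of `x` and of the shifted `x`, so the difference, `s` or `t`, vanishes modulo the
spacing of the level. -/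
theorem HasShape.dvd_or_dvd {x y : ℤ → ℤ → MarkedSquare} {S S' : ℤ → ℤ → Prop} {n : ℕ}
    {s t c a b : ℤ} (hS : IsTall S) (hS' : IsTall S') (h1 : ∀ i j, S i j → y i j = x i j)
    (h2 : ∀ i j, S' i j → y i j = shiftTiling s t x i j)
    (h : HasShape (centers x (n + 1)) (n + 1) c a b) (hy : IsRobinsonTiling y) :
    (2 : ℤ) ^ (n + 1 + 1) ∣ s ∨ (2 : ℤ) ^ (n + 1 + 1) ∣ t := by
  obtain ⟨c', a', b', h' | h'⟩ := hy.exists_hasShape_or n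
  · have h3 := dvd_sub ((h.shift s t).dvd_of_column hS' h2 h') (h.dvd_of_column hS h1 h')
    rw [show c + s - c' - (c - c') = s by ring] at h3
    exact Or.inl h3
  · have h3 := dvd_sub ((h.shift s t).dvd_of_row hS' h2 h') (h.dvd_of_row hS h1 h')
    rw [show b + t - c' - (b - c') = t by ring] at h3
    exact Or.inr h3

/-- A tiling cannot be broken into two parts that are shifted against each other in a direction
other than those of the axes. -/
theorem IsRobinsonTiling.eq_zero_or_eq_zero {x y : ℤ → ℤ → MarkedSquare} {S S' : ℤ → ℤ → Prop}
    (hx : IsRobinsonTiling x) (hy : IsRobinsonTiling y) {s t : ℤ}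
    (hS : IsTall S) (hS' : IsTall S') (hT : IsTall fun i j => S j i)
    (hT' : IsTall fun i j => S' j i) (h1 : ∀ i j, S i j → y i j = x i j)
    (h2 : ∀ i j, S' i j → y i j = shiftTiling s t x i j) : s = 0 ∨ t = 0 := by
  by_contra! hst
  obtain ⟨N, hN⟩ := exists_two_pow_gt (|s| + |t|)
  have hs : ¬ (2 : ℤ) ^ (N + 1 + 1) ∣ s :=
    not_dvd_of_abs_lt (by linarith [hN (N + 1 + 1) (by omega), abs_nonneg t]) hst.1
  have ht : ¬ (2 : ℤ) ^ (N + 1 + 1) ∣ t :=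
    not_dvd_of_abs_lt (by linarith [hN (N + 1 + 1) (by omega), abs_nonneg s]) hst.2
  obtain ⟨c, a, b, h | h⟩ := hx.exists_hasShape_or N
  · exact (h.dvd_or_dvd hS hS' h1 h2 hy).elim hs ht
  · exact (h.dvd_or_dvd (x := transposeTiling x) (y := transposeTiling y) (s := t) (t := s) hT hT'
      (fun i j hij => congrArg MarkedSquare.transpose (h1 j i hij))
      (fun i j hij => congrArg MarkedSquare.transpose (h2 j i hij))
      hy.transpose).elim ht hs

/-- The tile without red arrows and with a black arrow from north to south. -/
def plainTile : MarkedSquare := basic 0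

theorem isRobinson_basic (b : Fin 5) : (basic b).IsRobinson := ⟨b, 0, 0, rfl⟩

theorem isFaultColumn_plainTile {a b : ℤ} (h : 2 ∣ a - b) :
    IsFaultColumn a b fun _ => plainTile where
  tile _ := isRobinson_basic 0
  ver _ := rfl
  west _ _ := rfl
  east _ _ := rfl
  even := h

theorem shiftTiling_faultTiling {c a b s i j : ℤ} (hi : i < c) :
    faultTiling c (a + s) b (fun _ => plainTile) i j =
      shiftTiling 0 s (faultTiling c a b fun _ => plainTile) i j := by
  rw [shiftTiling, sub_zero, faultTiling_of_lt hi, faultTiling_of_lt hi, sub_sub, add_comm s a]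
  simp only [sub_eq_iff_eq_add]

/-! ### Local maps between Robinson tilings -/

/-- A map of Robinson tilings that is given by a local rule with windows of radius `R`. -/
structure IsLocalMap (R : ℤ) (g : (ℤ → ℤ → MarkedSquare) → ℤ → ℤ → MarkedSquare) : Prop where
  rob : ∀ {x}, IsRobinsonTiling x → IsRobinsonTiling (g x)
  loc : ∀ {x y}, IsRobinsonTiling x → IsRobinsonTiling y → ∀ v w v' w',
    (∀ i j, |i| ≤ R → |j| ≤ R → x (v + i) (w + j) = y (v' + i) (w' + j)) → g x v w = g y v' w'

/-- A local map with a local inverse. -/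
structure IsLocalPair (R : ℤ) (g h : (ℤ → ℤ → MarkedSquare) → ℤ → ℤ → MarkedSquare) : Prop where
  nonneg : 0 ≤ R
  left : IsLocalMap R g
  right : IsLocalMap R h
  left_inv : ∀ {x}, IsRobinsonTiling x → h (g x) = x
  right_inv : ∀ {x}, IsRobinsonTiling x → g (h x) = x

/-- The conjugate of a map with the transposition. -/
def transposeMap (g : (ℤ → ℤ → MarkedSquare) → ℤ → ℤ → MarkedSquare) :
    (ℤ → ℤ → MarkedSquare) → ℤ → ℤ → MarkedSquare :=
  fun x => transposeTiling (g (transposeTiling x))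

theorem IsLocalMap.transpose (hg : IsLocalMap R g) : IsLocalMap R (transposeMap g) where
  rob hx := (hg.rob hx.transpose).transpose
  loc hx hy v w v' w' H := congrArg MarkedSquare.transpose
    (hg.loc hx.transpose hy.transpose w v w' v' fun i j hi hj =>
      congrArg MarkedSquare.transpose (H j i hj hi))

theorem IsLocalPair.symm (hg : IsLocalPair R g h) : IsLocalPair R h g :=
  ⟨hg.nonneg, hg.right, hg.left, hg.right_inv, hg.left_inv⟩

theorem IsLocalPair.transpose (hg : IsLocalPair R g h) :
    IsLocalPair R (transposeMap g) (transposeMap h) where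
  nonneg := hg.nonneg
  left := hg.left.transpose
  right := hg.right.transpose
  left_inv hx := congrArg transposeTiling (hg.left_inv hx.transpose)
  right_inv hx := congrArg transposeTiling (hg.right_inv hx.transpose)

theorem shiftTiling_neg_shiftTiling (s t : ℤ) (x : ℤ → ℤ → MarkedSquare) :
    shiftTiling (-s) (-t) (shiftTiling s t x) = x := by
  funext i j
  simp [shiftTiling]

theorem shiftTiling_shiftTiling_neg (s t : ℤ) (x : ℤ → ℤ → MarkedSquare) :
    shiftTiling s t (shiftTiling (-s) (-t) x) = x := by
  funext i j
  simp [shiftTiling]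

theorem IsLocalPair.shift (hg : IsLocalPair R g h) (s t : ℤ) :
    IsLocalPair (R + |s| + |t|) (fun x => shiftTiling s t (g x))
      (fun x => h (shiftTiling (-s) (-t) x)) where
  nonneg := by have := hg.nonneg; positivity
  left :=
    { rob := fun hx => (hg.left.rob hx).shift s t
      loc := fun hx hy v w v' w' H => hg.left.loc hx hy _ _ _ _ fun i j hi hj => by
        have := H (i - s) (j - t) ((abs_sub _ _).trans (by linarith [abs_nonneg t]))
          ((abs_sub _ _).trans (by linarith [abs_nonneg s]))
        rwa [add_sub_left_comm, add_sub_left_comm w, add_comm i, add_comm j, add_sub_left_comm v',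
          add_sub_left_comm w', add_comm i, add_comm j] at this }
  right :=
    { rob := fun hx => hg.right.rob (hx.shift _ _)
      loc := fun hx hy v w v' w' H => hg.right.loc (hx.shift _ _) (hy.shift _ _) _ _ _ _
        fun i j hi hj => by
          have := H (i + s) (j + t) ((abs_add_le _ _).trans (by linarith [abs_nonneg t]))
            ((abs_add_le _ _).trans (by linarith [abs_nonneg s]))
          simpa only [shiftTiling, sub_neg_eq_add, add_assoc] using this }
  left_inv hx := by
    rw [shiftTiling_neg_shiftTiling, hg.left_inv hx]
  right_inv hx := by
    rw [hg.right_inv (hx.shift _ _), shiftTiling_shiftTiling_neg]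

/-! ### Normalization of a local map -/

theorem HasRowPhase.parity {x : ℤ → ℤ → MarkedSquare} {k l t : ℤ} (hx : IsRobinsonTiling x)
    (hk : ∀ i j, (x (k + 2 * i) (l + 2 * j)).IsCross) (h : HasRowPhase x t) : 2 ∣ t - l - 1 := by
  obtain ⟨σ, hσ, h⟩ := h
  obtain ⟨s, h1⟩ := h 1 (Or.inl rfl) 0
  have h4 : ∀ u : ℤ, (2 : ℤ) ^ (0 + 1 + 1) ∣ u → 2 ∣ u := fun u hu => by
    norm_num at hu
    omega
  obtain ⟨c, a, b, h' | h'⟩ := hx.exists_hasShape_or 0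
  · obtain ⟨-, h2, h3⟩ := h'.parity hx hk
    rcases hσ with rfl | rfl
    · have := h4 _ (h1.unique (by simp) (by simp) (h'.hasPhase_right 1)).2
      omega
    · have := h4 _ (h1.unique (by simp) (by simp) (h'.hasPhase_left 1)).2
      omega
  · obtain ⟨h2, -⟩ := h'.parity hx.transpose (k := l) (l := k) fun i j => (hk j i).transpose
    have := h4 _ (h1.transpose.unique (by simp) hσ (h'.hasPhase_right σ)).1
    omega

/-- If two tilings differ only in a horizontal strip, then there is a row of gaps of all levels. -/
theorem exists_hasRowPhase {y y' : ℤ → ℤ → MarkedSquare} (hy : IsRobinsonTiling y)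
    (hy' : IsRobinsonTiling y') (h : ∀ i j, R < |j| → y i j = y' i j) (hne : y ≠ y') :
    ∃ t, HasRowPhase y t := by
  by_contra! hno
  obtain ⟨k, l, hk⟩ := hy.cross
  have far : ∀ σ τ : ℤ, (σ = 1 ∨ σ = -1) → (τ = 1 ∨ τ = -1) → FarEq y y' σ τ := by
    refine fun σ τ _ hτ => ⟨R, fun i j _ hj => h i j (hj.trans_le ?_)⟩
    rcases hτ with rfl | rfl
    · rw [one_mul]; exact le_abs_self j
    · rw [neg_one_mul]; exact neg_le_abs j
  -- Without a row of gaps, differences occur only in columns of gaps, which have equal parity. So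
  -- the neighbours of such a column agree, and descending along it from above the strip fixes it
  -- tile by tile.
  have col : ∀ i j, y i j ≠ y' i j → 2 ∣ i - k - 1 := fun i j hij =>
    (((uncovered_of_ne hy hy' far hij).hasRowPhase_or hy).resolve_left (hno j)).parity
      hy.transpose (k := l) (l := k) fun i j => (hk j i).transpose
  apply hne
  funext i j
  by_cases hi : 2 ∣ i - k - 1
  · have nb : ∀ m, y (i + 1) m = y' (i + 1) m ∧ y (i - 1) m = y' (i - 1) m := fun m =>
      ⟨by_contra fun hm => by have := col _ _ hm; omega,
        by_contra fun hm => by have := col _ _ hm; omega⟩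
    have key : ∀ m, m ≤ |R| + 1 → y i m = y' i m := by
      intro m hm
      induction m, hm using Int.leInductionDown with
      | base => exact h i _ (by rw [abs_of_nonneg (by positivity)]; linarith [le_abs_self R])
      | pred m _ ih =>
        refine (hy.tile i _).ext_of_north (hy'.tile i _) ?_ ?_ ?_
        · rw [hy.north_eq, hy'.north_eq, sub_add_cancel, ih]
        · rw [hy.east_eq, hy'.east_eq, (nb _).1]
        · rw [hy.west_eq, hy'.west_eq, (nb _).2]
    rcases le_or_gt j (|R| + 1) with hj | hj
    · exact key j hj
    · exact h i j (lt_of_lt_of_le (by linarith [le_abs_self R]) (le_abs_self j))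
  · exact by_contra fun hij => hi (col i j hij)

theorem HasRowPhase.exists_hasPhase {y : ℤ → ℤ → MarkedSquare} {s t : ℤ} (h : HasRowPhase y t)
    (h' : HasRowPhase (transposeTiling y) s) :
    ∃ σ τ : ℤ, (σ = 1 ∨ σ = -1) ∧ (τ = 1 ∨ τ = -1) ∧ ∀ n, HasPhase y σ τ (n + 1) s t := by
  obtain ⟨σ, hσ, h⟩ := h
  obtain ⟨τ, hτ, h'⟩ := h'
  refine ⟨σ, τ, hσ, hτ, fun n => ?_⟩
  obtain ⟨s', h1⟩ := h τ hτ n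
  obtain ⟨t', h2⟩ := h' σ hσ n
  exact h1.congr (HasPhase.unique hσ hτ h2.transpose h1).1 (by simp)

theorem HasPhase.shift {y : ℤ → ℤ → MarkedSquare} {σ τ s t : ℤ} {n : ℕ} (hσ : σ = 1 ∨ σ = -1)
    (hτ : τ = 1 ∨ τ = -1) (h : HasPhase y σ τ n s t) :
    HasPhase (shiftTiling (-s) (-t) y) σ τ n 0 0 := by
  obtain ⟨B, h⟩ := h
  have h1 := abs_le.mp (le_refl |s|)
  have h2 := abs_le.mp (le_refl |t|)
  refine ⟨B + |s| + |t|, fun p q hp hq => ?_⟩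
  rw [centers_shift, h]
  · simp
  · rcases hσ with rfl | rfl <;> linarith [abs_nonneg t]
  · rcases hτ with rfl | rfl <;> linarith [abs_nonneg s]

/-- The map does not change tiles whose surroundings are as in the standard pattern. -/
def FixesStd (R : ℤ) (g : (ℤ → ℤ → MarkedSquare) → ℤ → ℤ → MarkedSquare) : Prop :=
  ∀ {x}, IsRobinsonTiling x → ∀ v w v' w', (∀ i j, |i| ≤ R → |j| ≤ R →
    v' + i ≠ 0 ∧ w' + j ≠ 0 ∧ x (v + i) (w + j) = stdTile (v' + i) (w' + j)) →
    g x v w = stdTile v' w'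

theorem FixesStd.transpose (hg : FixesStd R g) : FixesStd R (transposeMap g) := by
  intro x hx v w v' w' H
  change (g (transposeTiling x) w v).transpose = _
  rw [hg hx.transpose w v w' v' fun i j hi hj => ?_, stdTile_transpose]
  obtain ⟨h1, h2, h3⟩ := H j i hj hi
  exact ⟨h2, h1, by rw [transposeTiling, h3, stdTile_transpose]⟩

/-- Windows of the standard pattern recur far out in each quadrant. -/
theorem exists_far_stdTile {σ τ v w : ℤ} (hσ : σ = 1 ∨ σ = -1) (hτ : τ = 1 ∨ τ = -1)
    (hv : ∀ i, |i| ≤ R → v + i ≠ 0) (hw : ∀ i, |i| ≤ R → w + i ≠ 0) :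
    ∃ n : ℕ, ∀ B, ∃ V W, (∀ i, |i| ≤ R → B < σ * (V + i) ∧ ¬ (2 : ℤ) ^ (n + 1) ∣ V + i) ∧
      (∀ i, |i| ≤ R → B < τ * (W + i) ∧ ¬ (2 : ℤ) ^ (n + 1) ∣ W + i) ∧
      ∀ i j, |i| ≤ R → |j| ≤ R → stdTile (V + i) (W + j) = stdTile (v + i) (w + j) := by
  obtain ⟨n, hn⟩ := exists_two_pow_gt (|v| + |w| + R)
  have hn' := hn (n + 1) (by omega)
  refine ⟨n, fun B => ?_⟩
  have aux : ∀ {σ v : ℤ}, (σ = 1 ∨ σ = -1) → (∀ i, |i| ≤ R → v + i ≠ 0) →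
      |v| + R < 2 ^ (n + 1) → ∃ V, (2 : ℤ) ^ (n + 1 + 1) ∣ V - v ∧
      ∀ i, |i| ≤ R → B < σ * (V + i) ∧ ¬ (2 : ℤ) ^ (n + 1) ∣ V + i ∧
        ¬ (2 : ℤ) ^ (n + 1) ∣ v + i := by
    intro σ v hσ hv hvR
    obtain ⟨V, h1, h2⟩ := exists_dvd_and_lt hσ (M := 2 ^ (n + 1 + 1)) (by positivity) v (B + R)
    refine ⟨V, h1, fun i hi => ?_⟩
    have h3 := abs_le.mp hi
    have h4 : ¬ (2 : ℤ) ^ (n + 1) ∣ v + i :=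
      not_dvd_of_abs_lt ((abs_add_le _ _).trans_lt (by linarith)) (hv i hi)
    refine ⟨by rcases hσ with rfl | rfl <;> linarith, ?_, h4⟩
    rwa [show V + i = (V - v) + (v + i) by ring,
      dvd_add_right ((pow_dvd_pow 2 (by omega)).trans h1)]
  obtain ⟨V, hV, hV'⟩ := aux hσ hv (by linarith [abs_nonneg w])
  obtain ⟨W, hW, hW'⟩ := aux hτ hw (by linarith [abs_nonneg v])
  refine ⟨V, W, fun i hi => ⟨(hV' i hi).1, (hV' i hi).2.1⟩,
    fun i hi => ⟨(hW' i hi).1, (hW' i hi).2.1⟩, fun i j hi hj => ?_⟩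
  exact stdTile_congr (hV' i hi).2.2 (hW' j hj).2.2 (by simpa using hV) (by simpa using hW)

theorem IsFault.apply {x : ℤ → ℤ → MarkedSquare} (h : IsFault 0 0 0 x) {i j : ℤ} (hi : i ≠ 0)
    (hj : j ≠ 0) : x i j = stdTile i j := by
  rcases lt_or_gt_of_ne hi with h1 | h1
  · simpa using h.left i j h1 hj
  · simpa using h.right i j h1 hj

theorem ne_zero_of_not_two_pow_dvd {n : ℕ} {i : ℤ} (h : ¬ (2 : ℤ) ^ n ∣ i) : i ≠ 0 := by
  rintro rfl
  simp at h

/-- Every standard window recurs far out in the quadrant, where `z` and `g z` are both standard in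
the same frame. Locality carries the values of `g` and of its inverse `h` from there to all other
occurrences. -/
theorem IsLocalPair.fixesStd (hg : IsLocalPair R g h) {z : ℤ → ℤ → MarkedSquare}
    (hz : IsFault 0 0 0 z) {σ τ : ℤ} (hσ : σ = 1 ∨ σ = -1) (hτ : τ = 1 ∨ τ = -1)
    (hp : ∀ n, HasPhase (g z) σ τ (n + 1) 0 0) : FixesStd R g ∧ FixesStd R h := by
  have h0 : |(0 : ℤ)| ≤ R := by simpa using hg.nonneg
  have key : ∀ v w, (∀ i, |i| ≤ R → v + i ≠ 0) → (∀ i, |i| ≤ R → w + i ≠ 0) → ∃ V W,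
      stdTile V W = stdTile v w ∧ ∀ i j, |i| ≤ R → |j| ≤ R →
        z (V + i) (W + j) = stdTile (v + i) (w + j) ∧
        g z (V + i) (W + j) = stdTile (v + i) (w + j) := by
    intro v w hv hw
    obtain ⟨n, hn⟩ := exists_far_stdTile hσ hτ hv hw
    obtain ⟨B, hB⟩ := (hp n).apply_eq hσ hτ
    obtain ⟨V, W, h1, h2, h3⟩ := hn B
    refine ⟨V, W, by simpa using h3 0 0 h0 h0, fun i j hi hj => ⟨?_, ?_⟩⟩
    · rw [hz.apply (ne_zero_of_not_two_pow_dvd (h1 i hi).2)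
        (ne_zero_of_not_two_pow_dvd (h2 j hj).2), h3 i j hi hj]
    · rw [hB _ _ (h1 i hi).1 (h2 j hj).1 (by simpa using (h1 i hi).2) (by simpa using (h2 j hj).2),
        sub_zero, sub_zero, h3 i j hi hj]
  constructor
  · intro x hx v w v' w' H
    obtain ⟨V, W, h1, h2⟩ := key v' w' (fun i hi => (H i i hi hi).1) fun i hi => (H i i hi hi).2.1
    rw [hg.left.loc hx hz.rob v w V W fun i j hi hj => by
      rw [(H i j hi hj).2.2, (h2 i j hi hj).1]]
    simpa using (h2 0 0 h0 h0).2
  · intro x hx v w v' w' H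
    obtain ⟨V, W, h1, h2⟩ := key v' w' (fun i hi => (H i i hi hi).1) fun i hi => (H i i hi hi).2.1
    rw [hg.right.loc hx (hg.left.rob hz.rob) v w V W fun i j hi hj => by
      rw [(H i j hi hj).2.2, (h2 i j hi hj).2], hg.left_inv hz.rob]
    simpa using (h2 0 0 h0 h0).1

theorem IsLocalPair.map_ne (hg : IsLocalPair R g h) {x y : ℤ → ℤ → MarkedSquare}
    (hx : IsRobinsonTiling x) (hy : IsRobinsonTiling y) (hxy : x ≠ y) : g x ≠ g y := fun H =>
  hxy (by rw [← hg.left_inv hx, H, hg.left_inv hy])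

theorem IsLocalMap.eq_of_abs_gt (hg : IsLocalMap R g) {x y : ℤ → ℤ → MarkedSquare}
    (hx : IsRobinsonTiling x) (hy : IsRobinsonTiling y)
    (hxy : ∀ i j, j ≠ 0 → x i j = y i j) (i j : ℤ) (hj : R < |j|) : g x i j = g y i j := by
  refine hg.loc hx hy _ _ _ _ fun i' j' _ hj' => hxy _ _ fun h => ?_
  rw [show j = -j' by linarith, abs_neg] at hj
  linarith

/-- A local map with a local inverse becomes trivial on the standard pattern after a shift. -/
theorem IsLocalPair.exists_fixesStd (hg : IsLocalPair R g h) :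
    ∃ s t : ℤ, FixesStd (R + |s| + |t|) (fun x => shiftTiling s t (g x)) ∧
      FixesStd (R + |s| + |t|) (fun x => h (shiftTiling (-s) (-t) x)) := by
  have hz := (isFaultColumn_plainTile (a := 0) (b := 0) (by simp)).isFault 0
  -- This tiling differs from the plain one in row 0 only, through red marks along the row; the one
  -- of `hz4` differs in column 0 only.
  have hz3 := (isFaultColumn_colThrough (isRobinson_basic 3) (a := 0) (b := 0) (r := 0) (by simp)
    (Or.inl rfl) (Or.inl rfl)).isFault 0
  have hK4 : IsFaultColumn 0 0 fun _ => basic 4 :=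
    ⟨fun _ => isRobinson_basic 4, fun _ => rfl, fun _ _ => rfl, fun _ _ => rfl, by simp⟩
  have hz4 := hK4.isFault 0
  set z := faultTiling 0 0 0 fun _ => plainTile with hzdef
  obtain ⟨t, ht⟩ := exists_hasRowPhase (hg.left.rob hz.rob) (hg.left.rob hz3.rob)
    (hg.left.eq_of_abs_gt hz.rob hz3.rob fun i j hj => by
      rcases lt_trichotomy i 0 with hi | rfl | hi
      · rw [hz.left i j hi hj, hz3.left i j hi hj]
      · rw [hzdef, faultTiling_self, faultTiling_self]
        rcases lt_or_gt_of_ne hj with h1 | h1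
        · rw [colThrough_of_lt h1]; rfl
        · rw [colThrough_of_gt h1]; rfl
      · rw [hz.right i j hi hj, hz3.right i j hi hj])
    (hg.map_ne hz.rob hz3.rob fun H => by
      have := congrFun (congrFun H 0) 0
      rw [hzdef, faultTiling_self, faultTiling_self, colThrough_self] at this
      revert this
      decide)
  obtain ⟨s, hs⟩ := exists_hasRowPhase (hg.left.rob hz.rob).transpose
    (hg.left.rob hz4.rob).transpose
    (hg.transpose.left.eq_of_abs_gt hz.rob.transpose hz4.rob.transpose fun i j hj => by
      refine congrArg MarkedSquare.transpose ?_
      rcases lt_or_gt_of_ne hj with h1 | h1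
      · rw [hzdef, faultTiling_of_lt h1, faultTiling_of_lt h1]; rfl
      · rw [hzdef, faultTiling_of_gt h1, faultTiling_of_gt h1]; rfl)
    (hg.transpose.map_ne hz.rob.transpose hz4.rob.transpose fun H => by
      have := congrFun (congrFun H 0) 0
      simp only [transposeTiling, hzdef, faultTiling_self] at this
      revert this
      decide)
  obtain ⟨σ, τ, hσ, hτ, hp⟩ := ht.exists_hasPhase hs
  refine ⟨-s, -t, (hg.shift (-s) (-t)).fixesStd hz hσ hτ fun n => (hp n).shift hσ hτ⟩

/-! ### Local maps on tilings with a fault -/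

theorem centers_of_stdTile {x : ℤ → ℤ → MarkedSquare} {n : ℕ} {p q P Q : ℤ}
    (h : ∀ i j, |i| < 2 ^ n → |j| < 2 ^ n → x (p + i) (q + j) = stdTile (P + i) (Q + j))
    (hP : (2 : ℤ) ^ (n + 1) ∣ P - 2 ^ n) (hQ : (2 : ℤ) ^ (n + 1) ∣ Q - 2 ^ n) :
    centers x n p q := by
  have aux : ∀ {P : ℤ}, (2 : ℤ) ^ (n + 1) ∣ P - 2 ^ n →
      ∃ e : ℤ, (e = 1 ∨ e = -1) ∧ (2 : ℤ) ^ (n + 1 + 1) ∣ P - 2 ^ n * e := by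
    rintro P ⟨m, hm⟩
    rcases Int.even_or_odd m with ⟨k, rfl⟩ | ⟨k, rfl⟩
    · exact ⟨1, by simp, k, by rw [pow_succ, pow_succ] at *; linarith⟩
    · exact ⟨-1, by simp, k + 1, by rw [pow_succ, pow_succ] at *; linarith⟩
  obtain ⟨e, he, hP'⟩ := aux hP
  obtain ⟨d, hd, hQ'⟩ := aux hQ
  refine ⟨e, d, he, hd, fun i j hi hj => ?_⟩
  rw [h i j hi hj]
  exact stdTile_congr (not_dvd_sign_mul_add he hi) (not_dvd_sign_mul_add hd hj)
    (by simpa using hP') (by simpa using hQ')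

theorem add_ne_of_two_pow_dvd {n : ℕ} {p c i : ℤ} (h : (2 : ℤ) ^ (n + 1) ∣ p - c - 2 ^ n)
    (hi : |i| < 2 ^ n) : p + i ≠ c ∧ (c < p → c < p + i) ∧ (p < c → p + i < c) := by
  obtain ⟨k, hk⟩ := h
  rw [pow_succ] at hk
  have h0 : (0 : ℤ) < 2 ^ n := by positivity
  rw [abs_lt] at hi
  rcases lt_or_ge k 0 with h1 | h1
  · have : p + i < c := by nlinarith
    exact ⟨this.ne, fun _ => by nlinarith, fun _ => this⟩
  · have : c < p + i := by nlinarith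
    exact ⟨this.ne', fun _ => this, fun _ => by nlinarith⟩

theorem exists_common_not_dvd {v c w b : ℤ} (hv : v ≠ c) (hw : w ≠ b) :
    ∃ n : ℕ, ¬ (2 : ℤ) ^ (n + 1) ∣ v - c ∧ ¬ (2 : ℤ) ^ (n + 1) ∣ w - b := by
  obtain ⟨N, hN⟩ := exists_not_dvd hv
  obtain ⟨N', hN'⟩ := exists_not_dvd hw
  exact ⟨max N N', hN _ (le_max_left _ _), hN' _ (le_max_right _ _)⟩

/-- A point off the three lines lies in a supertile of some level, off its central arms, and the
centres of supertiles are determined by the quadrants at infinity. -/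
theorem IsFault.of_farEq {c a b : ℤ} {x y : ℤ → ℤ → MarkedSquare} (hx : IsFault c a b x)
    (hy : IsRobinsonTiling y)
    (hxy : ∀ σ τ : ℤ, (σ = 1 ∨ σ = -1) → (τ = 1 ∨ τ = -1) → FarEq x y σ τ) : IsFault c a b y where
  rob := hy
  left v w hv hw := by
    obtain ⟨n, h1, h2⟩ := exists_common_not_dvd hv.ne hw
    obtain ⟨p, hp, hp1, hp2, hp3, -⟩ := exists_center_near h1
    obtain ⟨q, hq, hq1, hq2, -⟩ := exists_center_near h2
    have h3 : centers x (n + 1) p q := centers_of_stdTile (P := p - c) (Q := q - a)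
      (fun i j hi hj => by
        rw [hx.left _ _ ((add_ne_of_two_pow_dvd hp hi).2.2 (hp3 hv))
          (add_ne_of_two_pow_dvd hq hj).1, add_sub_right_comm, add_sub_right_comm]) hp hq
    obtain ⟨e, d, h4⟩ := (centers_iff_of_farEq hx.rob hy hxy n p q).mp h3
    exact h4.apply_eq hp1 hq1 hp2 hq2 hp hq
  right v w hv hw := by
    obtain ⟨n, h1, h2⟩ := exists_common_not_dvd hv.ne' hw
    obtain ⟨p, hp, hp1, hp2, -, hp3⟩ := exists_center_near h1
    obtain ⟨q, hq, hq1, hq2, -⟩ := exists_center_near h2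
    have h3 : centers x (n + 1) p q := centers_of_stdTile (P := p - c) (Q := q - b)
      (fun i j hi hj => by
        rw [hx.right _ _ ((add_ne_of_two_pow_dvd hp hi).2.1 (hp3 hv))
          (add_ne_of_two_pow_dvd hq hj).1, add_sub_right_comm, add_sub_right_comm]) hp hq
    obtain ⟨e, d, h4⟩ := (centers_iff_of_farEq hx.rob hy hxy n p q).mp h3
    exact h4.apply_eq hp1 hq1 hp2 hq2 hp hq

/-- Far out in the quadrants, windows show only the standard pattern, which the map fixes;
`IsFault.of_farEq` extends this to all points off the lines. -/
theorem IsFault.map {c a b : ℤ} {x : ℤ → ℤ → MarkedSquare} (hx : IsFault c a b x)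
    (hg : IsLocalMap R g) (hR : 0 ≤ R) (hf : FixesStd R g) : IsFault c a b (g x) := by
  refine hx.of_farEq (hg.rob hx.rob) fun σ τ hσ hτ => ⟨|c| + |a| + |b| + R, fun v w hv hw => ?_⟩
  have hc := abs_le.mp (le_refl |c|)
  have ha := abs_le.mp (le_refl |a|)
  have hb := abs_le.mp (le_refl |b|)
  have h0 : |(0 : ℤ)| ≤ R := by simpa using hR
  have hrow : ∀ j, |j| ≤ R → w + j ≠ a ∧ w + j ≠ b := by
    intro j hj
    rw [abs_le] at hj
    rcases hτ with rfl | rfl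
    · constructor <;> intro h <;> linarith
    · constructor <;> intro h <;> linarith
  have key : ∀ r, (∀ i j, |i| ≤ R → |j| ≤ R → v + i ≠ c ∧ w + j ≠ r ∧
      x (v + i) (w + j) = stdTile (v + i - c) (w + j - r)) → x v w = g x v w := by
    intro r hr
    have h1 := (hr 0 0 h0 h0).2.2
    rw [add_zero, add_zero] at h1
    rw [h1]
    refine (hf hx.rob v w _ _ fun i j hi hj => ?_).symm
    obtain ⟨h2, h3, h4⟩ := hr i j hi hj
    rw [sub_add_eq_add_sub, sub_add_eq_add_sub]
    exact ⟨sub_ne_zero.mpr h2, sub_ne_zero.mpr h3, h4⟩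
  rcases hσ with rfl | rfl
  · refine key b fun i j hi hj => ?_
    have h1 : c < v + i := by rw [abs_le] at hi; linarith
    exact ⟨h1.ne', (hrow j hj).2, hx.right _ _ h1 (hrow j hj).2⟩
  · refine key a fun i j hi hj => ?_
    have h1 : v + i < c := by rw [abs_le] at hi; linarith
    exact ⟨h1.ne, (hrow j hj).1, hx.left _ _ h1 (hrow j hj).1⟩

/-- The half-row east of the fault is constant before and after the map. Away from the column its
window depends only on its mark. -/
theorem IsFault.map_east_congr {c a b c' a' b' : ℤ} {x x' : ℤ → ℤ → MarkedSquare}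
    (hx : IsFault c a b x) (hx' : IsFault c' a' b' x') (hg : IsLocalMap R g) (hR : 0 ≤ R)
    (hf : FixesStd R g) (h : (x c b).east = (x' c' b').east) :
    (g x c b).east = (g x' c' b').east := by
  have h1 := hg.loc hx.rob hx'.rob (c + (R + 1)) b (c' + (R + 1)) b' fun i j hi _ => by
    rw [abs_le] at hi
    by_cases hj : j = 0
    · rw [hj, add_zero, add_zero, hx.right_row (by linarith), hx'.right_row (by linarith), h]
    · rw [hx.right _ _ (by linarith) (by omega), hx'.right _ _ (by linarith) (by omega)]
      congr 1 <;> ring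
  rw [(hx.map hg hR hf).right_row (by linarith), (hx'.map hg hR hf).right_row (by linarith)] at h1
  have h2 : (rowTile _).east = (rowTile _).east := congrArg MarkedSquare.east h1
  exact h2

theorem IsFault.map_west_congr {c a b c' a' b' : ℤ} {x x' : ℤ → ℤ → MarkedSquare}
    (hx : IsFault c a b x) (hx' : IsFault c' a' b' x') (hg : IsLocalMap R g) (hR : 0 ≤ R)
    (hf : FixesStd R g) (h : (x c a).west = (x' c' a').west) :
    (g x c a).west = (g x' c' a').west := by
  have h1 := hg.loc hx.rob hx'.rob (c - (R + 1)) a (c' - (R + 1)) a' fun i j hi _ => by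
    rw [abs_le] at hi
    by_cases hj : j = 0
    · rw [hj, add_zero, add_zero, hx.left_row (by linarith), hx'.left_row (by linarith), h]
    · rw [hx.left _ _ (by linarith) (by omega), hx'.left _ _ (by linarith) (by omega)]
      congr 1 <;> ring
  rw [(hx.map hg hR hf).left_row (by linarith), (hx'.map hg hR hf).left_row (by linarith)] at h1
  have h2 : (rowTile _).east = (rowTile _).east := congrArg MarkedSquare.east h1
  exact opp_inj.mp h2

theorem IsFault.transpose {c a : ℤ} {x : ℤ → ℤ → MarkedSquare} (hx : IsFault c a a x) :
    IsFault a c c (transposeTiling x) := by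
  have key : ∀ i j, i ≠ a → j ≠ c → transposeTiling x i j = stdTile (i - a) (j - c) := by
    intro i j hi hj
    rw [← stdTile_transpose]
    refine congrArg MarkedSquare.transpose ?_
    rcases lt_or_gt_of_ne hj with h | h
    · exact hx.left j i h hi
    · exact hx.right j i h hi
  exact ⟨hx.rob.transpose, fun i j hi hj => key i j hi.ne hj, fun i j hi hj => key i j hi.ne' hj⟩

/-! ### The marks on the sides of the Robinson tiles -/

/-- The set of Robinson tiles. -/
def robinsonTiles : Finset MarkedSquare :=
  Finset.univ.image fun b : Fin 5 × Fin 4 × Fin 2 =>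
    rot^[(b.2.1 : ℕ)] (MarkedSquare.refl^[(b.2.2 : ℕ)] (basic b.1))

theorem mem_robinsonTiles {t : MarkedSquare} : t ∈ robinsonTiles ↔ t.IsRobinson := by
  simp only [robinsonTiles, Finset.mem_image, Finset.mem_univ, true_and, Prod.exists, IsRobinson]
  exact ⟨fun ⟨b, i, j, h⟩ => ⟨b, i, j, h.symm⟩, fun ⟨b, i, j, h⟩ => ⟨b, i, j, h.symm⟩⟩

/-- The number of Robinson tiles with a given mark on a given side. -/
def markCount (s : SideMarks) : ℕ :=
  match s.mid, s.low.isNone && s.high.isNone with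
  | .head, true => 4
  | .head, false => 3
  | .tail, true => 8
  | .tail, false => 5

theorem card_filter_side : ∀ (b : Fin 5) (i : Fin 4) (j : Fin 2),
    let t := rot^[(i : ℕ)] (MarkedSquare.refl^[(j : ℕ)] (basic b))
    (robinsonTiles.filter fun t' => t'.east = t.east).card = markCount t.east ∧
    (robinsonTiles.filter fun t' => t'.north = t.north).card = markCount t.north ∧
    (robinsonTiles.filter fun t' => t'.west = t.west).card = markCount t.west ∧
    (robinsonTiles.filter fun t' => t'.south = t.south).card = markCount t.south := by
  decide +kernel

/-- The tiles of three of the five types are determined by the kinds of marks on their sides, and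
each mark occurs on one of them. -/
theorem eq_of_markCount_eq : ∀ b ∈ ({0, 2, 3} : Finset (Fin 5)), ∀ (i : Fin 4) (j : Fin 2)
    (b' : Fin 5) (i' : Fin 4) (j' : Fin 2),
    let t := rot^[(i : ℕ)] (MarkedSquare.refl^[(j : ℕ)] (basic b))
    let t' := rot^[(i' : ℕ)] (MarkedSquare.refl^[(j' : ℕ)] (basic b'))
    markCount t'.east = markCount t.east → markCount t'.north = markCount t.north →
    markCount t'.west = markCount t.west → markCount t'.south = markCount t.south → t' = t := by
  decide +kernel

theorem exists_rigid_side : ∀ (b' : Fin 5) (i' : Fin 4) (j' : Fin 2),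
    let t' := rot^[(i' : ℕ)] (MarkedSquare.refl^[(j' : ℕ)] (basic b'))
    (∃ b ∈ ({0, 2, 3} : Finset (Fin 5)), ∃ (i : Fin 4) (j : Fin 2),
      (rot^[(i : ℕ)] (MarkedSquare.refl^[(j : ℕ)] (basic b))).east = t'.east) ∧
    (∃ b ∈ ({0, 2, 3} : Finset (Fin 5)), ∃ (i : Fin 4) (j : Fin 2),
      (rot^[(i : ℕ)] (MarkedSquare.refl^[(j : ℕ)] (basic b))).north = t'.north) ∧
    (∃ b ∈ ({0, 2, 3} : Finset (Fin 5)), ∃ (i : Fin 4) (j : Fin 2),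
      (rot^[(i : ℕ)] (MarkedSquare.refl^[(j : ℕ)] (basic b))).west = t'.west) ∧
    (∃ b ∈ ({0, 2, 3} : Finset (Fin 5)), ∃ (i : Fin 4) (j : Fin 2),
      (rot^[(i : ℕ)] (MarkedSquare.refl^[(j : ℕ)] (basic b))).south = t'.south) := by
  decide +kernel

/-- An injective self-map of the finite set of tiles is a permutation; it also permutes the classes
with equal marks on the given side, so a class and its image have the same size. -/
theorem card_filter_map_eq {τ : MarkedSquare → MarkedSquare} {side : MarkedSquare → SideMarks}
    (hτ : ∀ t, t.IsRobinson → (τ t).IsRobinson)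
    (hinj : ∀ t t', t.IsRobinson → t'.IsRobinson → τ t = τ t' → t = t')
    (hs : ∀ t t', t.IsRobinson → t'.IsRobinson → (side t = side t' ↔ side (τ t) = side (τ t')))
    {t : MarkedSquare} (ht : t.IsRobinson) :
    (robinsonTiles.filter fun t' => side t' = side (τ t)).card =
      (robinsonTiles.filter fun t' => side t' = side t).card := by
  have hinj' : Set.InjOn τ robinsonTiles := fun t ht t' ht' h =>
    hinj t t' (mem_robinsonTiles.mp ht) (mem_robinsonTiles.mp ht') h
  have himg : robinsonTiles.image τ = robinsonTiles :=
    Finset.eq_of_subset_of_card_le (Finset.image_subset_iff.mpr fun t ht =>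
      mem_robinsonTiles.mpr (hτ t (mem_robinsonTiles.mp ht)))
      (Finset.card_image_of_injOn hinj').ge
  have h1 : (robinsonTiles.filter fun t' => side t' = side (τ t)) =
      (robinsonTiles.filter fun t' => side t' = side t).image τ := by
    ext u
    simp only [Finset.mem_filter, Finset.mem_image]
    constructor
    · rintro ⟨hu, h⟩
      rw [← himg, Finset.mem_image] at hu
      obtain ⟨t', ht', rfl⟩ := hu
      exact ⟨t', ⟨ht', (hs _ _ (mem_robinsonTiles.mp ht') ht).mpr h⟩, rfl⟩
    · rintro ⟨t', ⟨ht', h⟩, rfl⟩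
      exact ⟨mem_robinsonTiles.mpr (hτ _ (mem_robinsonTiles.mp ht')),
        (hs _ _ (mem_robinsonTiles.mp ht') ht).mp h⟩
  rw [h1, Finset.card_image_of_injOn (hinj'.mono fun u hu => (Finset.mem_filter.mp hu).1)]

/-- A permutation of the Robinson tiles that acts separately on the marks of the four sides is
trivial. -/
theorem eq_self_of_side_congr {τ : MarkedSquare → MarkedSquare}
    (hτ : ∀ t, t.IsRobinson → (τ t).IsRobinson)
    (hinj : ∀ t t', t.IsRobinson → t'.IsRobinson → τ t = τ t' → t = t')
    (he : ∀ t t', t.IsRobinson → t'.IsRobinson → (t.east = t'.east ↔ (τ t).east = (τ t').east))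
    (hn : ∀ t t', t.IsRobinson → t'.IsRobinson →
      (t.north = t'.north ↔ (τ t).north = (τ t').north))
    (hw : ∀ t t', t.IsRobinson → t'.IsRobinson → (t.west = t'.west ↔ (τ t).west = (τ t').west))
    (hs : ∀ t t', t.IsRobinson → t'.IsRobinson →
      (t.south = t'.south ↔ (τ t).south = (τ t').south))
    {t : MarkedSquare} (ht : t.IsRobinson) : τ t = t := by
  have hcount : ∀ t : MarkedSquare, t.IsRobinson →
      markCount (τ t).east = markCount t.east ∧ markCount (τ t).north = markCount t.north ∧
      markCount (τ t).west = markCount t.west ∧ markCount (τ t).south = markCount t.south := by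
    intro t ht
    have h1 := card_filter_map_eq hτ hinj he ht
    have h2 := card_filter_map_eq hτ hinj hn ht
    have h3 := card_filter_map_eq hτ hinj hw ht
    have h4 := card_filter_map_eq hτ hinj hs ht
    obtain ⟨b', i', j', h'⟩ := hτ t ht
    rw [h'] at h1 h2 h3 h4 ⊢
    obtain ⟨b, i, j, rfl⟩ := ht
    obtain ⟨e1, e2, e3, e4⟩ := card_filter_side b i j
    obtain ⟨f1, f2, f3, f4⟩ := card_filter_side b' i' j'
    exact ⟨by rw [← e1, ← f1, h1], by rw [← e2, ← f2, h2], by rw [← e3, ← f3, h3],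
      by rw [← e4, ← f4, h4]⟩
  -- The class sizes 4, 3, 8, 5 tell heads from tails and bare sides from red ones, which is all
  -- that is needed to recognise a tile of these three types.
  have rigid : ∀ b ∈ ({0, 2, 3} : Finset (Fin 5)), ∀ (i : Fin 4) (j : Fin 2),
      τ (rot^[(i : ℕ)] (MarkedSquare.refl^[(j : ℕ)] (basic b))) =
        rot^[(i : ℕ)] (MarkedSquare.refl^[(j : ℕ)] (basic b)) := by
    intro b hb i j
    obtain ⟨h1, h2, h3, h4⟩ := hcount _ ⟨b, i, j, rfl⟩
    obtain ⟨b', i', j', h'⟩ := hτ _ ⟨b, i, j, rfl⟩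
    rw [h'] at h1 h2 h3 h4 ⊢
    exact eq_of_markCount_eq b hb i j b' i' j' h1 h2 h3 h4
  have ht' := ht
  obtain ⟨b, i, j, rfl⟩ := ht'
  -- Each side of an arbitrary tile shares its mark with a tile already known to be fixed.
  obtain ⟨⟨b1, hb1, i1, j1, h1⟩, ⟨b2, hb2, i2, j2, h2⟩, ⟨b3, hb3, i3, j3, h3⟩,
    ⟨b4, hb4, i4, j4, h4⟩⟩ := exists_rigid_side b i j
  apply ext_sides
  · rw [← (he _ _ ⟨b1, i1, j1, rfl⟩ ht).mp h1, rigid b1 hb1, h1]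
  · rw [← (hn _ _ ⟨b2, i2, j2, rfl⟩ ht).mp h2, rigid b2 hb2, h2]
  · rw [← (hw _ _ ⟨b3, i3, j3, rfl⟩ ht).mp h3, rigid b3 hb3, h3]
  · rw [← (hs _ _ ⟨b4, i4, j4, rfl⟩ ht).mp h4, rigid b4 hb4, h4]

/-! ### Local maps fix the tilings with a fault -/

/-- The tiling with standard patterns in four quadrants around a given tile. -/
def centerTiling (t : MarkedSquare) : ℤ → ℤ → MarkedSquare := faultTiling 0 0 0 (colThrough t 0)

@[simp] theorem centerTiling_zero (t : MarkedSquare) : centerTiling t 0 0 = t := by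
  rw [centerTiling, faultTiling_self, colThrough_self]

theorem MarkedSquare.IsRobinson.isFault {t : MarkedSquare} (ht : t.IsRobinson) :
    IsFault 0 0 0 (centerTiling t) :=
  (isFaultColumn_colThrough ht (by simp) (Or.inl rfl) (Or.inl rfl)).isFault 0

/-- A local map with a local inverse that is trivial on the standard pattern. -/
structure IsStdPair (R : ℤ) (g h : (ℤ → ℤ → MarkedSquare) → ℤ → ℤ → MarkedSquare) : Prop
    extends IsLocalPair R g h where
  std_left : FixesStd R g
  std_right : FixesStd R h

theorem IsStdPair.symm (hg : IsStdPair R g h) : IsStdPair R h g :=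
  ⟨hg.toIsLocalPair.symm, hg.std_right, hg.std_left⟩

theorem IsStdPair.transpose (hg : IsStdPair R g h) :
    IsStdPair R (transposeMap g) (transposeMap h) :=
  ⟨hg.toIsLocalPair.transpose, FixesStd.transpose hg.std_left,
    FixesStd.transpose hg.std_right⟩

section

variable {c a b c' a' b' : ℤ} {x x' : ℤ → ℤ → MarkedSquare}

theorem IsStdPair.isFault (hg : IsStdPair R g h) (hx : IsFault c a b x) : IsFault c a b (g x) :=
  hx.map hg.left hg.nonneg hg.std_left

theorem IsStdPair.east_congr (hg : IsStdPair R g h) (hx : IsFault c a b x)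
    (hx' : IsFault c' a' b' x') (H : (x c b).east = (x' c' b').east) :
    (g x c b).east = (g x' c' b').east :=
  hx.map_east_congr hx' hg.left hg.nonneg hg.std_left H

theorem IsStdPair.west_congr (hg : IsStdPair R g h) (hx : IsFault c a b x)
    (hx' : IsFault c' a' b' x') (H : (x c a).west = (x' c' a').west) :
    (g x c a).west = (g x' c' a').west :=
  hx.map_west_congr hx' hg.left hg.nonneg hg.std_left H

theorem IsStdPair.east_iff (hg : IsStdPair R g h) (hx : IsFault 0 0 0 x) (hx' : IsFault 0 0 0 x') :
    (x 0 0).east = (x' 0 0).east ↔ (g x 0 0).east = (g x' 0 0).east :=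
  ⟨hg.east_congr hx hx', fun H => by
    have := hg.symm.east_congr (hg.isFault hx) (hg.isFault hx') H
    rwa [hg.left_inv hx.rob, hg.left_inv hx'.rob] at this⟩

theorem IsStdPair.west_iff (hg : IsStdPair R g h) (hx : IsFault 0 0 0 x) (hx' : IsFault 0 0 0 x') :
    (x 0 0).west = (x' 0 0).west ↔ (g x 0 0).west = (g x' 0 0).west :=
  ⟨hg.west_congr hx hx', fun H => by
    have := hg.symm.west_congr (hg.isFault hx) (hg.isFault hx') H
    rwa [hg.left_inv hx.rob, hg.left_inv hx'.rob] at this⟩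

/-- The central tile determines the whole tiling, so `t ↦ g (centerTiling t) 0 0` permutes the
tiles. The mark on each side of the image depends only on the mark on the same side of `t`, because
the half-line beyond that side is constant. -/
theorem IsStdPair.map_centerTiling (hg : IsStdPair R g h) {t : MarkedSquare} (ht : t.IsRobinson) :
    g (centerTiling t) 0 0 = t := by
  refine eq_self_of_side_congr (τ := fun t => g (centerTiling t) 0 0)
    (fun t ht => (hg.left.rob ht.isFault.rob).tile 0 0) (fun t t' ht ht' H => ?_)
    (fun t t' ht ht' => ?_) (fun t t' ht ht' => ?_) (fun t t' ht ht' => ?_)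
    (fun t t' ht ht' => ?_) ht
  · have h1 := (hg.isFault ht.isFault).eq_of_column (hg.isFault ht'.isFault) (congrArg _ H)
      (congrArg _ H) H
    have h2 : centerTiling t = centerTiling t' := by
      rw [← hg.left_inv ht.isFault.rob, h1, hg.left_inv ht'.isFault.rob]
    rw [← centerTiling_zero t, h2, centerTiling_zero]
  · simpa using hg.east_iff ht.isFault ht'.isFault
  · have := hg.transpose.east_iff ht.isFault.transpose ht'.isFault.transpose
    change (centerTiling t 0 0).north = (centerTiling t' 0 0).north ↔ _ at this
    rwa [centerTiling_zero, centerTiling_zero] at this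
  · simpa using hg.west_iff ht.isFault ht'.isFault
  · have := hg.transpose.west_iff ht.isFault.transpose ht'.isFault.transpose
    change (centerTiling t 0 0).south = (centerTiling t' 0 0).south ↔ _ at this
    rwa [centerTiling_zero, centerTiling_zero] at this

theorem IsStdPair.east_eq (hg : IsStdPair R g h) (hx : IsFault c a b x) :
    (g x c b).east = (x c b).east := by
  have ht := hx.rob.tile c b
  rw [hg.east_congr hx ht.isFault (by rw [centerTiling_zero]), hg.map_centerTiling ht]

theorem IsStdPair.west_eq (hg : IsStdPair R g h) (hx : IsFault c a b x) :
    (g x c a).west = (x c a).west := by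
  have ht := hx.rob.tile c a
  rw [hg.west_congr hx ht.isFault (by rw [centerTiling_zero]), hg.map_centerTiling ht]

theorem IsFault.even (hx : IsFault c a b x) : 2 ∣ a - b := by
  obtain ⟨k, l, hk⟩ := hx.rob.cross
  have h1 : (x (c + 1) (b + 1)).IsCross := by
    rw [hx.right _ _ (by omega) (by omega)]
    simpa using stdTile_isCross 0 (m := 1) (o := 1) (by decide) (by decide)
  have h2 : (x (c - 1) (a + 1)).IsCross := by
    rw [hx.left _ _ (by omega) (by omega)]
    simpa using stdTile_isCross 0 (m := -1) (o := 1) (by decide) (by decide)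
  have h3 := parity_of_isCross hx.rob hk h1
  have h4 := parity_of_isCross hx.rob hk h2
  omega

/-- A column without horizontal marks is constant. -/
theorem IsRobinsonTiling.column_const (hx : IsRobinsonTiling x) {u v i : ℤ} (huv : u ≤ v)
    (H : ∀ j, u ≤ j → j ≤ v → (x i j).east = bareTail ∧ (x i j).west = bareTail) :
    x i u = colTile (x i v).north :=
  congrArg MarkedSquare.transpose (hx.transpose.row_const (j := i) huv H)

/-- The tilings with a fault at a column `c` whose rows have the same positions as the rows `a` and
`b` as far as low levels are concerned. -/
def IsNearFault (N : ℕ) (c a b : ℤ) (x : ℤ → ℤ → MarkedSquare) : Prop :=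
  ∃ a' b', IsFault c a' b' x ∧ (2 : ℤ) ^ (N + 1) ∣ a' - a ∧ (2 : ℤ) ^ (N + 1) ∣ b' - b

theorem IsStdPair.isNearFault (hg : IsStdPair R g h) {N : ℕ} (hx : IsNearFault N c a b x) :
    IsNearFault N c a b (g x) := by
  obtain ⟨a', b', hx, ha, hb⟩ := hx
  exact ⟨a', b', hg.isFault hx, ha, hb⟩

theorem dvd_of_eq_of_dvd {M M' u a a' : ℤ} (hM : M ∣ M') (ha : M' ∣ a' - a) (h : u = a') :
    M ∣ u - a := by
  rw [h]
  exact hM.trans ha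

/-- No row of the window is congruent to `a` or `b` modulo `2 ^ N`, so all rows have low level and
see `a'` and `b'` only modulo `2 ^ (N + 1)`. -/
theorem IsNearFault.apply {N : ℕ} {J : ℤ} (hx : IsNearFault N c a b x) (hR : R < 2 ^ N)
    (ha : ∀ j, |j| ≤ R → ¬ (2 : ℤ) ^ N ∣ J + j - a)
    (hb : ∀ j, |j| ≤ R → ¬ (2 : ℤ) ^ N ∣ J + j - b) {i j : ℤ} (hi : |i| ≤ R) (hj : |j| ≤ R) :
    x (c + i) (J + j) = if i < 0 then stdTile i (J + j - a) else
      if 0 < i then stdTile i (J + j - b) else colTile (x c J).north := by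
  obtain ⟨a', b', hx, ha', hb'⟩ := hx
  have hd : (2 : ℤ) ^ N ∣ 2 ^ (N + 1) := pow_dvd_pow 2 (by omega)
  have hja : ∀ j, |j| ≤ R → J + j ≠ a' := fun j hj h1 => ha j hj (dvd_of_eq_of_dvd hd ha' h1)
  have hjb : ∀ j, |j| ≤ R → J + j ≠ b' := fun j hj h1 => hb j hj (dvd_of_eq_of_dvd hd hb' h1)
  have hcong : ∀ {a a' : ℤ}, (2 : ℤ) ^ (N + 1) ∣ a' - a → (2 : ℤ) ^ (N + 1) ∣
      (J + j - a') - (J + j - a) := fun {a a'} h1 => by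
    rw [show J + j - a' - (J + j - a) = -(a' - a) by ring]
    exact h1.neg_right
  rcases lt_trichotomy i 0 with h1 | rfl | h1
  · rw [if_pos h1, hx.left _ _ (by omega) (hja j hj), add_sub_cancel_left]
    exact stdTile_congr (not_dvd_of_abs_lt (hi.trans_lt hR) h1.ne) (ha j hj) (by simp) (hcong ha')
  · rw [if_neg (lt_irrefl _), if_neg (lt_irrefl _), add_zero]
    have h2 : ∀ j, |j| ≤ R → x c (J + j) = colTile (x c (J + R)).north := by
      intro j hj
      have h3 := abs_le.mp hj
      refine hx.rob.column_const (by omega) fun m hm hm' => ?_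
      have h4 : |m - J| ≤ R := abs_le.mpr ⟨by omega, by omega⟩
      have h5 := hja _ h4
      have h6 := hjb _ h4
      rw [add_sub_cancel] at h5 h6
      exact ⟨hx.east h6, hx.west h5⟩
    have h3 := h2 0 (by simpa using (abs_nonneg j).trans hj)
    rw [add_zero] at h3
    rw [h2 j hj, h3]
    rfl
  · rw [if_neg h1.le.not_gt, if_pos h1, hx.right _ _ (by omega) (hjb j hj), add_sub_cancel_left]
    exact stdTile_congr (not_dvd_of_abs_lt (hi.trans_lt hR) h1.ne') (hb j hj) (by simp)
      (hcong hb')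

/-- The state of the column at `J` determines its image. -/
theorem IsStdPair.north_congr (hg : IsStdPair R g h) {N : ℕ} {J : ℤ} (hR : R < 2 ^ N)
    (ha : ∀ j, |j| ≤ R → ¬ (2 : ℤ) ^ N ∣ J + j - a)
    (hb : ∀ j, |j| ≤ R → ¬ (2 : ℤ) ^ N ∣ J + j - b)
    (hx : IsNearFault N c a b x) (hx' : IsNearFault N c a b x')
    (H : (x c J).north = (x' c J).north) : g x c J = g x' c J := by
  have hxr : IsRobinsonTiling x := by
    obtain ⟨_, _, hx, _⟩ := hx
    exact hx.rob
  have hxr' : IsRobinsonTiling x' := by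
    obtain ⟨_, _, hx, _⟩ := hx'
    exact hx.rob
  exact hg.left.loc hxr hxr' _ _ _ _ fun i j hi hj => by
    rw [hx.apply hR ha hb hi hj, hx'.apply hR ha hb hi hj, H]

/-- The image of a straight column is determined by the image of the exceptional tile. -/
theorem IsStdPair.map_colThrough (hg : IsStdPair R g h) {t : MarkedSquare} (ht : t.IsRobinson)
    (hab : 2 ∣ a - b) {r J : ℤ} (hw : r = a ∨ t.west = bareTail)
    (he : r = b ∨ t.east = bareTail) :
    ∃ t' : MarkedSquare, t'.IsRobinson ∧ t'.east = t.east ∧ t'.west = t.west ∧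
      (r < J → (g (faultTiling c a b (colThrough t r)) c J).north = t'.north) ∧
      (J < r → (g (faultTiling c a b (colThrough t r)) c J).north = t'.south.opp) := by
  have hx := (isFaultColumn_colThrough ht hab hw he).isFault c
  set x := faultTiling c a b (colThrough t r) with hxdef
  have hy := hg.isFault hx
  have hE : ∀ j, (g x c j).east = (x c j).east := fun j => by
    by_cases hj : j = b
    · rw [hj, hg.east_eq hx]
    · rw [hx.east hj, hy.east hj]
  have hW : ∀ j, (g x c j).west = (x c j).west := fun j => by
    by_cases hj : j = a
    · rw [hj, hg.west_eq hx]
    · rw [hx.west hj, hy.west hj]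
  have hx' : ∀ j, x c j = colThrough t r j := fun j => faultTiling_self
  have hbare : ∀ j, j ≠ r → (g x c j).east = bareTail ∧ (g x c j).west = bareTail := by
    intro j hj
    rw [hE, hW, hx']
    rcases lt_or_gt_of_ne hj with h1 | h1
    · rw [colThrough_of_lt h1]; exact ⟨rfl, rfl⟩
    · rw [colThrough_of_gt h1]; exact ⟨rfl, rfl⟩
  refine ⟨g x c r, hy.rob.tile c r, ?_, ?_, fun h1 => ?_, fun h1 => ?_⟩
  · rw [hE, hx', colThrough_self]
  · rw [hW, hx', colThrough_self]
  · have h2 := hy.rob.column_const (i := c) (u := r + 1) (v := J) (by omega) fun j hj _ =>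
      hbare j (by omega)
    have h3 := hy.rob.north_eq c r
    rw [h2] at h3
    rw [h3]
    simp [colTile]
  · have h2 := hy.rob.column_const (i := c) (u := J) (v := r - 1) (by omega) fun j _ hj =>
      hbare j (by omega)
    have h3 := hy.rob.south_eq c r
    rw [h3, opp_opp, h2]
    rfl

end

/-! ### Vertical marks along the fault column are preserved -/

/-- A side where black and red arrows start, the red one at coordinate `1/4`. -/
def lowTail : SideMarks := ⟨.tail, some .tail, none⟩

/-- A side where black and red arrows start, the red one at coordinate `3/4`. -/
def highTail : SideMarks := ⟨.tail, none, some .tail⟩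

theorem MarkedSquare.IsRobinson.of_east_bareHead {t : MarkedSquare} (h : t.IsRobinson)
    (he : t.east = bareHead) (hw : t.west = bareTail) :
    t.north = t.south ∧ (t.north = bareTail ∨ t.north = highTail) := by
  revert he hw
  exact forall_isRobinson (p := fun t => t.east = bareHead → t.west = bareTail →
    t.north = t.south ∧ (t.north = bareTail ∨ t.north = highTail)) (by decide) h

theorem MarkedSquare.IsRobinson.of_west_bareHead {t : MarkedSquare} (h : t.IsRobinson)
    (he : t.east = bareTail) (hw : t.west = bareHead) :
    t.north = t.south ∧ (t.north = bareTail ∨ t.north = lowTail) := by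
  revert he hw
  exact forall_isRobinson (p := fun t => t.east = bareTail → t.west = bareHead →
    t.north = t.south ∧ (t.north = bareTail ∨ t.north = lowTail)) (by decide) h

theorem MarkedSquare.IsRobinson.north_cases {t : MarkedSquare} (h : t.IsRobinson) :
    (t.north = bareTail ∨ t.north = lowTail ∨ t.north = highTail) ∨
    (t.north = bareTail.opp ∨ t.north = lowTail.opp ∨ t.north = highTail.opp) :=
  forall_isRobinson (p := fun t =>
    (t.north = bareTail ∨ t.north = lowTail ∨ t.north = highTail) ∨
    (t.north = bareTail.opp ∨ t.north = lowTail.opp ∨ t.north = highTail.opp)) (by decide) h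

/-- A functional and injective relation that preserves `{o, p}` and `{o, q}` fixes `o`, `p`
and `q`. -/
theorem rel_self_of_pairs {α : Type*} {r : α → α → Prop} {o p q : α}
    (hfun : ∀ u v w, r u v → r u w → v = w) (hinj : ∀ u v w, r u w → r v w → u = v)
    (hp : ∀ u, u = o ∨ u = p → ∃ v, (v = o ∨ v = p) ∧ r u v)
    (hq : ∀ u, u = o ∨ u = q → ∃ v, (v = o ∨ v = q) ∧ r u v) (hpq : p = q → o = p) :
    r o o ∧ r p p ∧ r q q := by
  have hoo : r o o := by
    obtain ⟨v, hv | hv, h1⟩ := hp o (Or.inl rfl)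
    · exact hv ▸ h1
    · obtain ⟨w, hw | hw, h2⟩ := hq o (Or.inl rfl)
      · exact hw ▸ h2
      -- If `o` goes to both `p` and `q`, these coincide, and then `o` equals them.
      · have h3 := hfun _ _ _ h1 h2
        rw [hv, hw] at h3
        rw [hv, ← hpq h3] at h1
        exact h1
  refine ⟨hoo, ?_, ?_⟩
  · obtain ⟨v, hv | hv, h1⟩ := hp p (Or.inr rfl)
    · rw [hv] at h1
      rwa [← hinj _ _ _ hoo h1]
    · exact hv ▸ h1
  · obtain ⟨v, hv | hv, h1⟩ := hq q (Or.inr rfl)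
    · rw [hv] at h1
      rwa [← hinj _ _ _ hoo h1]
    · exact hv ▸ h1

/-- It suffices to preserve the vertical mark at one height `J`, away from both rows. For all
tilings whose rows are congruent to `a` and `b` modulo a high power of two, this mark and its image
determine each other. Put far away, at a height congruent to `b`, a tile that sends a black arrow
east: its vertical marks are `bareTail` or `highTail`, and so are those of its image, so this pair
is preserved. Arrows to the west preserve the pair of `bareTail` and `lowTail`. Together this fixes
all three marks; such tiles above `J` instead of below give the three opposite marks. -/
theorem IsStdPair.map_fault (hg : IsStdPair R g h) {c a b : ℤ} {x : ℤ → ℤ → MarkedSquare}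
    (hx : IsFault c a b x) : g x = x := by
  have hR := hg.nonneg
  obtain ⟨J, hJa, hJb⟩ : ∃ J : ℤ, a + R < J ∧ b + R < J :=
    ⟨max a b + R + 1, by have := le_max_left a b; omega, by have := le_max_right a b; omega⟩
  -- `2 ^ N` exceeds the distance from `a` and `b` of every row within `R` of `J`, so none of these
  -- rows is congruent to `a` or `b`.
  obtain ⟨N, hN⟩ := exists_two_pow_gt (|J| + |a| + |b| + R)
  have hN := hN N le_rfl
  have h1 := abs_le.mp (le_refl |J|)
  have h2 := abs_le.mp (le_refl |a|)
  have h3 := abs_le.mp (le_refl |b|)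
  have hRN : R < 2 ^ N := by linarith [abs_nonneg J, abs_nonneg a, abs_nonneg b]
  have ha : ∀ j, |j| ≤ R → ¬ (2 : ℤ) ^ N ∣ J + j - a := fun j hj => by
    rw [abs_le] at hj
    exact not_dvd_of_abs_lt (abs_lt.mpr ⟨by linarith, by linarith [abs_nonneg b]⟩)
      (by intro h; linarith)
  have hb : ∀ j, |j| ≤ R → ¬ (2 : ℤ) ^ N ∣ J + j - b := fun j hj => by
    rw [abs_le] at hj
    exact not_dvd_of_abs_lt (abs_lt.mpr ⟨by linarith, by linarith [abs_nonneg a]⟩)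
      (by intro h; linarith)
  have hxn : IsNearFault N c a b x := ⟨a, b, hx, by simp, by simp⟩
  let St : SideMarks → SideMarks → Prop := fun u v =>
    ∃ x, IsNearFault N c a b x ∧ (x c J).north = u ∧ (g x c J).north = v
  have hfun : ∀ u v w, St u v → St u w → v = w := by
    rintro u v w ⟨x, hx, rfl, rfl⟩ ⟨x', hx', hu, rfl⟩
    rw [hg.north_congr hRN ha hb hx hx' hu.symm]
  have hinj : ∀ u v w, St u w → St v w → u = v := by
    rintro u v w ⟨x, hx, rfl, rfl⟩ ⟨x', hx', rfl, hw⟩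
    have h4 := hg.symm.north_congr hRN ha hb (hg.isNearFault hx) (hg.isNearFault hx') hw.symm
    obtain ⟨_, _, hx, -⟩ := hx
    obtain ⟨_, _, hx', -⟩ := hx'
    rw [hg.left_inv hx.rob, hg.left_inv hx'.rob] at h4
    rw [h4]
  have hM : (0 : ℤ) < 2 ^ (N + 1) := by positivity
  have heven : ∀ {u : ℤ}, (2 : ℤ) ^ (N + 1) ∣ u → 2 ∣ u := fun hu =>
    (Dvd.intro_left _ (pow_succ 2 N).symm).trans hu
  have hab := hx.even
  have rob : ∀ s : SideMarks, (s = bareTail ∨ s = highTail →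
      (⟨bareHead, s, bareTail, s⟩ : MarkedSquare).IsRobinson) ∧ (s = bareTail ∨ s = lowTail →
      (⟨bareTail, s, bareHead, s⟩ : MarkedSquare).IsRobinson) := by
    intro s
    constructor
    · rintro (rfl | rfl) <;> decide
    · rintro (rfl | rfl) <;> decide
  have stE : ∀ s, s = bareTail ∨ s = highTail →
      (∃ v, (v = bareTail ∨ v = highTail) ∧ St s v) ∧
      (∃ v, (v = bareTail ∨ v = highTail) ∧ St s.opp v.opp) := by
    intro s hs
    constructor
    -- With `σ = -1` the bound reads `-J < -r`, so the exceptional tile lies below `J`.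
    · obtain ⟨r, hr, hr'⟩ := exists_dvd_and_lt (σ := -1) (by simp) hM b (-J)
      have hr2 := heven hr
      obtain ⟨t', h4, h5, h6, h7, -⟩ := hg.map_colThrough (c := c) (a := a) (b := r) (r := r)
        (J := J) ((rob s).1 hs) (by omega) (Or.inr rfl) (Or.inl rfl)
      refine ⟨t'.north, (h4.of_east_bareHead h5 h6).2, _, ⟨a, r,
        (isFaultColumn_colThrough ((rob s).1 hs) (by omega) (Or.inr rfl) (Or.inl rfl)).isFault c,
        by simp, hr⟩, ?_, h7 (by linarith)⟩
      rw [faultTiling_self, colThrough_of_gt (by linarith)]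
      rfl
    · obtain ⟨r, hr, hr'⟩ := exists_dvd_and_lt (σ := 1) (by simp) hM b J
      have hr2 := heven hr
      obtain ⟨t', h4, h5, h6, -, h7⟩ := hg.map_colThrough (c := c) (a := a) (b := r) (r := r)
        (J := J) ((rob s).1 hs) (by omega) (Or.inr rfl) (Or.inl rfl)
      refine ⟨t'.south, (h4.of_east_bareHead h5 h6).1 ▸ (h4.of_east_bareHead h5 h6).2, _, ⟨a, r,
        (isFaultColumn_colThrough ((rob s).1 hs) (by omega) (Or.inr rfl) (Or.inl rfl)).isFault c,
        by simp, hr⟩, ?_, h7 (by linarith)⟩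
      rw [faultTiling_self, colThrough_of_lt (by linarith)]
      rfl
  have stW : ∀ s, s = bareTail ∨ s = lowTail →
      (∃ v, (v = bareTail ∨ v = lowTail) ∧ St s v) ∧
      (∃ v, (v = bareTail ∨ v = lowTail) ∧ St s.opp v.opp) := by
    intro s hs
    constructor
    · obtain ⟨r, hr, hr'⟩ := exists_dvd_and_lt (σ := -1) (by simp) hM a (-J)
      have hr2 := heven hr
      obtain ⟨t', h4, h5, h6, h7, -⟩ := hg.map_colThrough (c := c) (a := r) (b := b) (r := r)
        (J := J) ((rob s).2 hs) (by omega) (Or.inl rfl) (Or.inr rfl)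
      refine ⟨t'.north, (h4.of_west_bareHead h5 h6).2, _, ⟨r, b,
        (isFaultColumn_colThrough ((rob s).2 hs) (by omega) (Or.inl rfl) (Or.inr rfl)).isFault c,
        hr, by simp⟩, ?_, h7 (by linarith)⟩
      rw [faultTiling_self, colThrough_of_gt (by linarith)]
      rfl
    · obtain ⟨r, hr, hr'⟩ := exists_dvd_and_lt (σ := 1) (by simp) hM a J
      have hr2 := heven hr
      obtain ⟨t', h4, h5, h6, -, h7⟩ := hg.map_colThrough (c := c) (a := r) (b := b) (r := r)
        (J := J) ((rob s).2 hs) (by omega) (Or.inl rfl) (Or.inr rfl)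
      refine ⟨t'.south, (h4.of_west_bareHead h5 h6).1 ▸ (h4.of_west_bareHead h5 h6).2, _, ⟨r, b,
        (isFaultColumn_colThrough ((rob s).2 hs) (by omega) (Or.inl rfl) (Or.inr rfl)).isFault c,
        hr, by simp⟩, ?_, h7 (by linarith)⟩
      rw [faultTiling_self, colThrough_of_lt (by linarith)]
      rfl
  have tails := rel_self_of_pairs hfun hinj (fun u hu => (stW u hu).1) (fun u hu => (stE u hu).1)
    (by decide)
  have heads := rel_self_of_pairs (r := fun u v : SideMarks => St u.opp v.opp)
    (fun u v w h4 h5 => opp_inj.mp (hfun _ _ _ h4 h5))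
    (fun u v w h4 h5 => opp_inj.mp (hinj _ _ _ h4 h5)) (fun u hu => (stW u hu).2)
    (fun u hu => (stE u hu).2) (by decide)
  have hself : St (x c J).north (x c J).north := by
    rcases (hx.rob.tile c J).north_cases with (h4 | h4 | h4) | (h4 | h4 | h4) <;> rw [h4]
    exacts [tails.1, tails.2.1, tails.2.2, heads.1, heads.2.1, heads.2.2]
  have hnorth := hfun _ _ _ ⟨x, hxn, rfl, rfl⟩ hself
  refine (hg.isFault hx).eq_of_column hx (hg.east_eq hx) (hg.west_eq hx) (r := J) ?_
  have hJa' : J ≠ a := by intro h; linarith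
  have hJb' : J ≠ b := by intro h; linarith
  rw [(hg.isFault hx).eq_colTile hJa' hJb', hnorth, ← hx.eq_colTile hJa' hJb']

/-! ### Windows of Robinson tilings are windows of tilings with a fault -/

/-- Either some line of the window is a gap of all levels, and at high levels the next gap is too
far away to meet the window; or each of its finitely many lines stops being a gap at some level. -/
theorem exists_phase_window {C : ℕ → ℤ → Prop} (hne : ∀ n, ∃ c, C n c)
    (hmono : ∀ n c, C (n + 1) c → C n c)
    (hcongr : ∀ n c c', (2 : ℤ) ^ (n + 1 + 1) ∣ c' - c → C n c → C n c') (v R : ℤ) :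
    ∃ N, ∀ n ≥ N, ∃ c, C n c ∧ ∀ i, |i - v| ≤ R → i ≠ c → ¬ (2 : ℤ) ^ (n + 1) ∣ i - c := by
  by_cases h : ∃ i, |i - v| ≤ R ∧ ∀ n, C n i
  · obtain ⟨c, hc, hC⟩ := h
    obtain ⟨N, hN⟩ := exists_two_pow_gt (2 * R)
    refine ⟨N, fun n hn => ⟨c, hC n, fun i hi hic => ?_⟩⟩
    refine not_dvd_of_abs_lt ?_ (sub_ne_zero.mpr hic)
    have h1 := hN (n + 1) (by omega)
    rw [abs_le] at hc hi
    rw [abs_lt]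
    constructor <;> linarith
  · push Not at h
    have hmono' : ∀ m n c, m ≤ n → C n c → C m c := by
      intro m n c hmn hC
      induction n, hmn using Nat.le_induction with
      | base => exact hC
      | succ n _ ih => exact ih (hmono _ _ hC)
    choose! f hf using h
    -- The additional level is needed because congruence modulo `2 ^ (n + 1)` transfers gaps of
    -- level `n - 1` only.
    refine ⟨(Finset.Icc (v - R) (v + R)).sup f + 1, fun n hn => ?_⟩
    obtain ⟨c, hc⟩ := hne n
    refine ⟨c, hc, fun i hi _ hd => hf i hi ?_⟩
    obtain ⟨m, rfl⟩ : ∃ m, n = m + 1 := ⟨n - 1, by omega⟩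
    refine hmono' _ m _ ?_ (hcongr m c i hd (hmono _ _ hc))
    rw [abs_le] at hi
    have h1 : i ∈ Finset.Icc (v - R) (v + R) := Finset.mem_Icc.mpr ⟨by linarith, by linarith⟩
    have h2 := Finset.le_sup (f := f) h1
    omega

/-- In the window of radius `R` around `(v, w)` the supertiles of some level leave free at most the
column `c` and, to the left and to the right of it, the rows `a` and `b`. -/
def HasWindowShape (x : ℤ → ℤ → MarkedSquare) (v w R c a b : ℤ) : Prop :=
  ∃ n : ℕ, HasShape (centers x (n + 1)) (n + 1) c a b ∧
    (∀ i, |i - v| ≤ R → i ≠ c → ¬ (2 : ℤ) ^ (n + 1) ∣ i - c) ∧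
    (∀ j, |j - w| ≤ R → j ≠ a → ¬ (2 : ℤ) ^ (n + 1) ∣ j - a) ∧
    (∀ j, |j - w| ≤ R → j ≠ b → ¬ (2 : ℤ) ^ (n + 1) ∣ j - b)

theorem exists_hasWindowShape_of_column {x : ℤ → ℤ → MarkedSquare} (hx : IsRobinsonTiling x) {c : ℤ}
    (hc : ∀ n, ∃ a b, HasShape (centers x (n + 1)) (n + 1) c a b) (v w R : ℤ) :
    ∃ c a b, HasWindowShape x v w R c a b := by
  obtain ⟨N₁, h1⟩ := exists_phase_window (C := fun n a => ∃ b,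
    HasShape (centers x (n + 1)) (n + 1) c a b) hc
    (fun n a ⟨b, H⟩ => ⟨b, H.of_le hx (Nat.le_succ n)⟩)
    (fun n a a' hd ⟨b, H⟩ => ⟨b, H.congr hd (by simp)⟩) w R
  obtain ⟨N₂, h2⟩ := exists_phase_window (C := fun n b => ∃ a,
    HasShape (centers x (n + 1)) (n + 1) c a b) (fun n => exists_comm.mp (hc n))
    (fun n b ⟨a, H⟩ => ⟨a, H.of_le hx (Nat.le_succ n)⟩)
    (fun n b b' hd ⟨a, H⟩ => ⟨a, H.congr (by simp) hd⟩) w R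
  obtain ⟨N₃, h3⟩ := exists_two_pow_gt (R + |v| + |c|)
  have hn1 := le_max_left (max N₁ N₂) N₃
  have hn2 := le_max_right (max N₁ N₂) N₃
  have hn3 := le_max_left N₁ N₂
  have hn4 := le_max_right N₁ N₂
  set n := max (max N₁ N₂) N₃
  obtain ⟨a, ⟨b', H1⟩, ha⟩ := h1 n (by omega)
  obtain ⟨b, ⟨a', H2⟩, hb⟩ := h2 n (by omega)
  have h4 := ((H2.hasPhase_right 1).unique (by simp) (by simp) (H1.hasPhase_right 1)).2
  refine ⟨c, a, b, n, H1.congr (by simp) h4, fun i hi hic => ?_, ha, hb⟩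
  refine not_dvd_of_abs_lt ?_ (sub_ne_zero.mpr hic)
  have h5 := h3 (n + 1) (by omega)
  have h6 := abs_le.mp (le_refl |v|)
  have h7 := abs_le.mp (le_refl |c|)
  rw [abs_le] at hi
  rw [abs_lt]
  constructor <;> linarith

theorem exists_hasWindowShape {x : ℤ → ℤ → MarkedSquare} (hx : IsRobinsonTiling x) (v w R : ℤ) :
    (∃ c a b, HasWindowShape x v w R c a b) ∨
      ∃ c a b, HasWindowShape (transposeTiling x) w v R c a b := by
  rcases exists_hasShape_centers hx with hc | ⟨c, hc⟩ | ⟨c, hc⟩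
  · left
    obtain ⟨N₁, h1⟩ := exists_phase_window (C := fun n c => ∃ a,
      HasShape (centers x (n + 1)) (n + 1) c a a) hc
      (fun n c ⟨a, H⟩ => ⟨a, H.of_le hx (Nat.le_succ n)⟩)
      (fun n c c' hd ⟨a, H⟩ => ⟨a, (H.swap.congr hd hd).swap⟩) v R
    obtain ⟨N₂, h2⟩ := exists_phase_window (C := fun n a => ∃ c,
      HasShape (centers x (n + 1)) (n + 1) c a a) (fun n => exists_comm.mp (hc n))
      (fun n a ⟨c, H⟩ => ⟨c, H.of_le hx (Nat.le_succ n)⟩)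
      (fun n a a' hd ⟨c, H⟩ => ⟨c, H.congr hd hd⟩) w R
    have hn1 := le_max_left N₁ N₂
    have hn2 := le_max_right N₁ N₂
    set n := max N₁ N₂
    obtain ⟨c, ⟨a', H1⟩, hc⟩ := h1 n (by omega)
    obtain ⟨a, ⟨c', H2⟩, ha⟩ := h2 n (by omega)
    have h3 := ((H2.hasPhase_right 1).unique (by simp) (by simp) (H1.hasPhase_right 1)).2
    exact ⟨c, a, a, n, H1.congr h3 h3, hc, ha, ha⟩
  · exact Or.inl (exists_hasWindowShape_of_column hx hc v w R)
  · exact Or.inr (exists_hasWindowShape_of_column hx.transpose hc w v R)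

theorem IsRobinsonTiling.row_eq {x : ℤ → ℤ → MarkedSquare} (hx : IsRobinsonTiling x)
    {S : Set ℤ} (hS : S.OrdConnected) {u v j : ℤ} (hu : u ∈ S) (hv : v ∈ S)
    (H : ∀ i ∈ S, (x i j).north = bareTail ∧ (x i j).south = bareTail) : x u j = x v j := by
  wlog huv : u ≤ v generalizing u v
  · exact (this hv hu (by omega)).symm
  rw [hx.row_const huv fun i h1 h2 => H i (hS.out hu hv ⟨h1, h2⟩)]
  exact ((hx.tile v j).eq_rowTile (H v hv).1 (H v hv).2).symm

/-- In the window only the column `c` and the half-rows `a` and `b` can deviate from the standard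
pattern. The half-rows are constant there, and outside the window the column is continued straight
in both directions. If `c` misses the window, one row suffices. -/
theorem HasWindowShape.exists_isFault {x : ℤ → ℤ → MarkedSquare} (hx : IsRobinsonTiling x)
    {v w c a b : ℤ} (hR : 0 ≤ R) (H : HasWindowShape x v w (R + 1) c a b) :
    ∃ c' a' b' y, IsFault c' a' b' y ∧
      ∀ i j, |i - v| ≤ R → |j - w| ≤ R → x i j = y i j := by
  obtain ⟨n, hshape, hc, ha, hb⟩ := H
  -- The margin of one tile gives access to the standard neighbours of the lines, which leave them
  -- no transversal marks.
  have hmem : ∀ {m u : ℤ}, |m - u| ≤ R → |m - u| ≤ R + 1 ∧ |m + 1 - u| ≤ R + 1 ∧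
      |m - 1 - u| ≤ R + 1 := fun {m u} hm => by
    rw [abs_le] at hm
    refine ⟨abs_le.mpr ?_, abs_le.mpr ?_, abs_le.mpr ?_⟩ <;> constructor <;> linarith
  have hleft : ∀ i j, |i - v| ≤ R + 1 → |j - w| ≤ R + 1 → i < c → j ≠ a →
      x i j = stdTile (i - c) (j - a) := fun i j hi hj hic hja =>
    hshape.apply_left hic (hc i hi hic.ne) (ha j hj hja)
  have hright : ∀ i j, |i - v| ≤ R + 1 → |j - w| ≤ R + 1 → c < i → j ≠ b →
      x i j = stdTile (i - c) (j - b) := fun i j hi hj hic hjb =>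
    hshape.apply_right hic (hc i hi hic.ne') (hb j hj hjb)
  have hleft' : ∀ i, |i - v| ≤ R + 1 → |a - w| ≤ R → i < c →
      (x i a).north = bareTail ∧ (x i a).south = bareTail := fun i hi haw hic =>
    hx.north_south_eq_bareTail (m := i - c) (by omega)
      (by rw [hleft _ _ hi (hmem haw).2.1 hic (by omega), add_sub_cancel_left])
      (by rw [hleft _ _ hi (hmem haw).2.2 hic (by omega), sub_sub_cancel_left])
  have hright' : ∀ i, |i - v| ≤ R + 1 → |b - w| ≤ R → c < i →
      (x i b).north = bareTail ∧ (x i b).south = bareTail := fun i hi hbw hic =>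
    hx.north_south_eq_bareTail (m := i - c) (by omega)
      (by rw [hright _ _ hi (hmem hbw).2.1 hic (by omega), add_sub_cancel_left])
      (by rw [hright _ _ hi (hmem hbw).2.2 hic (by omega), sub_sub_cancel_left])
  have hcon : (Set.Icc (v - R) (v + R)).OrdConnected := Set.ordConnected_Icc
  have hicc : ∀ {i : ℤ}, i ∈ Set.Icc (v - R) (v + R) ↔ |i - v| ≤ R := fun {i} => by
    rw [Set.mem_Icc, abs_le]
    constructor <;> rintro ⟨h1, h2⟩ <;> constructor <;> linarith
  have hv0 : |v - v| ≤ R := by simpa using hR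
  rcases lt_or_ge (v + R) c with h1 | h1
  · refine ⟨c, a, a, _, (isFaultColumn_colThrough (hx.tile v a) (r := a) (by simp) (Or.inl rfl)
      (Or.inl rfl)).isFault c, fun i j hi hj => ?_⟩
    have h2 : ∀ i, |i - v| ≤ R → i < c := fun i hi => by rw [abs_le] at hi; linarith
    rw [faultTiling_of_lt (h2 i hi)]
    split_ifs with hja
    · subst hja
      have hstr : ∀ i ∈ Set.Icc (v - R) (v + R), (x i j).north = bareTail ∧
          (x i j).south = bareTail := fun i hi =>
        hleft' i (hmem (hicc.mp hi)).1 hj (h2 i (hicc.mp hi))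
      rw [hx.row_eq hcon (hicc.mpr hi) (hicc.mpr hv0) hstr, colThrough_self]
      obtain ⟨h3, h4⟩ := hstr v (hicc.mpr hv0)
      have h5 := (hx.tile v j).eq_rowTile h3 h4
      rw [h5]
      simp [rowTile]
    · exact hleft i j (hmem hi).1 (hmem hj).1 (h2 i hi) hja
  rcases lt_or_ge c (v - R) with h1' | h1'
  · refine ⟨c, b, b, _, (isFaultColumn_colThrough (hx.tile v b) (r := b) (by simp) (Or.inl rfl)
      (Or.inl rfl)).isFault c, fun i j hi hj => ?_⟩
    have h2 : ∀ i, |i - v| ≤ R → c < i := fun i hi => by rw [abs_le] at hi; linarith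
    rw [faultTiling_of_gt (h2 i hi)]
    split_ifs with hjb
    · subst hjb
      have hstr : ∀ i ∈ Set.Icc (v - R) (v + R), (x i j).north = bareTail ∧
          (x i j).south = bareTail := fun i hi =>
        hright' i (hmem (hicc.mp hi)).1 hj (h2 i (hicc.mp hi))
      rw [hx.row_eq hcon (hicc.mpr hi) (hicc.mpr hv0) hstr, colThrough_self]
      obtain ⟨h3, h4⟩ := hstr v (hicc.mpr hv0)
      exact (hx.tile v j).eq_rowTile h3 h4
    · exact hright i j (hmem hi).1 (hmem hj).1 (h2 i hi) hjb
  have hcv : |c - v| ≤ R := hicc.mp ⟨h1', h1⟩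
  let K : ℤ → MarkedSquare := fun j => if w + R < j then colTile (x c (w + R)).north else
    if j < w - R then colTile (x c (w - R)).south.opp else x c j
  have hKin : ∀ j, |j - w| ≤ R → K j = x c j := fun j hj => by
    rw [abs_le] at hj
    simp only [K]
    rw [if_neg (by omega), if_neg (by omega)]
  have hKup : ∀ j, w + R < j → K j = colTile (x c (w + R)).north := fun j hj => by
    simp only [K]
    rw [if_pos hj]
  have hKlow : ∀ j, j < w - R → K j = colTile (x c (w - R)).south.opp := fun j hj => by
    simp only [K]
    rw [if_neg (by omega), if_pos hj]
  have hcases : ∀ j, j < w - R ∨ |j - w| ≤ R ∨ w + R < j := fun j => by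
    rw [abs_le]
    omega
  obtain ⟨k, l, hk⟩ := hx.cross
  have hpar := hshape.parity hx hk
  have hK : IsFaultColumn a b K :=
    { tile := fun j => by
        rcases hcases j with h2 | h2 | h2
        · rw [hKlow j h2]; exact (hx.tile _ _).colTile.2
        · rw [hKin j h2]; exact hx.tile _ _
        · rw [hKup j h2]; exact (hx.tile _ _).colTile.1
      ver := fun j => by
        rcases hcases j with h2 | h2 | h2
        · rw [hKlow j h2]
          rcases lt_or_eq_of_le (Int.add_one_le_iff.mpr h2) with h3 | h3
          · rw [hKlow _ h3]; rfl
          · rw [h3, hKin _ (abs_le.mpr ⟨by omega, by omega⟩)]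
            simp [colTile]
        · rw [hKin j h2]
          rw [abs_le] at h2
          rcases lt_or_eq_of_le (show j ≤ w + R by linarith) with h3 | h3
          · rw [hKin _ (abs_le.mpr ⟨by omega, by omega⟩), hx.ver]
          · rw [hKup _ (by omega), h3]; rfl
        · rw [hKup j h2, hKup _ (by omega)]; rfl
      west := fun j hj => by
        rcases hcases j with h2 | h2 | h2
        · rw [hKlow j h2]; rfl
        · rw [hKin j h2, hx.west_eq, hleft _ j (hmem hcv).2.2 (hmem h2).1 (by omega) hj,
            sub_sub_cancel_left, stdTile_east_neg_one (by omega)]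
          rfl
        · rw [hKup j h2]; rfl
      east := fun j hj => by
        rcases hcases j with h2 | h2 | h2
        · rw [hKlow j h2]; rfl
        · rw [hKin j h2, hx.east_eq, hright _ j (hmem hcv).2.1 (hmem h2).1 (by omega) hj,
            add_sub_cancel_left, stdTile_west_one (by omega)]
          rfl
        · rw [hKup j h2]; rfl
      even := by omega }
  refine ⟨c, a, b, _, hK.isFault c, fun i j hi hj => ?_⟩
  rcases lt_trichotomy i c with hic | rfl | hic
  · rw [faultTiling_of_lt hic]
    split_ifs with hja
    · subst hja
      rw [hKin j hj, hx.west_eq, opp_opp]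
      refine hx.row_const (by omega) fun m h2 h3 => hleft' m ?_ hj (by omega)
      rw [abs_le] at hi hcv ⊢
      omega
    · exact hleft i j (hmem hi).1 (hmem hj).1 hic hja
  · rw [faultTiling_self, hKin j hj]
  · rw [faultTiling_of_gt hic]
    split_ifs with hjb
    · subst hjb
      rw [hKin j hj, hx.east_eq]
      have hstr : ∀ m ∈ Set.Icc (c + 1) i, (x m j).north = bareTail ∧
          (x m j).south = bareTail := fun m hm => by
        have h2 := hm.1
        have h3 := hm.2
        refine hright' m ?_ hj (by omega)
        rw [abs_le] at hi hcv ⊢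
        omega
      rw [hx.row_eq Set.ordConnected_Icc (Set.right_mem_Icc.mpr (by omega))
        (Set.left_mem_Icc.mpr (by omega)) hstr]
      obtain ⟨h3, h4⟩ := hstr (c + 1) (Set.left_mem_Icc.mpr (by omega))
      have h5 := (hx.tile (c + 1) j).eq_rowTile h3 h4
      rw [h5]
      simp [rowTile]
    · exact hright i j (hmem hi).1 (hmem hj).1 hic hjb

theorem IsStdPair.apply_of_window (hg : IsStdPair R g h) {x : ℤ → ℤ → MarkedSquare}
    (hx : IsRobinsonTiling x) {v w c a b : ℤ} (H : HasWindowShape x v w (R + 1) c a b) :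
    g x v w = x v w := by
  obtain ⟨c', a', b', y, hy, hxy⟩ := H.exists_isFault hx hg.nonneg
  have h0 : ∀ u : ℤ, |u - u| ≤ R := fun u => by simpa using hg.nonneg
  rw [hg.left.loc hx hy.rob v w v w fun i j hi hj =>
      hxy _ _ (by simpa using hi) (by simpa using hj), hg.map_fault hy, hxy v w (h0 v) (h0 w)]

/-- A local map with a local inverse that is trivial on the standard pattern is trivial. -/
theorem IsStdPair.map_eq (hg : IsStdPair R g h) {x : ℤ → ℤ → MarkedSquare}
    (hx : IsRobinsonTiling x) : g x = x := by
  funext v w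
  rcases exists_hasWindowShape hx v w (R + 1) with ⟨c, a, b, H⟩ | ⟨c, a, b, H⟩
  · exact hg.apply_of_window hx H
  · have := hg.transpose.apply_of_window hx.transpose H
    exact congrArg MarkedSquare.transpose this

/-- The only local maps of Robinson tilings with a local inverse are the shifts. -/
theorem IsLocalPair.exists_eq_shift (hg : IsLocalPair R g h) :
    ∃ s t : ℤ, ∀ x, IsRobinsonTiling x → g x = shiftTiling s t x := by
  obtain ⟨s, t, h1, h2⟩ := hg.exists_fixesStd
  have hstd : IsStdPair _ _ _ := ⟨hg.shift s t, h1, h2⟩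
  refine ⟨-s, -t, fun x hx => ?_⟩
  have := hstd.map_eq hx
  rw [← this, shiftTiling_neg_shiftTiling, this]

end Faults

/-! ### Local rules and fractures of subshifts -/

namespace Subshift

variable {d : ℕ} {𝒜 : Type*} [TopologicalSpace 𝒜]

theorem shift_apply (X : Subshift d 𝒜) (k v : Fin d → ℤ) (x : X.Point) :
    (X.shift k x).1 v = x.1 (v - k) := rfl

theorem shift_add (X : Subshift d 𝒜) (k l : Fin d → ℤ) (x : X.Point) :
    X.shift (k + l) x = X.shift k (X.shift l x) := by
  apply Subtype.ext
  funext v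
  rw [shift_apply, shift_apply, shift_apply, sub_sub]

theorem shift_zero (X : Subshift d 𝒜) (x : X.Point) : X.shift 0 x = x := by
  apply Subtype.ext
  funext v
  rw [shift_apply, sub_zero]

theorem IsAMorphism.mul {X : Subshift d 𝒜} {A B : GL (Fin d) ℤ} {f g : X.Point ≃ₜ X.Point}
    (hf : X.IsAMorphism A f) (hg : X.IsAMorphism B g) : X.IsAMorphism (A * B) (f * g) := by
  intro p x
  change f (g (X.shift p x)) = X.shift _ (f (g x))
  rw [hg, hf, Matrix.mulVec_mulVec]
  rfl

theorem IsAMorphism.one (X : Subshift d 𝒜) : X.IsAMorphism 1 (1 : X.Point ≃ₜ X.Point) := by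
  intro p x
  simp

theorem IsAMorphism.inv {X : Subshift d 𝒜} {A : GL (Fin d) ℤ} {f : X.Point ≃ₜ X.Point}
    (hf : X.IsAMorphism A f) : X.IsAMorphism A⁻¹ (f⁻¹ : X.Point ≃ₜ X.Point) := by
  intro p x
  have h := hf ((A⁻¹).1.mulVec p) (f.symm x)
  rw [Matrix.mulVec_mulVec, ← Units.val_mul, mul_inv_cancel, Units.val_one,
    Matrix.one_mulVec, f.apply_symm_apply] at h
  change f.symm (X.shift p x) = X.shift _ (f.symm x)
  rw [← h, f.symm_apply_apply]

theorem IsAMorphism.pow {X : Subshift d 𝒜} {A : GL (Fin d) ℤ} {f : X.Point ≃ₜ X.Point}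
    (hf : X.IsAMorphism A f) (n : ℕ) : X.IsAMorphism (A ^ n) (f ^ n : X.Point ≃ₜ X.Point) := by
  induction n with
  | zero => rw [pow_zero, pow_zero]; exact IsAMorphism.one X
  | succ n ih => rw [pow_succ, pow_succ]; exact ih.mul hf

/-- The matrix of an extended symmetry of a strongly aperiodic subshift is unique. -/
theorem IsAMorphism.unique {X : Subshift d 𝒜} (hX : X.StronglyAperiodic) [Nonempty X.Point]
    {A B : GL (Fin d) ℤ} {f : X.Point → X.Point} (hA : X.IsAMorphism A f)
    (hB : X.IsAMorphism B f) : A = B := by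
  obtain ⟨x⟩ := ‹Nonempty X.Point›
  apply Units.ext
  apply Matrix.toLin'.injective
  apply LinearMap.ext
  intro p
  rw [Matrix.toLin'_apply, Matrix.toLin'_apply, ← sub_eq_zero]
  apply hX (f x)
  have h := (hA p x).symm.trans (hB p x)
  rw [sub_eq_add_neg, add_comm, shift_add, h, ← shift_add, neg_add_cancel, shift_zero]

/-- A continuous map of subshifts looks only at a finite window. -/
theorem exists_radius [Finite 𝒜] [DiscreteTopology 𝒜] {X : Subshift d 𝒜}
    {f : X.Point → X.Point} (hf : Continuous f) : ∃ R : ℕ, ∀ x y : X.Point,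
      (∀ v : Fin d → ℤ, (∀ i, |v i| ≤ R) → x.1 v = y.1 v) → (f x).1 0 = (f y).1 0 := by
  by_contra! hcon
  have : CompactSpace X.Point := isCompact_iff_compactSpace.mp X.isClosed'.isCompact
  have hev : ∀ v, Continuous fun x : X.Point => x.1 v := fun v =>
    (continuous_apply v).comp continuous_subtype_val
  -- A decreasing sequence of compact sets. If all were nonempty, a common point would be a pair of
  -- equal configurations with different images.
  let T : ℕ → Set (X.Point × X.Point) := fun R =>
    {p | (∀ v : Fin d → ℤ, (∀ i, |v i| ≤ R) → p.1.1 v = p.2.1 v) ∧ (f p.1).1 0 ≠ (f p.2).1 0}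
  have hclosed : ∀ R, IsClosed (T R) := by
    intro R
    have h1 : IsClosed {p : X.Point × X.Point | (f p.1).1 0 ≠ (f p.2).1 0} :=
      (isClosed_discrete {q : 𝒜 × 𝒜 | q.1 ≠ q.2}).preimage
        (((hev 0).comp (hf.comp continuous_fst)).prodMk ((hev 0).comp (hf.comp continuous_snd)))
    have h2 : IsClosed {p : X.Point × X.Point |
        ∀ v : Fin d → ℤ, (∀ i, |v i| ≤ R) → p.1.1 v = p.2.1 v} := by
      simp only [Set.ofPred_forall]
      exact isClosed_iInter fun v => isClosed_iInter fun _ =>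
        isClosed_eq ((hev v).comp continuous_fst) ((hev v).comp continuous_snd)
    exact h2.inter h1
  obtain ⟨⟨x, y⟩, hxy⟩ := IsCompact.nonempty_iInter_of_sequence_nonempty_isCompact_isClosed T
    (fun R p hp => ⟨fun v hv => hp.1 v fun i => (hv i).trans (by push_cast; linarith), hp.2⟩)
    (fun R => by
      obtain ⟨x, y, h1, h2⟩ := hcon R
      exact ⟨(x, y), h1, h2⟩)
    (hclosed 0).isCompact hclosed
  rw [Set.mem_iInter] at hxy
  have h1 : x = y := by
    apply Subtype.ext
    funext v
    refine (hxy (∑ i, (v i).natAbs)).1 v fun i => ?_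
    have := Finset.single_le_sum (f := fun i => (v i).natAbs) (fun _ _ => Nat.zero_le _)
      (Finset.mem_univ i)
    rw [Int.abs_eq_natAbs]
    exact_mod_cast this
  exact (hxy 0).2 (by rw [h1])

theorem IsAMorphism.exists_radius [Finite 𝒜] [DiscreteTopology 𝒜] {X : Subshift d 𝒜}
    {A : GL (Fin d) ℤ} {f : X.Point → X.Point} (hf : X.IsAMorphism A f) (hc : Continuous f) :
    ∃ R : ℕ, ∀ (x y : X.Point) (v w : Fin d → ℤ),
      (∀ u : Fin d → ℤ, (∀ i, |u i| ≤ R) → x.1 (v + u) = y.1 (w + u)) →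
      (f x).1 (A.1.mulVec v) = (f y).1 (A.1.mulVec w) := by
  obtain ⟨R, hR⟩ := Subshift.exists_radius hc
  refine ⟨R, fun x y v w h => ?_⟩
  have key : ∀ (x : X.Point) (v : Fin d → ℤ),
      (f (X.shift (-v) x)).1 0 = (f x).1 (A.1.mulVec v) := fun x v => by
    rw [hf, shift_apply, Matrix.mulVec_neg, sub_neg_eq_add, zero_add]
  rw [← key, ← key]
  refine hR _ _ fun u hu => ?_
  rw [shift_apply, shift_apply, sub_neg_eq_add, sub_neg_eq_add, add_comm u, add_comm u]
  exact h u hu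

/-! ### Fractures under extended symmetries -/

theorem sum_inv_mulVec (A : GL (Fin 2) ℤ) (α : Fin 2 → ℝ) (v : Fin 2 → ℤ) :
    ∑ j, (∑ i, α i * ((A⁻¹).1 i j : ℝ)) * (v j : ℝ) =
      ∑ i, α i * (((A⁻¹).1.mulVec v) i : ℝ) := by
  simp only [Fin.sum_univ_two, Matrix.mulVec, dotProduct]
  push_cast
  ring

/-- The part of a half-plane that is far from its boundary, moved by a matrix, is contained in a
half-plane. -/
theorem exists_halfPlane_map (A : GL (Fin 2) ℤ) {S : Set (Fin 2 → ℤ)} (hS : IsLatticeHalfPlane S)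
    (R : ℕ) : ∃ S', IsLatticeHalfPlane S' ∧ ∀ v ∈ S', ∀ u : Fin 2 → ℤ, (∀ i, |u i| ≤ R) →
      (A⁻¹).1.mulVec v + u ∈ S := by
  obtain ⟨α, c, hα, rfl⟩ := hS
  -- The normal vector is pulled back by the inverse matrix; a displacement `u` with entries at most
  -- `R` lowers the linear form by at most `R * ∑ i, |α i|`.
  refine ⟨{v | c + R * ∑ i, |α i| ≤ ∑ j, (∑ i, α i * ((A⁻¹).1 i j : ℝ)) * (v j : ℝ)},
    ⟨_, _, fun h0 => hα ?_, rfl⟩, fun v hv u hu => ?_⟩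
  · have h1 : ∀ w : Fin 2 → ℤ, ∑ i, α i * (w i : ℝ) = 0 := fun w => by
      have h2 := sum_inv_mulVec A α (A.1.mulVec w)
      rw [Matrix.mulVec_mulVec, ← Units.val_mul, inv_mul_cancel, Units.val_one,
        Matrix.one_mulVec] at h2
      rw [← h2]
      have h3 : ∀ j, ∑ i, α i * ((A⁻¹).1 i j : ℝ) = 0 := fun j => congrFun h0 j
      simp only [h3, zero_mul, Finset.sum_const_zero]
    funext i
    have h2 := h1 (Pi.single i 1)
    fin_cases i <;> simpa [Fin.sum_univ_two] using h2
  · rw [Set.mem_ofPred_eq, sum_inv_mulVec] at hv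
    rw [Set.mem_ofPred_eq]
    have h1 : ∀ i, -(R * |α i|) ≤ α i * (u i : ℝ) := fun i => by
      have h2 : |α i * (u i : ℝ)| ≤ R * |α i| := by
        rw [abs_mul, mul_comm]
        refine mul_le_mul_of_nonneg_right ?_ (abs_nonneg _)
        exact_mod_cast hu i
      exact (abs_le.mp h2).1
    simp only [Fin.sum_univ_two, Pi.add_apply, Int.cast_add] at hv h1 ⊢
    linarith [h1 0, h1 1]

/-- Extended symmetries map directions of fracture to such directions. -/
theorem HasFracture.map {𝒜 : Type*} [TopologicalSpace 𝒜] [Finite 𝒜] [DiscreteTopology 𝒜]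
    {X : Subshift 2 𝒜} {A : GL (Fin 2) ℤ} {f : X.Point → X.Point} (hf : X.IsAMorphism A f)
    (hc : Continuous f) {q : Fin 2 → ℤ} (hq : X.HasFracture q) :
    X.HasFracture (A.1.mulVec q) := by
  obtain ⟨x, k, S₁, S₂, hk, hS₁, hS₂, hd, hq₁, hq₂, hy⟩ := hq
  obtain ⟨R, hR⟩ := hf.exists_radius hc
  obtain ⟨T₁, hT₁, h1⟩ := exists_halfPlane_map A hS₁ R
  obtain ⟨T₂, hT₂, h2⟩ := exists_halfPlane_map A hS₂ R
  have hAinv : ∀ v : Fin 2 → ℤ, A.1.mulVec ((A⁻¹).1.mulVec v) = v := fun v => by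
    rw [Matrix.mulVec_mulVec, ← Units.val_mul, mul_inv_cancel, Units.val_one, Matrix.one_mulVec]
  have hinvA : ∀ v : Fin 2 → ℤ, (A⁻¹).1.mulVec (A.1.mulVec v) = v := fun v => by
    rw [Matrix.mulVec_mulVec, ← Units.val_mul, inv_mul_cancel, Units.val_one, Matrix.one_mulVec]
  have h1' : ∀ v ∈ T₁, (A⁻¹).1.mulVec v ∈ S₁ := fun v hv => by
    simpa using h1 v hv 0 (by simp)
  have h2' : ∀ v ∈ T₂, (A⁻¹).1.mulVec v ∈ S₂ := fun v hv => by
    simpa using h2 v hv 0 (by simp)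
  refine ⟨f x, k, T₁, T₂, hk, hT₁, hT₂, Set.disjoint_left.mpr fun v hv hv' =>
    Set.disjoint_left.mp hd (h1' v hv) (h2' v hv'), fun m hm => hq₁ m ?_, fun m hm => hq₂ m ?_,
    fun j => ?_⟩
  · have := h1' _ hm
    rwa [Matrix.mulVec_smul, hinvA] at this
  · have := h2' _ hm
    rwa [Matrix.mulVec_smul, hinvA] at this
  · obtain ⟨y, hy₁, hy₂⟩ := hy j
    refine ⟨f y, fun v hv => ?_, fun v hv => ?_⟩
    · have := hR y x ((A⁻¹).1.mulVec v) _ fun u hu => hy₁ _ (h1 v hv u hu)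
      rwa [hAinv] at this
    · have := hR y (X.shift (k j • q) x) ((A⁻¹).1.mulVec v) _ fun u hu => hy₂ _ (h2 v hv u hu)
      rwa [hAinv, hf, Matrix.mulVec_smul] at this

end Subshift

/-! ### The Robinson shift in coordinates -/

/-- The point of the Robinson shift in coordinates. -/
def coords (x : robinsonShift.Point) (i j : ℤ) : MarkedSquare := (x.1 ![i, j]).1

theorem eta_vec (v : Fin 2 → ℤ) : ![v 0, v 1] = v := by
  funext i
  fin_cases i <;> rfl

theorem coords_apply (x : robinsonShift.Point) (v : Fin 2 → ℤ) :
    coords x (v 0) (v 1) = (x.1 v).1 := by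
  rw [coords, eta_vec]

theorem coords_injective : Function.Injective coords := fun x y h => by
  apply Subtype.ext
  funext v
  apply Subtype.ext
  rw [← coords_apply, ← coords_apply, h]

theorem coords_isRobinsonTiling (x : robinsonShift.Point) : IsRobinsonTiling (coords x) := by
  obtain ⟨ha, k, hk, -⟩ := x.2
  refine ⟨fun i j => (x.1 _).2, fun i j => ?_, fun i j => ?_, k 0, k 1, fun i j => ?_⟩
  · have := (ha ![i, j]).1
    simpa [coords] using this
  · have := (ha ![i, j]).2
    simpa [coords] using this
  · have := hk ![i, j]
    rw [← coords_apply] at this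
    simpa using this

/-- The point of the Robinson shift with given coordinates. -/
def ofCoords (x : ℤ → ℤ → MarkedSquare) (hx : IsRobinsonTiling x) : robinsonShift.Point where
  val v := ⟨x (v 0) (v 1), hx.tile _ _⟩
  property := by
    obtain ⟨k, l, hk⟩ := hx.cross
    refine ⟨fun v => ⟨?_, ?_⟩, ![k, l], fun p => ?_, fun v hv => ?_⟩
    · simpa using hx.hor (v 0) (v 1)
    · simpa using hx.ver (v 0) (v 1)
    · simpa using hk (p 0) (p 1)
    · rcases parity_of_isCross hx hk hv with ⟨⟨a, ha⟩, ⟨b, hb⟩⟩ | ⟨⟨a, ha⟩, ⟨b, hb⟩⟩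
      · refine Or.inl ⟨![a, b], ?_⟩
        rw [← eta_vec v]
        simp only [two_nsmul]
        simp
        omega
      · refine Or.inr ⟨![a, b], ?_⟩
        rw [← eta_vec v]
        simp only [two_nsmul]
        simp
        omega

@[simp] theorem coords_ofCoords {x : ℤ → ℤ → MarkedSquare} (hx : IsRobinsonTiling x) :
    coords (ofCoords x hx) = x := rfl

theorem coords_shift (k : Fin 2 → ℤ) (x : robinsonShift.Point) :
    coords (robinsonShift.shift k x) = shiftTiling (k 0) (k 1) (coords x) := by
  funext i j
  have : ![i, j] - k = ![i - k 0, j - k 1] := by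
    rw [← eta_vec (![i, j] - k)]
    rfl
  rw [coords, Subshift.shift_apply, this]
  rfl

instance : Nonempty robinsonShift.Point :=
  ⟨ofCoords _ ((isFaultColumn_plainTile (a := 0) (b := 0) (by simp)).isRobinsonTiling 0)⟩

theorem robinsonShift_stronglyAperiodic : robinsonShift.StronglyAperiodic := by
  intro x k h
  have h1 := congrArg coords h
  rw [coords_shift] at h1
  obtain ⟨h2, h3⟩ := (coords_isRobinsonTiling x).period_eq_zero (s := k 0) (t := k 1)
    fun i j => by
      have := congrFun (congrFun h1 (i + k 0)) (j + k 1)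
      rw [← this]
      simp [shiftTiling]
  rw [← eta_vec k, h2, h3]
  funext i
  fin_cases i <;> rfl

/-! ### The fractures of the Robinson shift -/

/-- As `β ≠ 0`, going far along a column in the direction of the sign of `β`, in steps of `M`,
outweighs the bounded contribution of the square. -/
theorem isTall_halfPlane {α β c : ℝ} (hβ : β ≠ 0) :
    IsTall fun i j => c ≤ α * i + β * j := by
  intro p r R M hM
  have hβ' : 0 < |β| := abs_pos.mpr hβ
  obtain ⟨n, hn⟩ := exists_nat_ge ((c + |α| * (|p| + |R|) + |β| * (|r| + |R|)) / |β|)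
  rw [div_le_iff₀ hβ'] at hn
  obtain ⟨τ, hτ⟩ : ∃ τ : ℤ, β * τ = |β| := by
    rcases lt_or_gt_of_ne hβ with h | h
    · exact ⟨-1, by rw [abs_of_neg h]; simp⟩
    · exact ⟨1, by rw [abs_of_pos h]; simp⟩
  refine ⟨r + M * (τ * n), ⟨τ * n, by ring⟩, fun i j hi hj => ?_⟩
  have hbound : ∀ (γ : ℝ) (p i : ℤ), |i| ≤ R → -(|γ| * (|p| + |R|)) ≤ γ * (p + i : ℤ) := by
    intro γ p i hi
    have h1 : |((p + i : ℤ) : ℝ)| ≤ |p| + |R| := by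
      have : |p + i| ≤ |p| + |R| := (abs_add_le _ _).trans (by linarith [le_abs_self R])
      exact_mod_cast this
    have h2 := neg_abs_le (γ * (p + i : ℤ))
    rw [abs_mul] at h2
    have h3 := mul_le_mul_of_nonneg_left h1 (abs_nonneg γ)
    push_cast at *
    linarith
  have h1 := hbound α p i hi
  have h2 := hbound β r j hj
  have h3 : |β| * n ≤ |β| * n * M := by
    have : (1 : ℝ) ≤ M := by exact_mod_cast hM
    exact le_mul_of_one_le_right (by positivity) this
  have h4 : β * ((r + M * (τ * n) + j : ℤ) : ℝ) = β * (r + j : ℤ) + |β| * n * M := by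
    rw [← hτ]
    push_cast
    ring
  change c ≤ α * ((p + i : ℤ) : ℝ) + β * ((r + M * (τ * n) + j : ℤ) : ℝ)
  rw [h4]
  push_cast at *
  linarith

theorem eq_zero_of_forall_int_mul_lt {u c : ℝ} (h : ∀ m : ℤ, (m : ℝ) * u < c) : u = 0 := by
  by_contra hu
  obtain ⟨n, hn⟩ := exists_nat_ge (c / |u|)
  rw [div_le_iff₀ (abs_pos.mpr hu)] at hn
  rcases lt_or_gt_of_ne hu with h1 | h1
  · have := h (-n)
    rw [abs_of_neg h1] at hn
    push_cast at this
    linarith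
  · have := h n
    rw [abs_of_pos h1] at hn
    push_cast at this
    linarith

/-- A half-plane that misses `ℤq` has a normal vector orthogonal to `q`; as `q` is off the axes, so
is the normal vector. -/
theorem IsLatticeHalfPlane.isTall {S : Set (Fin 2 → ℤ)} (hS : IsLatticeHalfPlane S)
    {q : Fin 2 → ℤ} (hq : ∀ m : ℤ, m • q ∉ S) (h0 : q 0 ≠ 0) (h1 : q 1 ≠ 0) :
    IsTall (fun i j => ![i, j] ∈ S) ∧ IsTall (fun i j => ![j, i] ∈ S) := by
  obtain ⟨α, c, hα, rfl⟩ := hS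
  simp only [Set.mem_ofPred_eq, Fin.sum_univ_two, not_le, Pi.smul_apply, smul_eq_mul,
    Int.cast_mul] at hq
  have h2 : α 0 * q 0 + α 1 * q 1 = 0 := eq_zero_of_forall_int_mul_lt (c := c) fun m => by
    have := hq m
    linarith
  have h0' : (q 0 : ℝ) ≠ 0 := by exact_mod_cast h0
  have h1' : (q 1 : ℝ) ≠ 0 := by exact_mod_cast h1
  have hα' : α 0 ≠ 0 ∧ α 1 ≠ 0 := by
    constructor <;> intro h3 <;> refine hα (funext fun i => ?_)
    · rw [h3, zero_mul, zero_add, mul_eq_zero, or_iff_left h1'] at h2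
      fin_cases i
      exacts [h3, h2]
    · rw [h3, zero_mul, add_zero, mul_eq_zero, or_iff_left h0'] at h2
      fin_cases i
      exacts [h2, h3]
  constructor
  · have := isTall_halfPlane (α := α 0) (c := c) hα'.2
    simpa [Fin.sum_univ_two] using this
  · have := isTall_halfPlane (α := α 1) (c := c) hα'.1
    simpa [Fin.sum_univ_two, add_comm] using this

theorem robinsonShift_fracture_axis {q : Fin 2 → ℤ} (hq : robinsonShift.HasFracture q) :
    q 0 = 0 ∨ q 1 = 0 := by
  by_contra! h
  obtain ⟨x, k, S₁, S₂, hk, hS₁, hS₂, -, hq₁, hq₂, hy⟩ := hq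
  obtain ⟨j, hj⟩ : ∃ j, k j ≠ 0 := by
    by_contra! h0
    have := hk (Nat.zero_lt_one)
    rw [h0, h0] at this
    exact lt_irrefl _ this
  obtain ⟨y, hy₁, hy₂⟩ := hy j
  obtain ⟨ht₁, ht₁'⟩ := hS₁.isTall hq₁ h.1 h.2
  obtain ⟨ht₂, ht₂'⟩ := hS₂.isTall hq₂ h.1 h.2
  rcases (coords_isRobinsonTiling x).eq_zero_or_eq_zero (coords_isRobinsonTiling y)
    (s := (k j • q) 0) (t := (k j • q) 1) ht₁ ht₂ ht₁' ht₂'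
    (fun i j hij => congrArg Subtype.val (hy₁ _ hij)) (fun i j hij => by
      rw [← coords_shift]
      exact congrArg Subtype.val (hy₂ _ hij)) with h1 | h1
  · exact mul_ne_zero hj h.1 h1
  · exact mul_ne_zero hj h.2 h1

theorem isLatticeHalfPlane_coord (i : Fin 2) {τ : ℤ} (hτ : τ ≠ 0) :
    IsLatticeHalfPlane {v : Fin 2 → ℤ | 1 ≤ τ * v i} := by
  refine ⟨Pi.single i (τ : ℝ), 1, fun h => hτ ?_, ?_⟩
  · have := congrFun h i
    simpa using this
  · ext v
    simp only [Set.mem_ofPred_eq]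
    have : ∑ j, (Pi.single i (τ : ℝ) : Fin 2 → ℝ) j * (v j : ℝ) = ((τ * v i : ℤ) : ℝ) := by
      fin_cases i <;> simp [Fin.sum_univ_two]
    rw [this]
    exact_mod_cast Iff.rfl

theorem strictMono_two_mul : StrictMono fun j : ℕ => 2 * (j : ℤ) := fun a b h => by
  change 2 * (a : ℤ) < 2 * (b : ℤ)
  omega

/-- The column of plain tiles fits any even offset between its two sides, so the left half may slide
by `2jm` while the right half stays. -/
theorem hasFracture_vertical (m : ℤ) : robinsonShift.HasFracture ![0, m] := by
  have hz : ∀ s : ℤ, IsRobinsonTiling (faultTiling 0 (0 + 2 * s) 0 fun _ => plainTile) := fun s =>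
    (isFaultColumn_plainTile (by omega)).isRobinsonTiling 0
  refine ⟨ofCoords _ (hz 0), fun j => 2 * (j : ℤ), {v | 1 ≤ 1 * v 0}, {v | 1 ≤ -1 * v 0},
    strictMono_two_mul, isLatticeHalfPlane_coord 0 (by simp), isLatticeHalfPlane_coord 0 (by simp),
    Set.disjoint_left.mpr fun v hv hv' => ?_, fun m hm => ?_, fun m hm => ?_, fun j =>
      ⟨ofCoords _ (hz (j * m)), fun v hv => ?_, fun v hv => ?_⟩⟩
  · simp only [Set.mem_ofPred_eq] at hv hv'
    omega
  · simp at hm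
  · simp at hm
  · apply Subtype.ext
    simp only [Set.mem_ofPred_eq] at hv
    rw [← coords_apply, ← coords_apply, coords_ofCoords, coords_ofCoords,
      faultTiling_of_gt (by omega), faultTiling_of_gt (by omega)]
  · apply Subtype.ext
    simp only [Set.mem_ofPred_eq] at hv
    rw [← coords_apply, ← coords_apply, coords_shift, coords_ofCoords, coords_ofCoords,
      shiftTiling_faultTiling (by omega)]
    simp [mul_assoc]

theorem hasFracture_horizontal (m : ℤ) : robinsonShift.HasFracture ![m, 0] := by
  have hz : ∀ s : ℤ, IsRobinsonTiling (faultTiling 0 (0 + 2 * s) 0 fun _ => plainTile) := fun s =>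
    (isFaultColumn_plainTile (by omega)).isRobinsonTiling 0
  refine ⟨ofCoords _ (hz 0).transpose, fun j => 2 * (j : ℤ), {v | 1 ≤ 1 * v 1}, {v | 1 ≤ -1 * v 1},
    strictMono_two_mul, isLatticeHalfPlane_coord 1 (by simp), isLatticeHalfPlane_coord 1 (by simp),
    Set.disjoint_left.mpr fun v hv hv' => ?_, fun m hm => ?_, fun m hm => ?_, fun j =>
      ⟨ofCoords _ (hz (j * m)).transpose, fun v hv => ?_, fun v hv => ?_⟩⟩
  · simp only [Set.mem_ofPred_eq] at hv hv'
    omega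
  · simp at hm
  · simp at hm
  · apply Subtype.ext
    simp only [Set.mem_ofPred_eq] at hv
    rw [← coords_apply, ← coords_apply, coords_ofCoords, coords_ofCoords, transposeTiling,
      transposeTiling, faultTiling_of_gt (by omega), faultTiling_of_gt (by omega)]
  · apply Subtype.ext
    simp only [Set.mem_ofPred_eq] at hv
    rw [← coords_apply, ← coords_apply, coords_shift, coords_ofCoords, coords_ofCoords,
      transposeTiling, shiftTiling_faultTiling (by omega)]
    simp [mul_assoc, shiftTiling, transposeTiling]

theorem robinsonShift_hasFracture_iff {q : Fin 2 → ℤ} :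
    robinsonShift.HasFracture q ↔ (∃ m : ℤ, q = ![m, 0]) ∨ ∃ m : ℤ, q = ![0, m] := by
  constructor
  · intro h
    rcases robinsonShift_fracture_axis h with h0 | h1
    · exact Or.inr ⟨q 1, by rw [← h0, eta_vec]⟩
    · exact Or.inl ⟨q 0, by rw [← h1, eta_vec]⟩
  · rintro (⟨m, rfl⟩ | ⟨m, rfl⟩)
    · exact hasFracture_horizontal m
    · exact hasFracture_vertical m

/-! ### The extended symmetries of the Robinson shift -/

open Classical in
/-- A map of points of the Robinson shift in coordinates. -/
noncomputable def coordMap (f : robinsonShift.Point → robinsonShift.Point)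
    (x : ℤ → ℤ → MarkedSquare) : ℤ → ℤ → MarkedSquare :=
  if hx : IsRobinsonTiling x then coords (f (ofCoords x hx)) else x

theorem coordMap_eq (f : robinsonShift.Point → robinsonShift.Point) {x : ℤ → ℤ → MarkedSquare}
    (hx : IsRobinsonTiling x) : coordMap f x = coords (f (ofCoords x hx)) := by
  rw [coordMap, dif_pos hx]

theorem ofCoords_coords (x : robinsonShift.Point) (hx : IsRobinsonTiling (coords x)) :
    ofCoords (coords x) hx = x :=
  coords_injective rfl

theorem coordMap_isLocalMap {f : robinsonShift.Point → robinsonShift.Point} {R : ℕ} {R' : ℤ}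
    (hR : (R : ℤ) ≤ R')
    (h : ∀ (x y : robinsonShift.Point) (v w : Fin 2 → ℤ),
      (∀ u : Fin 2 → ℤ, (∀ i, |u i| ≤ R) → x.1 (v + u) = y.1 (w + u)) → (f x).1 v = (f y).1 w) :
    IsLocalMap R' (coordMap f) where
  rob hx := by
    rw [coordMap_eq f hx]
    exact coords_isRobinsonTiling _
  loc := by
    intro x y hx hy v w v' w' H
    rw [coordMap_eq f hx, coordMap_eq f hy]
    refine congrArg Subtype.val (h _ _ _ _ fun u hu => Subtype.ext ?_)
    exact H (u 0) (u 1) ((hu 0).trans hR) ((hu 1).trans hR)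

/-- The extended symmetries with trivial matrix are the shifts. -/
theorem exists_eq_shift {f : robinsonShift.Point ≃ₜ robinsonShift.Point}
    (hf : robinsonShift.IsAMorphism 1 f) : ∃ k, ∀ x, f x = robinsonShift.shift k x := by
  have hf' := hf.inv
  rw [inv_one] at hf'
  obtain ⟨R₁, h1⟩ := hf.exists_radius f.continuous
  obtain ⟨R₂, h2⟩ := hf'.exists_radius (f⁻¹ : robinsonShift.Point ≃ₜ robinsonShift.Point).continuous
  simp only [Units.val_one, Matrix.one_mulVec] at h1 h2
  have hpair : IsLocalPair (max (R₁ : ℤ) R₂) (coordMap f)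
      (coordMap (f⁻¹ : robinsonShift.Point ≃ₜ robinsonShift.Point)) :=
    { nonneg := le_max_of_le_left (by positivity)
      left := coordMap_isLocalMap (le_max_left _ _) h1
      right := coordMap_isLocalMap (le_max_right _ _) h2
      left_inv := fun {x} hx => by
        rw [coordMap_eq f hx, coordMap_eq _ (coords_isRobinsonTiling _), ofCoords_coords]
        exact congrArg coords (f.symm_apply_apply _)
      right_inv := fun {x} hx => by
        rw [coordMap_eq _ hx, coordMap_eq _ (coords_isRobinsonTiling _), ofCoords_coords]
        exact congrArg coords (f.apply_symm_apply _) }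
  obtain ⟨s, t, h⟩ := hpair.exists_eq_shift
  refine ⟨![s, t], fun x => coords_injective ?_⟩
  have h3 := h (coords x) (coords_isRobinsonTiling x)
  rw [coordMap_eq _ (coords_isRobinsonTiling x), ofCoords_coords] at h3
  rw [h3, coords_shift]
  rfl

/-! ### Matrices of extended symmetries -/

theorem exists_dihedralMatrix_eq : ∀ e ∈ ({1, -1} : Finset ℤ), ∀ f ∈ ({1, -1} : Finset ℤ),
    (∃ d, (dihedralMatrix d).1 = !![e, 0; 0, f]) ∧ ∃ d, (dihedralMatrix d).1 = !![0, e; f, 0] := by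
  decide

theorem dihedralMatrix_injective : Function.Injective dihedralMatrix := by
  decide

/-- An invertible matrix that preserves the union of the axes is a signed permutation matrix. -/
theorem exists_dihedralMatrix {A : GL (Fin 2) ℤ} (h0 : A.1 0 0 = 0 ∨ A.1 1 0 = 0)
    (h1 : A.1 0 1 = 0 ∨ A.1 1 1 = 0) : ∃ d, dihedralMatrix d = A := by
  have hdet : IsUnit (A.1 0 0 * A.1 1 1 - A.1 0 1 * A.1 1 0) := by
    rw [← Matrix.det_fin_two]
    exact (Matrix.isUnit_iff_isUnit_det _).mp A.isUnit
  have hmem : ∀ {u : ℤ}, IsUnit u → u ∈ ({1, -1} : Finset ℤ) := fun hu => by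
    simpa using Int.isUnit_iff.mp hu
  have hA : A.1 = !![A.1 0 0, A.1 0 1; A.1 1 0, A.1 1 1] := Matrix.eta_fin_two _
  rcases h0 with h0 | h0 <;> rcases h1 with h1 | h1 <;> rw [h0, h1] at hdet
  · simp at hdet
  · rw [zero_mul, zero_sub, IsUnit.neg_iff, IsUnit.mul_iff] at hdet
    obtain ⟨d, hd⟩ := (exists_dihedralMatrix_eq _ (hmem hdet.1) _ (hmem hdet.2)).2
    exact ⟨d, Units.ext (by rw [hd, hA, h0, h1]; rfl)⟩
  · rw [zero_mul, sub_zero, IsUnit.mul_iff] at hdet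
    obtain ⟨d, hd⟩ := (exists_dihedralMatrix_eq _ (hmem hdet.1) _ (hmem hdet.2)).1
    exact ⟨d, Units.ext (by rw [hd, hA, h0, h1]; rfl)⟩
  · simp at hdet

/-- The unit vectors are directions of fracture, so their images, the columns of `A`, lie on the
axes. -/
theorem Subshift.IsAMorphism.exists_dihedralMatrix {A : GL (Fin 2) ℤ}
    {f : robinsonShift.Point ≃ₜ robinsonShift.Point} (hf : robinsonShift.IsAMorphism A f) :
    ∃ d, dihedralMatrix d = A := by
  apply _root_.exists_dihedralMatrix
  · have := robinsonShift_fracture_axis ((hasFracture_horizontal 1).map hf f.continuous)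
    simpa [Matrix.mulVec, dotProduct, Fin.sum_univ_two] using this
  · have := robinsonShift_fracture_axis ((hasFracture_vertical 1).map hf f.continuous)
    simpa [Matrix.mulVec, dotProduct, Fin.sum_univ_two] using this

/-- The rotation of points of the Robinson shift. -/
def rotPoint (x : robinsonShift.Point) : robinsonShift.Point :=
  -- The quarter turn is the transposition followed by the east-west reflection.
  ofCoords _ (coords_isRobinsonTiling x).transpose.mirror

/-- The reflection of points of the Robinson shift. -/
def reflPoint (x : robinsonShift.Point) : robinsonShift.Point :=
  ofCoords _ (coords_isRobinsonTiling x).mirror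

theorem rotPoint_apply (x : robinsonShift.Point) (v : Fin 2 → ℤ) :
    (rotPoint x).1 v = (x.1 ![v 1, -v 0]).rot := rfl

theorem reflPoint_apply (x : robinsonShift.Point) (v : Fin 2 → ℤ) :
    (reflPoint x).1 v = (x.1 ![-v 0, v 1]).refl := rfl

theorem coords_rotPoint (x : robinsonShift.Point) :
    coords (rotPoint x) = mirrorTiling (transposeTiling (coords x)) := rfl

theorem coords_reflPoint (x : robinsonShift.Point) :
    coords (reflPoint x) = mirrorTiling (coords x) := rfl

theorem rotPoint_rotPoint (x : robinsonShift.Point) :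
    rotPoint (rotPoint (rotPoint (rotPoint x))) = x := by
  apply coords_injective
  funext i j
  simp only [coords_rotPoint, mirrorTiling, transposeTiling, neg_neg]
  rfl

theorem reflPoint_reflPoint (x : robinsonShift.Point) : reflPoint (reflPoint x) = x := by
  apply coords_injective
  funext i j
  simp only [coords_reflPoint, mirrorTiling, neg_neg]
  rfl

theorem rotPoint_reflPoint_rotPoint (x : robinsonShift.Point) :
    rotPoint (reflPoint (rotPoint x)) = reflPoint x := by
  apply coords_injective
  funext i j
  simp only [coords_reflPoint, coords_rotPoint, mirrorTiling, transposeTiling, neg_neg]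
  rfl

theorem continuous_of_apply {f : robinsonShift.Point → robinsonShift.Point}
    (φ : (Fin 2 → ℤ) → Fin 2 → ℤ) (t : RobinsonTile → RobinsonTile)
    (h : ∀ x v, (f x).1 v = t (x.1 (φ v))) : Continuous f := by
  refine Continuous.subtype_mk (f := fun x => (f x).1) (continuous_pi fun v => ?_) fun x => (f x).2
  simp only [h]
  exact continuous_of_discreteTopology.comp ((continuous_apply _).comp continuous_subtype_val)

theorem continuous_rotPoint : Continuous rotPoint :=
  continuous_of_apply _ _ rotPoint_apply

/-- The rotation as a homeomorphism. -/
def rotHomeo : robinsonShift.Point ≃ₜ robinsonShift.Point where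
  toFun := rotPoint
  invFun x := rotPoint (rotPoint (rotPoint x))
  left_inv := rotPoint_rotPoint
  right_inv := rotPoint_rotPoint
  continuous_toFun := continuous_rotPoint
  continuous_invFun := continuous_rotPoint.comp (continuous_rotPoint.comp continuous_rotPoint)

/-- The reflection as a homeomorphism. -/
def reflHomeo : robinsonShift.Point ≃ₜ robinsonShift.Point where
  toFun := reflPoint
  invFun := reflPoint
  left_inv := reflPoint_reflPoint
  right_inv := reflPoint_reflPoint
  continuous_toFun := continuous_of_apply _ _ reflPoint_apply
  continuous_invFun := continuous_of_apply _ _ reflPoint_apply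

/-- The shift as a homeomorphism. -/
def shiftHomeo (k : Fin 2 → ℤ) : robinsonShift.Point ≃ₜ robinsonShift.Point where
  toFun := robinsonShift.shift k
  invFun := robinsonShift.shift (-k)
  left_inv x := by rw [← Subshift.shift_add, neg_add_cancel, Subshift.shift_zero]
  right_inv x := by rw [← Subshift.shift_add, add_neg_cancel, Subshift.shift_zero]
  continuous_toFun := continuous_of_apply (fun v => v - k) id fun _ _ => rfl
  continuous_invFun := continuous_of_apply (fun v => v - -k) id fun _ _ => rfl

theorem isAMorphism_rotHomeo : robinsonShift.IsAMorphism rotMatrix rotHomeo := by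
  intro p x
  apply coords_injective
  funext i j
  change coords (rotPoint _) i j = coords (robinsonShift.shift _ (rotPoint x)) i j
  simp only [coords_rotPoint, coords_shift, mirrorTiling, transposeTiling, shiftTiling]
  simp only [rotMatrix, Matrix.mulVec, dotProduct, Fin.sum_univ_two]
  simp
  ring_nf

theorem isAMorphism_reflHomeo : robinsonShift.IsAMorphism reflMatrix reflHomeo := by
  intro p x
  apply coords_injective
  funext i j
  change coords (reflPoint _) i j = coords (robinsonShift.shift _ (reflPoint x)) i j
  simp only [coords_reflPoint, coords_shift, mirrorTiling, shiftTiling]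
  simp only [reflMatrix, Matrix.mulVec, dotProduct, Fin.sum_univ_two]
  simp
  ring_nf

theorem isAMorphism_shiftHomeo (k : Fin 2 → ℤ) :
    robinsonShift.IsAMorphism 1 (shiftHomeo k) := by
  intro p x
  change robinsonShift.shift k (robinsonShift.shift p x) = _
  rw [Units.val_one, Matrix.one_mulVec, ← Subshift.shift_add, add_comm, Subshift.shift_add]
  rfl

/-! ### The isomorphism with the semidirect product -/

/-- The homomorphism on the dihedral group of order 8 that is given by a rotation and a
reflection. -/
def dihedralHom {G : Type*} [Group G] (ρ μ : G) (h4 : ρ ^ 4 = 1) (h2 : μ * μ = 1)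
    (hc : ρ * μ * ρ = μ) : DihedralGroup 4 →* G where
  toFun
    | .r i => ρ ^ i.val
    | .sr i => μ * ρ ^ i.val
  map_one' := by
    change ρ ^ (0 : ZMod 4).val = 1
    simp
  map_mul' := by
    have hadd : ∀ i j : ZMod 4, ρ ^ (i + j).val = ρ ^ i.val * ρ ^ j.val := fun i j => by
      rw [ZMod.val_add, ← pow_eq_pow_mod _ h4, pow_add]
    have hsub : ∀ i j : ZMod 4, ρ ^ (j - i).val = (ρ ^ i.val)⁻¹ * ρ ^ j.val := fun i j => by
      have := hadd i (j - i)
      rw [add_sub_cancel] at this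
      rw [this, inv_mul_cancel_left]
    have hcomm : ∀ n : ℕ, ρ ^ n * μ = μ * (ρ ^ n)⁻¹ := fun n => by
      have h5 : SemiconjBy μ ρ⁻¹ ρ := by
        rw [SemiconjBy, mul_inv_eq_iff_eq_mul, hc]
      rw [← inv_pow]
      exact (h5.pow_right n).symm
    rintro (i | i) (j | j)
    · exact hadd i j
    · change μ * ρ ^ (j - i).val = ρ ^ i.val * (μ * ρ ^ j.val)
      rw [hsub, ← mul_assoc, ← mul_assoc, hcomm]
    · change μ * ρ ^ (i + j).val = μ * ρ ^ i.val * ρ ^ j.val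
      rw [hadd, mul_assoc]
    · change ρ ^ (j - i).val = μ * ρ ^ i.val * (μ * ρ ^ j.val)
      rw [hsub, mul_assoc, ← mul_assoc (ρ ^ i.val), hcomm, ← mul_assoc, ← mul_assoc, h2, one_mul]

/-- The dihedral group acting on the Robinson shift. -/
def dihedralSymmetry : DihedralGroup 4 →* robinsonShift.extendedSymmetry :=
  dihedralHom ⟨rotHomeo, rotMatrix, isAMorphism_rotHomeo⟩
    ⟨reflHomeo, reflMatrix, isAMorphism_reflHomeo⟩
    (Subtype.ext (Homeomorph.ext rotPoint_rotPoint))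
    (Subtype.ext (Homeomorph.ext reflPoint_reflPoint))
    (Subtype.ext (Homeomorph.ext rotPoint_reflPoint_rotPoint))

/-- The shifts as extended symmetries. -/
def shiftSymmetry : Multiplicative (Fin 2 → ℤ) →* robinsonShift.extendedSymmetry where
  toFun k := ⟨shiftHomeo k.toAdd, 1, isAMorphism_shiftHomeo _⟩
  map_one' := Subtype.ext (Homeomorph.ext fun x => Subshift.shift_zero _ x)
  map_mul' _ _ := Subtype.ext (Homeomorph.ext fun x => Subshift.shift_add _ _ _ x)

theorem isAMorphism_dihedralSymmetry (d : DihedralGroup 4) :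
    robinsonShift.IsAMorphism (dihedralMatrix d) (dihedralSymmetry d).1 := by
  rcases d with i | i
  · exact isAMorphism_rotHomeo.pow i.val
  · exact isAMorphism_reflHomeo.mul (isAMorphism_rotHomeo.pow i.val)

/-- The action of `ℤ² ⋊ D₄` on the Robinson shift. -/
def latticeDihedralHom : LatticeDihedral →* robinsonShift.extendedSymmetry :=
  SemidirectProduct.lift shiftSymmetry dihedralSymmetry fun d => by
    refine MonoidHom.ext fun k => ?_
    change shiftSymmetry (Multiplicative.ofAdd ((dihedralMatrix d).1.mulVec k.toAdd)) =
      dihedralSymmetry d * shiftSymmetry k * (dihedralSymmetry d)⁻¹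
    rw [eq_mul_inv_iff_mul_eq]
    exact Subtype.ext (Homeomorph.ext fun x => (isAMorphism_dihedralSymmetry d k.toAdd x).symm)

theorem latticeDihedralHom_eq (s : LatticeDihedral) :
    latticeDihedralHom s = shiftSymmetry s.left * dihedralSymmetry s.right := rfl

theorem isAMorphism_latticeDihedralHom (s : LatticeDihedral) :
    robinsonShift.IsAMorphism (dihedralMatrix s.right) (latticeDihedralHom s).1 := by
  have := (isAMorphism_shiftHomeo s.left.toAdd).mul (isAMorphism_dihedralSymmetry s.right)
  rw [one_mul] at this
  exact this

/-- Uniqueness of the matrix makes the dihedral part of a kernel element trivial; the remaining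
shift is trivial by strong aperiodicity. -/
theorem latticeDihedralHom_injective : Function.Injective latticeDihedralHom := by
  rw [injective_iff_map_eq_one]
  intro s hs
  have h1 := isAMorphism_latticeDihedralHom s
  rw [hs] at h1
  have h2 := h1.unique robinsonShift_stronglyAperiodic (Subshift.IsAMorphism.one _)
  rw [← map_one dihedralMatrix] at h2
  have h3 := dihedralMatrix_injective h2
  rw [latticeDihedralHom_eq, h3, map_one, mul_one] at hs
  obtain ⟨x⟩ := (inferInstance : Nonempty robinsonShift.Point)
  have h4 : robinsonShift.shift s.left.toAdd x = x :=
    congrArg (fun f : robinsonShift.extendedSymmetry => f.1 x) hs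
  have h5 := robinsonShift_stronglyAperiodic x _ h4
  exact SemidirectProduct.ext h5 h3

/-- Dividing by the dihedral symmetry with the same matrix leaves a symmetry that commutes with the
shifts, hence a shift. -/
theorem latticeDihedralHom_surjective : Function.Surjective latticeDihedralHom := by
  rintro ⟨f, A, hA⟩
  obtain ⟨d, rfl⟩ := hA.exists_dihedralMatrix
  have h1 := hA.mul (isAMorphism_dihedralSymmetry d).inv
  rw [mul_inv_cancel] at h1
  obtain ⟨k, hk⟩ := exists_eq_shift h1
  refine ⟨⟨Multiplicative.ofAdd k, d⟩, Subtype.ext (Homeomorph.ext fun x => ?_)⟩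
  change robinsonShift.shift k ((dihedralSymmetry d).1 x) = f x
  rw [← hk]
  exact congrArg f ((dihedralSymmetry d).1.symm_apply_apply x)

theorem mainTheorem6 :
    robinsonShift.StronglyAperiodic ∧
    {q : Fin 2 → ℤ | robinsonShift.HasFracture q} =
      {q | (∃ m : ℤ, q = ![m, 0]) ∨ (∃ m : ℤ, q = ![0, m])} ∧
    (∀ f : robinsonShift.extendedSymmetry,
      ∃! A : GL (Fin 2) ℤ, robinsonShift.IsAMorphism A f.1) ∧
    ∃ e : LatticeDihedral ≃* robinsonShift.extendedSymmetry,
      (∀ (k : Fin 2 → ℤ) (x : robinsonShift.Point),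
        (e (SemidirectProduct.inl (Multiplicative.ofAdd k))).1 x = robinsonShift.shift k x) ∧
      (∀ s : LatticeDihedral, robinsonShift.IsAMorphism (dihedralMatrix s.right) (e s).1) ∧
      (∀ (x : robinsonShift.Point) (v : Fin 2 → ℤ),
        ((e (SemidirectProduct.inr (DihedralGroup.r 1))).1 x).1 v = (x.1 ![v 1, -v 0]).rot) ∧
      (∀ (x : robinsonShift.Point) (v : Fin 2 → ℤ),
        ((e (SemidirectProduct.inr (DihedralGroup.sr 0))).1 x).1 v = (x.1 ![-v 0, v 1]).refl) := by
  refine ⟨robinsonShift_stronglyAperiodic, ?_, fun f => ?_,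
    MulEquiv.ofBijective latticeDihedralHom
      ⟨latticeDihedralHom_injective, latticeDihedralHom_surjective⟩,
    fun k x => ?_, isAMorphism_latticeDihedralHom, fun x v => ?_, fun x v => ?_⟩
  · ext q
    exact robinsonShift_hasFracture_iff
  · obtain ⟨A, hA⟩ := f.2
    exact ⟨A, hA, fun B hB => hB.unique robinsonShift_stronglyAperiodic hA⟩
  · change (latticeDihedralHom (SemidirectProduct.inl (Multiplicative.ofAdd k))).1 x = _
    rw [latticeDihedralHom, SemidirectProduct.lift_inl]
    rfl
  · change ((latticeDihedralHom (SemidirectProduct.inr (DihedralGroup.r 1))).1 x).1 v = _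
    rw [latticeDihedralHom, SemidirectProduct.lift_inr]
    rfl
  · change ((latticeDihedralHom (SemidirectProduct.inr (DihedralGroup.sr 0))).1 x).1 v = _
    rw [latticeDihedralHom, SemidirectProduct.lift_inr]
    rfl
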